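/- **Theorem 2.** Let $X\subset[0,1]^d$ be compact and let $D\supseteq X$ be convex (for example $D=[0,1]^d$, or $D=X$ if $X$ is convex). Let $f$ be a centred Gaussian process on $D$ with covariance kernel $k$, $k(x,x)\le 1$ for $x\in X$, whose sample paths are almost surely differentiable on $D$ and satisfy, for some constants $a,b>0$, $$\mathbb P\Big(\sup_{x\in D}\Big|\frac{\partial f(x)}{\partial x_i}\Big|>J\Big)\le a\,e^{-(J/b)^2}\qquad\text{for all }J>0,\ i\in\{1,\dots,d\}.$$ A query at $x$ returns $y=f(x)+\epsilon$, where the noises $\epsilon\sim\mathcal N(0,\eta^2)$, $\eta>0$, are i.i.d. and independent of $f$. Let $(\beta_j)_{j\ge1}$ be a non-decreasing sequence of non-negative numbers with $$\beta_j\ \ge\ 4(d+1)\log j+2d\log(d\,a\,b\sqrt{\pi})\qquad(j\ge1).$$ *Asynchronous UCB with $q$ workers.* The $j$-th query ($j=1,2,\dots$) is made as soon as a worker is free. Let $\mathcal D_j$ be the set of those among the first $j-1$ evaluations that are completed at that time; fewer than $q$ of them are not, and completed evaluations stay completed. Let $\mu_{\mathcal D_j},\sigma_{\mathcal D_j}$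 be the Gaussian process posterior mean and standard deviation given $\mathcal D_j$. The query is $$x_j\in\arg\max_{x\in X}\big(\mu_{\mathcal D_j}(x)+\sqrt{\beta_j}\,\sigma_{\mathcal D_j}(x)\big).$$ Ties are broken as a measurable function of $\mathcal D_j$, and which evaluations are completed depends only on the locations queried so far; both may also use additional randomness that is independent of $f$ and of the noises. With $I$ the Shannon mutual information and $y_A$ the noisy observations at the points of $A$ (repetitions allowed), let $\Psi_n=\sup_{A\subset X,\,|A|=n}I(f;y_A)$, and let $\xi_q\ge1$ be a constant such that, almost surely, $$\sup_{B\subset X,\ |B|<q}I(f;y_B\mid\mathcal D_j)\le\tfrac12\log\xi_q\qquad\text{for all }j\ge1,$$ where the locations in $\mathcal D_j$ are regarded as fixed. Let $\mathrm{BSR}(n)=\mathbb E\big[\max_{x\in X}f(x)-\max_{j\le n}f(x_j)\big]$. Then, for every $n\ge1$, the expectation exists and $$\mathrm{BSR}(n)\le\frac{\pi^2+\sqrt{2\pi}}{12\,n}+\sqrt{\frac{2\,\xi_q\,\beta_n\,\Psi_n}{n\log(1+\eta^{-2})}}.$$ Moreover, if $\beta_n=O(\log n)$, then there is a constant $C$,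 independent of $q$, $\xi_q$, $n$ and of the run (the schedule and the choice of maximizers), such that $\mathrm{BSR}(n)\le C\sqrt{\xi_q\,\log(n)\,\Psi_n/n}$ for all $n\ge2$. -/

import Mathlib

open MeasureTheory ProbabilityTheory Asymptotics Filter

namespace AsyncBO

/-- Euclidean space `ℝ^d`. -/
abbrev Pt (d : ℕ) := EuclideanSpace ℝ (Fin d)

noncomputable section

/-! ### Mutual information -/

section Information

variable {Ω 𝓧 𝓨 𝓩 : Type*} [MeasurableSpace Ω] [MeasurableSpace 𝓧] [MeasurableSpace 𝓨]
  [MeasurableSpace 𝓩]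

/-- Shannon mutual information `I(F ; Y)` (in nats): the Kullback-Leibler divergence of the joint
law from the product of the marginal laws. -/
def mutualInfo (P : Measure Ω) (F : Ω → 𝓧) (Y : Ω → 𝓨) : ENNReal :=
  InformationTheory.klDiv (P.map (fun ω => (F ω, Y ω))) ((P.map F).prod (P.map Y))

/-- Conditional Shannon mutual information `I(F ; Y | Z)`: the Kullback-Leibler divergence of the
joint law of `(F, Z, Y)` from the law under which `(F, Z)` has its own law and, given `(F, Z)`, the
variable `Y` is drawn from its conditional law given `Z` alone. -/
def condMutualInfo (P : Measure Ω) [IsFiniteMeasure P] [StandardBorelSpace 𝓨] [Nonempty 𝓨]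
    (F : Ω → 𝓧) (Y : Ω → 𝓨) (Z : Ω → 𝓩) : ENNReal :=
  InformationTheory.klDiv (P.map (fun ω => ((F ω, Z ω), Y ω)))
    ((P.map (fun ω => (F ω, Z ω))) ⊗ₘ (Kernel.prodMkLeft 𝓧 (condDistrib Y Z P)))

end Information

/-! ### Gaussian process regression and the UCB acquisition function -/

section Posterior

variable {d : ℕ}

/-- The matrix `K_{XX} + η² I` of the locations `x i`, `i ∈ A`. -/
def noisyGram (k : Pt d → Pt d → ℝ) (η : ℝ) (A : Finset ℕ) (x : ℕ → Pt d) : Matrix A A ℝ :=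
  Matrix.of (fun i j : A => k (x i) (x j)) + η ^ 2 • (1 : Matrix A A ℝ)

/-- The vector `k(X, z)`. -/
def kernelVec (k : Pt d → Pt d → ℝ) (A : Finset ℕ) (x : ℕ → Pt d) (z : Pt d) : A → ℝ :=
  fun i => k (x i) z

/-- Posterior mean at `z` given the data `(x i, y i)`, `i ∈ A`. -/
def postMean (k : Pt d → Pt d → ℝ) (η : ℝ) (A : Finset ℕ) (x : ℕ → Pt d) (y : ℕ → ℝ)
    (z : Pt d) : ℝ :=
  kernelVec k A x z ⬝ᵥ Matrix.mulVec (noisyGram k η A x)⁻¹ (fun i : A => y i)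

/-- Posterior variance at `z` given evaluations at the locations `x i`, `i ∈ A`. -/
def postVar (k : Pt d → Pt d → ℝ) (η : ℝ) (A : Finset ℕ) (x : ℕ → Pt d) (z : Pt d) : ℝ :=
  k z z - kernelVec k A x z ⬝ᵥ Matrix.mulVec (noisyGram k η A x)⁻¹ (kernelVec k A x z)

/-- The acquisition function `μ + √β σ`, computed from the completed evaluations only. -/
def ucb (k : Pt d → Pt d → ℝ) (η β : ℝ) (A : Finset ℕ) (x : ℕ → Pt d) (y : ℕ → ℝ)
    (z : Pt d) : ℝ :=
  postMean k η A x y z + Real.sqrt β * Real.sqrt (postVar k η A x z)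

end Posterior

/-! ### Prior, noise, exogenous randomness -/

section Model

variable {d : ℕ} {Ω W : Type*} [MeasurableSpace Ω] [MeasurableSpace W]

/-- `f` is a centred Gaussian process on `D` with covariance `k`, the observation noises `ε i` are
i.i.d. `N(0, η²)` and independent of `f`, and `w` (which drives the random part of the evaluation
times and the choice among several maximizers) is independent of `f` and of the noises. -/
structure IsModel (P : Measure Ω) (D : Set (Pt d)) (k : Pt d → Pt d → ℝ) (η : ℝ)
    (f : Pt d → Ω → ℝ) (ε : ℕ → Ω → ℝ) (w : Ω → W) : Prop where
  measurable_f : ∀ z ∈ D, Measurable (f z)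
  gaussian : IsGaussianProcess (fun (z : D) ω => f z ω) P
  mean_zero : ∀ z ∈ D, ∫ ω, f z ω ∂P = 0
  cov_eq : ∀ z ∈ D, ∀ z' ∈ D, covariance (f z) (f z') P = k z z'
  measurable_noise : ∀ i, Measurable (ε i)
  law_noise : ∀ i, P.map (ε i) = gaussianReal 0 (Real.toNNReal (η ^ 2))
  indep_noise : iIndepFun ε P
  indep_f_noise : IndepFun (fun ω (z : D) => f z ω) (fun ω i => ε i ω) P
  measurable_w : Measurable w
  indep_w : IndepFun (fun ω => ((fun z : D => f z ω), fun i => ε i ω)) w P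

/-- Sub-Gaussian tails of the partial derivatives of the sample paths on `D`: almost every path is
differentiable on `D` (with derivative `f' z ω` at `z`), and
`P(sup_{z ∈ D} |∂f/∂z_i| > J) ≤ a exp(-(J/b)²)` for all `J > 0` and every coordinate `i`. -/
def GradientTails (P : Measure Ω) (D : Set (Pt d)) (f : Pt d → Ω → ℝ) (a b : ℝ) : Prop :=
  ∃ f' : Pt d → Ω → (Pt d →L[ℝ] ℝ),
    (∀ᵐ ω ∂P, ∀ z ∈ D, HasFDerivWithinAt (fun u => f u ω) (f' z ω) D z) ∧
    ∀ i : Fin d, ∀ J : ℝ, 0 < J →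
      P {ω | ∃ z ∈ D, J < |f' z ω (EuclideanSpace.single i 1)|} ≤
        ENNReal.ofReal (a * Real.exp (-(J / b) ^ 2))

/-- The random function `f`, restricted to the search space. -/
def path (X : Set (Pt d)) (f : Pt d → Ω → ℝ) (ω : Ω) : X → ℝ := fun z => f z ω

/-- The noisy observations `f (x i) + ε i`, `i ∈ A`, at a fixed design `x`. -/
def obs (f : Pt d → Ω → ℝ) (ε : ℕ → Ω → ℝ) (A : Finset ℕ) (x : ℕ → Pt d) (ω : Ω) : A → ℝ :=
  fun i => f (x i) ω + ε i ω

/-- The maximum information gain `Ψ_n = max_{|A| = n} I(f ; y_A)`; the points of a design `A` need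
not be distinct. -/
def maxInfoGain (P : Measure Ω) (X : Set (Pt d)) (f : Pt d → Ω → ℝ) (ε : ℕ → Ω → ℝ) (n : ℕ) : ℝ :=
  (⨆ x : ℕ → X, mutualInfo P (path X f) (obs f ε (Finset.range n) (fun i => x i))).toReal

/-! ### Asynchronous UCB -/

/-- The value `y_i = f(x_i) + ε_i` returned by the `i`-th query. -/
def value (f : Pt d → Ω → ℝ) (ε : ℕ → Ω → ℝ) (x : ℕ → Ω → Pt d) (i : ℕ) (ω : Ω) : ℝ :=
  f (x i ω) ω + ε i ω

/-- A run of asynchronous UCB with `q` workers on the search space `X`. Acquisitions are numbered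
from `0`, so that acquisition `j` uses the parameter `β (j + 1)`. `x j` is the location of
acquisition `j`, and `A j` is the set of earlier acquisitions whose evaluation is completed when
acquisition `j` is made. -/
structure IsAsyncUCB (X : Set (Pt d)) (k : Pt d → Pt d → ℝ) (η : ℝ) (β : ℕ → ℝ) (q : ℕ)
    (f : Pt d → Ω → ℝ) (ε : ℕ → Ω → ℝ) (w : Ω → W)
    (A : ℕ → Ω → Finset ℕ) (x : ℕ → Ω → Pt d) : Prop where
  /-- only earlier queries can be completed -/
  completed_subset : ∀ j ω, A j ω ⊆ Finset.range j
  /-- completed evaluations stay completed -/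
  completed_mono : ∀ j ω, A j ω ⊆ A (j + 1) ω
  /-- one worker is free, so fewer than `q` evaluations are pending -/
  pending_lt : ∀ j ω, (Finset.range j \ A j ω).card < q
  /-- which evaluations are completed depends only on the locations queried so far and on the
  exogenous randomness -/
  schedule : ∀ j, ∃ S : W → (ℕ → Pt d) → Finset ℕ,
    (∀ B, MeasurableSet {p : W × (ℕ → Pt d) | S p.1 p.2 = B}) ∧
    ∀ ω, A j ω = S (w ω) (fun i => if i < j then x i ω else 0)
  /-- the location is computed from the completed data and the exogenous randomness -/
  nonanticipating : ∀ j, ∃ R : Finset ℕ → W → (ℕ → Pt d × ℝ) → Pt d,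
    (∀ B, Measurable (fun p : W × (ℕ → Pt d × ℝ) => R B p.1 p.2)) ∧
    ∀ ω, x j ω = R (A j ω) (w ω) (fun i => if i ∈ A j ω then (x i ω, value f ε x i ω) else (0, 0))
  /-- queries lie in the search space -/
  mem : ∀ j ω, x j ω ∈ X
  /-- the location maximizes the acquisition function -/
  isMaxOn : ∀ j ω, IsMaxOn
    (ucb k η (β (j + 1)) (A j ω) (fun i => x i ω) (fun i => value f ε x i ω)) X (x j ω)

/-- `max_{B, |B| < q} I(f ; y_B | D_j) ≤ (1/2) log ξ` at every acquisition `j` of the run, where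
`D_j` are the evaluations completed at that time and `B` ranges over the designs of fewer than `q`
further points of `X`. (`ω` fixes the locations in `D_j`; the information is that of fresh
evaluations at these fixed locations. `B` empty forces `1 ≤ ξ`.) -/
def PendingInfoBound (P : Measure Ω) [IsFiniteMeasure P] (X : Set (Pt d)) (q : ℕ)
    (f : Pt d → Ω → ℝ) (ε : ℕ → Ω → ℝ) (A : ℕ → Ω → Finset ℕ) (x : ℕ → Ω → Pt d) (ξ : ℝ) : Prop :=
  1 ≤ ξ ∧ ∀ j, ∀ᵐ ω ∂P, ∀ B : Finset ℕ, Disjoint B (A j ω) → B.card < q →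
    ∀ u : ℕ → X,
      condMutualInfo P (path X f) (obs f ε B (fun i => u i)) (obs f ε (A j ω) (fun i => x i ω)) ≤
        ENNReal.ofReal (1 / 2 * Real.log ξ)

/-- `f(x^*) - max_{j ≤ n} f(x_j)` with `f(x^*) = max_X f`. -/
def simpleRegret (X : Set (Pt d)) (f : Pt d → Ω → ℝ) (x : ℕ → Ω → Pt d) (n : ℕ) (ω : Ω) : ℝ :=
  (⨆ z : X, f z ω) - ⨆ j : Fin n, f (x j ω) ω

/-- The Bayes simple regret after `n` queries. -/
def bayesSimpleRegret (P : Measure Ω) (X : Set (Pt d)) (f : Pt d → Ω → ℝ) (x : ℕ → Ω → Pt d)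
    (n : ℕ) : ℝ :=
  ∫ ω, simpleRegret X f x n ω ∂P

end Model

end

end AsyncBO

set_option linter.unusedSectionVars false

/-! Fix an acquisition `j` and let `μ`, `σ` be the posterior mean and standard deviation given the
completed data. Given these data, `f z` is Gaussian with mean `μ z` and variance `σ z ^ 2` at every
point `z` computed from them, in particular at the query `x j`. Since `x j` maximizes `μ + √β σ`
over `X`, for every `z` in `X` the difference `f z - f (x j)` is at most the excess of `f z` over
its upper confidence bound, plus the bonus `√β σ (x j)`, minus the prediction error at `x j`, which
has mean zero.

The supremum over `z` is reached through a grid of at most `N ^ d` points of `X`. Passing to the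
grid costs `L / N`, where `L` is a random Lipschitz constant with `E L ≤ θ / 2` and `θ = d a b √π`;
each grid point has expected excess at most `exp (-β / 2) / (e √β)`. With `N = ⌊θ J ^ 2⌋` for the
`J`-th query, the lower bound on `β` makes the two costs together at most `1 / J ^ 2`; when `θ J ^ 2
< 2`, comparison with a single point suffices (`expectedGap_le`, `expectedGap_le_grid`,
`gap_error_le`). The simple regret is at most each of the gaps, hence at most their average. The
series of `1 / J ^ 2` alone exceeds the constant of the theorem, so the first query needs care: for
small `θ` its gap is at most `θ / 2` plus its bonus, and for `θ > 1` the last query is counted twice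
in its place (`sum_gap_le`). The latter is possible because the first query has the largest prior
variance, which dominates the posterior variance of the last query.

For the bonuses, one further observation divides a posterior variance by at most `1 + σ ^ 2 / η ^
2`, the exponential of twice the information it brings. Hence the pending evaluations change the
variance by a factor of at most `ξ` (`postVar_le_mul_of_condMutualInfo_le`). With all earlier points
regarded as observed, the chain rule for information bounds the sum of the variances by `2 Ψ_n / log
(1 + η⁻²)`, and Cauchy-Schwarz bounds the sum of the deviations.

The delicate point is the posterior law under an adaptive, asynchronous design. Observations with an
adapted drift have the product of the one-step Gaussian density ratios as density relative to pure
noise (`lintegral_adaptive`). Once the observed values and the exogenous randomness are frozen, the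
design is fixed and this density is the likelihood of a fixed design. Bayes' rule for fixed designs,
proved for every value of the observations (`lintegral_mul_likelihood`), then applies inside the
integral. Asynchrony is handled by splitting according to the completed set `B` and coupling with a
run that observes only the values in `B` (`restricted_run_eq`, `posterior_law`). -/

namespace AsyncBO

/-! ### Posterior variance as a squared distance -/

/-- The weights of the observations in the posterior mean at `z`. -/
noncomputable def postCoef {d : ℕ} (k : Pt d → Pt d → ℝ) (η : ℝ) (A : Finset ℕ) (x : ℕ → Pt d)
    (z : Pt d) : A → ℝ :=
  Matrix.mulVec (noisyGram k η A x)⁻¹ (kernelVec k A x z)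

/-- A feature map `φ` for the kernel `k` on `D`, together with orthogonal noise vectors `e i` of
norm `η`. -/
structure IsFeature {d : ℕ} {H : Type*} [NormedAddCommGroup H] [InnerProductSpace ℝ H]
    (D : Set (Pt d)) (k : Pt d → Pt d → ℝ) (η : ℝ) (φ : Pt d → H) (e : ℕ → H) : Prop where
  inner_feature : ∀ z ∈ D, ∀ z' ∈ D, inner ℝ (φ z) (φ z') = k z z'
  inner_feature_noise : ∀ z ∈ D, ∀ i, inner ℝ (φ z) (e i) = 0
  inner_noise : ∀ i j, inner ℝ (e i) (e j) = if i = j then η ^ 2 else 0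

section Feature

variable {d : ℕ} {H : Type*} [NormedAddCommGroup H] [InnerProductSpace ℝ H]
  {D : Set (Pt d)} {k : Pt d → Pt d → ℝ} {η : ℝ} {φ : Pt d → H} {e : ℕ → H}
  {A : Finset ℕ} {x : ℕ → Pt d} {z : Pt d}

lemma IsFeature.inner_obs (h : IsFeature D k η φ e) (hx : ∀ i, x i ∈ D) (i j : ℕ) :
    inner ℝ (φ (x i) + e i) (φ (x j) + e j) = k (x i) (x j) + if i = j then η ^ 2 else 0 := by
  rw [inner_add_left, inner_add_right, inner_add_right, h.inner_feature _ (hx i) _ (hx j),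
    h.inner_feature_noise _ (hx i), real_inner_comm, h.inner_feature_noise _ (hx j),
    h.inner_noise]
  ring

lemma IsFeature.noisyGram_apply (h : IsFeature D k η φ e) (hx : ∀ i, x i ∈ D) (i j : A) :
    noisyGram k η A x i j = inner ℝ (φ (x i) + e i) (φ (x j) + e j) := by
  rw [h.inner_obs hx]
  simp only [noisyGram, Matrix.add_apply, Matrix.of_apply, Matrix.smul_apply, Matrix.one_apply,
    Subtype.ext_iff, smul_eq_mul]
  split_ifs <;> simp

lemma IsFeature.kernelVec_apply (h : IsFeature D k η φ e) (hx : ∀ i, x i ∈ D) (hz : z ∈ D)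
    (i : A) : kernelVec k A x z i = inner ℝ (φ (x i) + e i) (φ z) := by
  rw [inner_add_left, h.inner_feature _ (hx i) _ hz, real_inner_comm (φ z),
    h.inner_feature_noise _ hz, add_zero, kernelVec]

/-- The matrix is the Gram matrix of the vectors `φ (x i) + e i`. A kernel vector gives a vanishing
combination of them, and pairing this combination with `e i` isolates `v i * η ^ 2`. -/
lemma IsFeature.isUnit_det_noisyGram (h : IsFeature D k η φ e) (hη : 0 < η)
    (hx : ∀ i, x i ∈ D) : IsUnit (noisyGram k η A x).det := by
  rw [← Matrix.isUnit_iff_isUnit_det, ← Matrix.mulVec_injective_iff_isUnit]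
  have key : ∀ v : A → ℝ, Matrix.mulVec (noisyGram k η A x) v = 0 → v = 0 := by
    intro v hv
    have h1 : inner ℝ (∑ i : A, v i • (φ (x i) + e i)) (∑ i : A, v i • (φ (x i) + e i)) = 0 := by
      rw [sum_inner]
      refine Finset.sum_eq_zero fun i _ => ?_
      have := congrFun hv i
      rw [Matrix.mulVec, dotProduct] at this
      rw [inner_smul_left, inner_sum]
      simp only [inner_smul_right]
      have h2 : ∑ j : A, v j * inner ℝ (φ (x i) + e i) (φ (x j) + e j) = 0 := by
        rw [← Pi.zero_apply (M := fun _ => ℝ) i, ← this]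
        refine Finset.sum_congr rfl fun j _ => ?_
        rw [h.noisyGram_apply hx, mul_comm]
      rw [h2, mul_zero]
    have h3 : ∑ i : A, v i • (φ (x i) + e i) = 0 := inner_self_eq_zero.mp h1
    funext i
    have h4 : inner ℝ (e i) (∑ i : A, v i • (φ (x i) + e i)) = v i * η ^ 2 := by
      rw [inner_sum, Finset.sum_eq_single i]
      · rw [inner_smul_right, inner_add_right, real_inner_comm, h.inner_feature_noise _ (hx i),
          h.inner_noise]
        simp
      · intro j _ hj
        rw [inner_smul_right, inner_add_right, real_inner_comm, h.inner_feature_noise _ (hx j),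
          h.inner_noise, if_neg (fun hc => hj (Subtype.ext hc.symm))]
        simp
      · simp
    rw [h3, inner_zero_right] at h4
    have : η ^ 2 ≠ 0 := by positivity
    simpa [this] using h4.symm
  intro v w hvw
  have := key (v - w) (by rw [Matrix.mulVec_sub]; exact sub_eq_zero.mpr hvw)
  exact sub_eq_zero.mp this

/-- The prediction error of the posterior mean. -/
noncomputable def residual (k : Pt d → Pt d → ℝ) (η : ℝ) (φ : Pt d → H) (e : ℕ → H)
    (A : Finset ℕ) (x : ℕ → Pt d) (z : Pt d) : H :=
  φ z - ∑ i : A, postCoef k η A x z i • (φ (x i) + e i)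

/-- These are the normal equations: the posterior weights solve the Gram system, so the residual is
orthogonal to every observation vector. -/
lemma IsFeature.inner_residual (h : IsFeature D k η φ e) (hη : 0 < η) (hx : ∀ i, x i ∈ D)
    (hz : z ∈ D) (i : A) : inner ℝ (φ (x i) + e i) (residual k η φ e A x z) = 0 := by
  rw [residual, inner_sub_right, inner_sum]
  have h1 : Matrix.mulVec (noisyGram k η A x) (postCoef k η A x z) = kernelVec k A x z := by
    rw [postCoef, Matrix.mulVec_mulVec, Matrix.mul_nonsing_inv _ (h.isUnit_det_noisyGram hη hx),
      Matrix.one_mulVec]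
  have h2 := congrFun h1 i
  rw [Matrix.mulVec, dotProduct, h.kernelVec_apply hx hz] at h2
  rw [← h2, sub_eq_zero]
  refine Finset.sum_congr rfl fun j _ => ?_
  rw [inner_smul_right, h.noisyGram_apply hx, mul_comm]

lemma IsFeature.inner_sum_residual (h : IsFeature D k η φ e) (hη : 0 < η) (hx : ∀ i, x i ∈ D)
    (hz : z ∈ D) (c : A → ℝ) :
    inner ℝ (∑ i : A, c i • (φ (x i) + e i)) (residual k η φ e A x z) = 0 := by
  rw [sum_inner]
  refine Finset.sum_eq_zero fun i _ => ?_
  rw [inner_smul_left, h.inner_residual hη hx hz, mul_zero]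

lemma IsFeature.postVar_eq (h : IsFeature D k η φ e) (hη : 0 < η) (hx : ∀ i, x i ∈ D)
    (hz : z ∈ D) : postVar k η A x z = ‖residual k η φ e A x z‖ ^ 2 := by
  have h1 := h.inner_sum_residual hη hx hz (postCoef k η A x z)
  rw [← real_inner_self_eq_norm_sq]
  nth_rewrite 1 [residual]
  rw [inner_sub_left, h1, sub_zero, residual, inner_sub_right, h.inner_feature _ hz _ hz, postVar,
    inner_sum, dotProduct]
  congr 1
  refine Finset.sum_congr rfl fun i _ => ?_
  rw [h.kernelVec_apply hx hz, inner_smul_right, real_inner_comm, mul_comm]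
  rfl

/-- Pythagoras: the posterior mean is the orthogonal projection onto the span of the observations,
so every other linear predictor has at least its error. -/
lemma IsFeature.postVar_le (h : IsFeature D k η φ e) (hη : 0 < η) (hx : ∀ i, x i ∈ D)
    (hz : z ∈ D) (c : A → ℝ) :
    postVar k η A x z ≤ ‖φ z - ∑ i : A, c i • (φ (x i) + e i)‖ ^ 2 := by
  have h1 : φ z - ∑ i : A, c i • (φ (x i) + e i) = residual k η φ e A x z +
      ∑ i : A, (postCoef k η A x z i - c i) • (φ (x i) + e i) := by
    simp only [residual, sub_smul, Finset.sum_sub_distrib]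
    abel
  have h2 := h.inner_sum_residual hη hx hz (fun i => postCoef k η A x z i - c i)
  rw [h1, norm_add_sq_real, real_inner_comm, h2, h.postVar_eq hη hx hz]
  nlinarith [sq_nonneg ‖∑ i : A, (postCoef k η A x z i - c i) • (φ (x i) + e i)‖]

lemma IsFeature.postVar_nonneg (h : IsFeature D k η φ e) (hη : 0 < η) (hx : ∀ i, x i ∈ D)
    (hz : z ∈ D) : 0 ≤ postVar k η A x z := by
  rw [h.postVar_eq hη hx hz]; positivity

lemma IsFeature.postVar_le_prior (h : IsFeature D k η φ e) (hη : 0 < η) (hx : ∀ i, x i ∈ D)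
    (hz : z ∈ D) : postVar k η A x z ≤ k z z := by
  refine (h.postVar_le hη hx hz (fun _ => 0)).trans ?_
  rw [← h.inner_feature _ hz _ hz, real_inner_self_eq_norm_sq]
  simp

lemma IsFeature.postMean_eq (h : IsFeature D k η φ e) (hx : ∀ i, x i ∈ D)
    (y : ℕ → ℝ) : postMean k η A x y z = ∑ i : A, postCoef k η A x z i * y i := by
  have hs : (noisyGram k η A x).IsSymm := by
    ext i j
    rw [Matrix.transpose_apply, h.noisyGram_apply hx, h.noisyGram_apply hx, real_inner_comm]
  rw [postMean, Matrix.dotProduct_mulVec, ← Matrix.mulVec_transpose, Matrix.transpose_nonsing_inv,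
    hs.eq, postCoef, dotProduct]

/-- One further evaluation shrinks the posterior variance by a bounded factor only. -/
lemma IsFeature.postVar_le_insert (h : IsFeature D k η φ e) (hη : 0 < η) (hx : ∀ i, x i ∈ D)
    (hz : z ∈ D) {i : ℕ} (hi : i ∉ A) :
    postVar k η A x z ≤ (1 + postVar k η A x (x i) / η ^ 2) * postVar k η (insert i A) x z := by
  set c := postCoef k η (insert i A) x z with hc
  set t := c ⟨i, Finset.mem_insert_self i A⟩ with ht
  set c' : A → ℝ := fun j => c ⟨j, Finset.mem_insert_of_mem j.2⟩ with hc'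
  set s := postCoef k η A x (x i) with hs
  -- The optimal residual for the enlarged design is `V - t • e i`, and `e i` is orthogonal to `V`
  -- because `i ∉ A`.
  set V := φ z - t • φ (x i) - ∑ j : A, c' j • (φ (x j) + e j) with hV
  have hsum : ∑ j : ↥(insert i A), c j • (φ (x j) + e j) =
      t • (φ (x i) + e i) + ∑ j : A, c' j • (φ (x j) + e j) := by
    let F : ℕ → H := fun j => if hj : j ∈ insert i A then c ⟨j, hj⟩ • (φ (x j) + e j) else 0
    have h1 : ∑ j : ↥(insert i A), c j • (φ (x j) + e j) = ∑ j ∈ insert i A, F j := by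
      rw [← Finset.sum_coe_sort (insert i A) F]
      refine Finset.sum_congr rfl fun j _ => ?_
      simp only [F, dif_pos j.2]
    have h2 : ∑ j : A, c' j • (φ (x j) + e j) = ∑ j ∈ A, F j := by
      rw [← Finset.sum_coe_sort A F]
      refine Finset.sum_congr rfl fun j _ => ?_
      simp only [F, dif_pos (Finset.mem_insert_of_mem j.2), c']
    rw [h1, h2, Finset.sum_insert hi]
    simp only [F, dif_pos (Finset.mem_insert_self i A), t]
  have hres : residual k η φ e (insert i A) x z = V - t • e i := by
    rw [residual, ← hc, hsum, hV, smul_add]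
    abel
  have horth : inner ℝ V (e i) = 0 := by
    rw [hV, inner_sub_left, inner_sub_left, h.inner_feature_noise _ hz, inner_smul_left,
      h.inner_feature_noise _ (hx i), sum_inner]
    rw [Finset.sum_eq_zero]
    · simp
    · intro j _
      rw [inner_smul_left, inner_add_left, h.inner_feature_noise _ (hx j), h.inner_noise,
        if_neg (fun hji : (j : ℕ) = i => hi (hji ▸ j.2))]
      simp
  have hnew : postVar k η (insert i A) x z = ‖V‖ ^ 2 + t ^ 2 * η ^ 2 := by
    rw [h.postVar_eq hη hx hz, hres, norm_sub_sq_real, inner_smul_right, horth, norm_smul,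
      mul_pow, ← real_inner_self_eq_norm_sq (e i), h.inner_noise]
    simp
  -- Replacing `φ (x i)` inside `V` by its prediction from `A` gives an admissible predictor for the
  -- smaller design, whose error exceeds that of `V` by at most `|t|` times the residual at `x i`.
  have hdist : ‖residual k η φ e A x z‖ ≤ ‖V‖ + |t| * ‖residual k η φ e A x (x i)‖ := by
    have h1 : postVar k η A x z ≤ ‖V + t • residual k η φ e A x (x i)‖ ^ 2 := by
      have h2 : V + t • residual k η φ e A x (x i) =
          φ z - ∑ j : A, (c' j + t * s j) • (φ (x j) + e j) := by
        simp only [hV, residual, smul_sub, Finset.smul_sum, smul_smul, add_smul,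
          Finset.sum_add_distrib, ← hs]
        abel
      rw [h2]
      exact h.postVar_le hη hx hz _
    rw [h.postVar_eq hη hx hz] at h1
    have h3 := (sq_le_sq₀ (norm_nonneg _) (norm_nonneg _)).mp h1
    refine h3.trans ((norm_add_le _ _).trans ?_)
    rw [norm_smul, Real.norm_eq_abs]
  rw [hnew, h.postVar_eq hη hx hz, h.postVar_eq hη hx (hx i)]
  set a := ‖residual k η φ e A x z‖
  set b := ‖residual k η φ e A x (x i)‖
  have ha : 0 ≤ a := norm_nonneg _
  have hb : 0 ≤ b := norm_nonneg _
  have hη2 : 0 < η ^ 2 := by positivity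
  have h1 : a ^ 2 ≤ (‖V‖ + |t| * b) ^ 2 := pow_le_pow_left₀ ha hdist 2
  -- Cauchy-Schwarz for the pairs `(1, b / η)` and `(‖V‖, |t| * η)`; the defect is an explicit
  -- square.
  have h2 : (‖V‖ + |t| * b) ^ 2 ≤ (1 + b ^ 2 / η ^ 2) * (‖V‖ ^ 2 + t ^ 2 * η ^ 2) := by
    have h3 : (1 + b ^ 2 / η ^ 2) * (‖V‖ ^ 2 + t ^ 2 * η ^ 2) - (‖V‖ + |t| * b) ^ 2 =
        (b / η * ‖V‖ - |t| * η) ^ 2 := by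
      have : t ^ 2 = |t| ^ 2 := (sq_abs t).symm
      rw [this]
      field_simp
      ring
    nlinarith [sq_nonneg (b / η * ‖V‖ - |t| * η)]
  exact h1.trans h2

end Feature

/-! ### Change of measure for adaptive observations -/

/-- Density at `u` of `N(h, η²)` with respect to `N(0, η²)`. -/
noncomputable def tilt (η h u : ℝ) : ℝ := Real.exp (h * u / η ^ 2 - h ^ 2 / (2 * η ^ 2))

lemma tilt_pos (η h u : ℝ) : 0 < tilt η h u := Real.exp_pos _

@[fun_prop]
lemma measurable_tilt (η : ℝ) : Measurable (fun p : ℝ × ℝ => tilt η p.1 p.2) := by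
  unfold tilt; fun_prop

/-- The law of one observation noise. -/
noncomputable abbrev noiseLaw (η : ℝ) : Measure ℝ := gaussianReal 0 (Real.toNNReal (η ^ 2))

lemma gaussianReal_eq_withDensity_tilt {η : ℝ} (hη : 0 < η) (c : ℝ) :
    gaussianReal c (Real.toNNReal (η ^ 2)) =
      (noiseLaw η).withDensity (fun t => ENNReal.ofReal (tilt η c t)) := by
  have hv : Real.toNNReal (η ^ 2) ≠ 0 := by
    rw [Ne, Real.toNNReal_eq_zero, not_le]; positivity
  rw [noiseLaw, gaussianReal_of_var_ne_zero _ hv, gaussianReal_of_var_ne_zero _ hv,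
    ← withDensity_mul _ (measurable_gaussianPDF _ _)
      (by unfold tilt; fun_prop)]
  congr 1
  funext t
  rw [Pi.mul_apply, gaussianPDF, gaussianPDF, ← ENNReal.ofReal_mul (gaussianPDFReal_nonneg _ _ _),
    gaussianPDFReal, gaussianPDFReal, tilt, mul_assoc (_)⁻¹, ← Real.exp_add,
    Real.coe_toNNReal _ (by positivity)]
  congr 3
  field_simp
  ring

lemma lintegral_add_noiseLaw {η : ℝ} (hη : 0 < η) (c : ℝ) {G : ℝ → ENNReal} (hG : Measurable G) :
    ∫⁻ t, G (t + c) ∂(noiseLaw η) = ∫⁻ t, G t * ENNReal.ofReal (tilt η c t) ∂(noiseLaw η) := by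
  have h1 : (noiseLaw η).map (· + c) = gaussianReal c (Real.toNNReal (η ^ 2)) := by
    rw [noiseLaw, gaussianReal_map_add_const, zero_add]
  have h2 : ∫⁻ t, G (t + c) ∂(noiseLaw η) = ∫⁻ t, G t ∂((noiseLaw η).map (· + c)) :=
    (lintegral_map hG (by fun_prop)).symm
  rw [h2, h1, gaussianReal_eq_withDensity_tilt hη,
    lintegral_withDensity_eq_lintegral_mul _ (by unfold tilt; fun_prop) hG]
  refine lintegral_congr fun t => ?_
  rw [Pi.mul_apply, mul_comm]

section Adaptive

variable {ι : Type*} [Fintype ι] [LinearOrder ι] {η : ℝ} {c : ι → (ι → ℝ) → ℝ}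

/-- As `b` does not see coordinate `a`, integrating over that coordinate alone leaves a shift of a
one-dimensional Gaussian by a constant. -/
lemma lintegral_shift_coordinate (hη : 0 < η) (a : ι) {b : (ι → ℝ) → ℝ} (hb : Measurable b)
    (hba : ∀ u t, b (Function.update u a t) = b u) {H : (ι → ℝ) → ENNReal} (hH : Measurable H) :
    ∫⁻ u, H (Function.update u a (u a + b u)) ∂(Measure.pi fun _ => noiseLaw η) =
      ∫⁻ u, H u * ENNReal.ofReal (tilt η (b u) (u a)) ∂(Measure.pi fun _ => noiseLaw η) := by
  have hm : Measurable fun u : ι → ℝ => Function.update u a (u a + b u) := by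
    rw [measurable_pi_iff]
    intro i
    by_cases hi : i = a
    · subst hi; simp only [Function.update_self]; fun_prop
    · simp only [Function.update_of_ne hi]; fun_prop
  have hm2 : Measurable fun u : ι → ℝ => ENNReal.ofReal (tilt η (b u) (u a)) :=
    ENNReal.measurable_ofReal.comp ((measurable_tilt η).comp (hb.prodMk (measurable_pi_apply a)))
  refine lintegral_eq_of_lmarginal_eq (μ := fun _ : ι => noiseLaw η) {a} (hH.comp hm)
    (hH.mul hm2) ?_
  rw [lmarginal_singleton, lmarginal_singleton]
  funext u
  simp only [Function.update_idem, Function.update_self, hba]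
  exact lintegral_add_noiseLaw hη (b u) (G := fun t => H (Function.update u a t))
    (hH.comp (measurable_update u))

/-- If `Y` adds to each noise a drift which depends only on the earlier values of `Y`, then `Y` has
the product of the density ratios as density with respect to the law of the noises. -/
theorem lintegral_adaptive (hη : 0 < η) (hc : ∀ i, Measurable (c i))
    (hadapt : ∀ i u u', (∀ l < i, u l = u' l) → c i u = c i u') {Y : (ι → ℝ) → ι → ℝ}
    (hY : ∀ e i, Y e i = e i + c i (Y e)) {G : (ι → ℝ) → ENNReal} (hG : Measurable G) :
    ∫⁻ e, G (Y e) ∂(Measure.pi fun _ => noiseLaw η) =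
      ∫⁻ u, G u * ∏ i, ENNReal.ofReal (tilt η (c i u) (u i)) ∂(Measure.pi fun _ => noiseLaw η) := by
  -- Induction over initial segments `s`: coordinates in `s` already carry the observations, the
  -- others still carry pure noise.
  have key : ∀ s : Finset ι, (∀ m ∈ s, ∀ l < m, l ∈ s) → ∀ G : (ι → ℝ) → ENNReal, Measurable G →
      ∫⁻ e, G (fun i => if i ∈ s then Y e i else e i) ∂(Measure.pi fun _ => noiseLaw η) =
      ∫⁻ u, G u * ∏ i ∈ s, ENNReal.ofReal (tilt η (c i u) (u i))
        ∂(Measure.pi fun _ => noiseLaw η) := by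
    intro s
    induction s using Finset.induction_on_max with
    | empty => intro _ G _; simp
    | insert a s has ih =>
      intro hs G hG
      have hans : a ∉ s := fun h => lt_irrefl _ (has a h)
      have hlow : ∀ l, l < a → l ∈ s := fun l hl =>
        (Finset.mem_insert.mp (hs a (Finset.mem_insert_self a s) l hl)).resolve_left hl.ne
      have hsl : ∀ m ∈ s, ∀ l < m, l ∈ s := fun m hm l hl => hlow l (hl.trans (has m hm))
      have hba : ∀ i ≤ a, ∀ (u : ι → ℝ) (t : ℝ), c i (Function.update u a t) = c i u :=
        fun i hi u t => hadapt i _ _ fun l hl =>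
          Function.update_of_ne (hl.trans_le hi).ne _ _
      -- Adding the largest index `a` applies one more shift. Its drift depends only on coordinates
      -- in `s`, and the earlier drifts do not see coordinate `a`, so their density factors pass
      -- through unchanged.
      set F : (ι → ℝ) → ι → ℝ := fun u => Function.update u a (u a + c a u) with hF
      have hFm : Measurable F := by
        rw [measurable_pi_iff]
        intro i
        by_cases hi : i = a
        · subst hi; simp only [hF, Function.update_self]; have := hc i; fun_prop
        · simp only [hF, Function.update_of_ne hi]; fun_prop
      have h1 : ∀ e, (fun i => if i ∈ insert a s then Y e i else e i) =
          F (fun i => if i ∈ s then Y e i else e i) := by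
        intro e
        funext i
        by_cases hi : i = a
        · subst hi
          simp only [hF, Finset.mem_insert_self, if_true, Function.update_self, if_neg hans]
          rw [hY]
          congr 1
          refine hadapt i _ _ fun l hl => ?_
          rw [if_pos (hlow l hl)]
        · simp [hF, hi]
      simp only [h1]
      rw [ih hsl (fun u => G (F u)) (hG.comp hFm)]
      have hm3 : ∀ i, Measurable fun u : ι → ℝ => ENNReal.ofReal (tilt η (c i u) (u i)) :=
        fun i => ENNReal.measurable_ofReal.comp
          ((measurable_tilt η).comp ((hc i).prodMk (measurable_pi_apply i)))
      have h2 : ∀ u, G (F u) * ∏ i ∈ s, ENNReal.ofReal (tilt η (c i u) (u i)) =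
          (fun u => G u * ∏ i ∈ s, ENNReal.ofReal (tilt η (c i u) (u i)))
            (Function.update u a (u a + c a u)) := by
        intro u
        simp only [hF]
        congr 1
        refine Finset.prod_congr rfl fun i hi => ?_
        rw [hba i (has i hi).le, Function.update_of_ne (has i hi).ne]
      simp only [h2]
      rw [lintegral_shift_coordinate hη a (hc a) (hba a le_rfl)
        (H := fun u => G u * ∏ i ∈ s, ENNReal.ofReal (tilt η (c i u) (u i)))
        (hG.mul (Finset.measurable_prod _ fun i _ => hm3 i))]
      refine lintegral_congr fun u => ?_
      rw [Finset.prod_insert hans]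
      ring
  simpa only [Finset.mem_univ, if_true] using key Finset.univ (fun _ _ _ _ => Finset.mem_univ _) G hG

/-- Solution of the recursion `Y i = e i + c i Y` for an adapted drift `c`. -/
noncomputable def driftSolution (c : ι → (ι → ℝ) → ℝ) (e : ι → ℝ) : ι → ℝ :=
  (fun u i => e i + c i u)^[Fintype.card ι] e

/-- A coordinate is stable once the number of iterations exceeds the number of its predecessors, so
`Fintype.card ι` iterations settle all of them. -/
lemma driftSolution_apply (hadapt : ∀ i u u', (∀ l < i, u l = u' l) → c i u = c i u')
    (e : ι → ℝ) (i : ι) : driftSolution c e i = e i + c i (driftSolution c e) := by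
  set Φ : (ι → ℝ) → ι → ℝ := fun u i => e i + c i u with hΦ
  have key : ∀ m i, (Finset.univ.filter (· < i)).card < m → ∀ m', m ≤ m' →
      Φ^[m'] e i = Φ^[m] e i := by
    intro m
    induction m with
    | zero => intro i hi; omega
    | succ m ih =>
      intro i hi m' hm'
      obtain ⟨p, rfl⟩ : ∃ p, m' = p + 1 := ⟨m' - 1, by omega⟩
      rw [Function.iterate_succ_apply', Function.iterate_succ_apply']
      simp only [hΦ]
      congr 1
      refine hadapt i _ _ fun l hl => ih l ?_ p (by omega)
      refine lt_of_lt_of_le (Finset.card_lt_card ?_) (Nat.lt_succ_iff.mp hi)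
      refine ⟨fun j hj => ?_, fun h => ?_⟩
      · simp only [Finset.mem_filter, Finset.mem_univ, true_and] at hj ⊢
        exact hj.trans hl
      · have := h (Finset.mem_filter.mpr ⟨Finset.mem_univ _, hl⟩)
        simp at this
  have h1 := key (Fintype.card ι) i
    (Finset.card_lt_univ_of_notMem (x := i) (by simp)) (Fintype.card ι + 1) (by omega)
  rw [Function.iterate_succ_apply'] at h1
  exact h1.symm

omit [LinearOrder ι] in
lemma measurable_driftSolution {S : Type*} [MeasurableSpace S] {c : S → ι → (ι → ℝ) → ℝ}
    (hc : ∀ i, Measurable fun p : S × (ι → ℝ) => c p.1 i p.2) :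
    Measurable fun p : S × (ι → ℝ) => driftSolution (c p.1) p.2 := by
  have : ∀ m, Measurable fun p : S × (ι → ℝ) => (fun u i => p.2 i + c p.1 i u)^[m] p.2 := by
    intro m
    induction m with
    | zero => exact measurable_snd
    | succ m ih =>
      simp only [Function.iterate_succ_apply']
      rw [measurable_pi_iff]
      intro i
      exact (by fun_prop : Measurable fun p : S × (ι → ℝ) => p.2 i).add
        ((hc i).comp (measurable_fst.prodMk ih))
  exact this _

/-- Change of measure for adaptive observations of a random element `U` which is independent of the
noises `E`. -/
theorem lintegral_adaptive_of_indepFun {Ω S : Type*} [MeasurableSpace Ω] [MeasurableSpace S]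
    {P : Measure Ω} [IsProbabilityMeasure P] (hη : 0 < η) {U : Ω → S} (hU : Measurable U)
    {E : Ω → ι → ℝ} (hE : Measurable E) (hlaw : P.map E = Measure.pi fun _ => noiseLaw η)
    (hind : IndepFun U E P) {c : S → ι → (ι → ℝ) → ℝ}
    (hc : ∀ i, Measurable fun p : S × (ι → ℝ) => c p.1 i p.2)
    (hadapt : ∀ s i u u', (∀ l < i, u l = u' l) → c s i u = c s i u')
    {G : S × (ι → ℝ) → ENNReal} (hG : Measurable G) :
    ∫⁻ ω, G (U ω, driftSolution (c (U ω)) (E ω)) ∂P =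
      ∫⁻ ω, ∫⁻ u, G (U ω, u) * ∏ i, ENNReal.ofReal (tilt η (c (U ω) i u) (u i))
        ∂(Measure.pi fun _ => noiseLaw η) ∂P := by
  have hm : Measurable fun p : S × (ι → ℝ) => G (p.1, driftSolution (c p.1) p.2) :=
    hG.comp (measurable_fst.prodMk (measurable_driftSolution hc))
  have hm2 : Measurable fun p : S × (ι → ℝ) =>
      G (p.1, p.2) * ∏ i, ENNReal.ofReal (tilt η (c p.1 i p.2) (p.2 i)) :=
    (hG.comp (measurable_fst.prodMk measurable_snd)).mul
      (Finset.measurable_prod _ fun i _ => ENNReal.measurable_ofReal.comp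
        ((measurable_tilt η).comp ((hc i).prodMk (by fun_prop))))
  have h1 : P.map (fun ω => (U ω, E ω)) = (P.map U).prod (Measure.pi fun _ => noiseLaw η) := by
    rw [← hlaw]
    exact (indepFun_iff_map_prod_eq_prod_map_map hU.aemeasurable hE.aemeasurable).mp hind
  have h2 : ∫⁻ ω, G (U ω, driftSolution (c (U ω)) (E ω)) ∂P =
      ∫⁻ p, G (p.1, driftSolution (c p.1) p.2) ∂(P.map (fun ω => (U ω, E ω))) :=
    (lintegral_map hm (hU.prodMk hE)).symm
  rw [h2, h1, lintegral_prod _ hm.aemeasurable, lintegral_map hm.lintegral_prod_right' hU]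
  refine lintegral_congr fun ω => ?_
  exact lintegral_adaptive hη (fun i => (hc i).comp measurable_prodMk_left)
    (hadapt (U ω)) (driftSolution_apply (hadapt (U ω))) (hG.comp measurable_prodMk_left)

end Adaptive

/-! ### The posterior law for a fixed design -/

section L2

variable {Ω : Type*} [MeasurableSpace Ω] {P : Measure Ω}

lemma inner_toLp {f g : Ω → ℝ} (hf : MemLp f 2 P) (hg : MemLp g 2 P) :
    inner ℝ (hf.toLp f) (hg.toLp g) = ∫ ω, f ω * g ω ∂P := by
  rw [L2.inner_def]
  refine integral_congr_ae ?_
  filter_upwards [hf.coeFn_toLp, hg.coeFn_toLp] with ω h1 h2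
  rw [h1, h2]
  simp [mul_comm]

lemma sum_toLp {ι : Type*} (s : Finset ι) {g : ι → Ω → ℝ} (hg : ∀ i, MemLp (g i) 2 P) :
    ∑ i ∈ s, (hg i).toLp (g i) =
      (memLp_finsetSum s fun i _ => hg i).toLp (fun ω => ∑ i ∈ s, g i ω) := by
  classical
  refine Lp.ext (EventuallyEq.trans ?_ (MemLp.coeFn_toLp _).symm)
  induction s using Finset.induction_on with
  | empty =>
    simp only [Finset.sum_empty]
    exact Lp.coeFn_zero ℝ 2 P
  | insert a s ha ih =>
    simp only [Finset.sum_insert ha]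
    filter_upwards [Lp.coeFn_add ((hg a).toLp (g a)) (∑ i ∈ s, (hg i).toLp (g i)),
      (hg a).coeFn_toLp, ih] with ω h1 h2 h3
    rw [h1, Pi.add_apply, h2, h3]

end L2

/-- The likelihood of the observations `u i`, `i ∈ A`, given the function values `h i`, relative to
the law of the noises. -/
noncomputable def likelihood (η : ℝ) (A : Finset ℕ) (h u : ℕ → ℝ) : ℝ :=
  ∏ i ∈ A, tilt η (h i) (u i)

lemma likelihood_pos (η : ℝ) (A : Finset ℕ) (h u : ℕ → ℝ) : 0 < likelihood η A h u :=
  Finset.prod_pos fun _ _ => tilt_pos _ _ _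

lemma likelihood_congr {η : ℝ} {A : Finset ℕ} {h h' u u' : ℕ → ℝ} (hh : ∀ i ∈ A, h i = h' i)
    (hu : ∀ i ∈ A, u i = u' i) : likelihood η A h u = likelihood η A h' u' :=
  Finset.prod_congr rfl fun i hi => by rw [hh i hi, hu i hi]

/-- The quadratic exponent is maximal at `h = u`. The bound is uniform in the function values, so
likelihoods can be dominated without any control of `f`. -/
lemma tilt_le (η h u : ℝ) (hη : 0 < η) : tilt η h u ≤ Real.exp (u ^ 2 / (2 * η ^ 2)) := by
  refine Real.exp_le_exp.mpr ?_
  rw [div_sub_div _ _ (by positivity) (by positivity), div_le_div_iff₀ (by positivity)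
    (by positivity)]
  nlinarith [mul_nonneg (sq_nonneg (h - u)) (by positivity : 0 ≤ η ^ 4)]

lemma likelihood_le {η : ℝ} (hη : 0 < η) (A : Finset ℕ) (h u : ℕ → ℝ) :
    likelihood η A h u ≤ Real.exp (∑ i ∈ A, u i ^ 2 / (2 * η ^ 2)) := by
  rw [Real.exp_sum]
  exact Finset.prod_le_prod (fun _ _ => (tilt_pos _ _ _).le) fun _ _ => tilt_le _ _ _ hη

/-- Extension by zero. -/
def extendZero {A : Finset ℕ} (u : A → ℝ) (i : ℕ) : ℝ := if hi : i ∈ A then u ⟨i, hi⟩ else 0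

@[simp]
lemma extendZero_coe {A : Finset ℕ} (u : A → ℝ) (i : A) : extendZero u i = u i := by
  simp [extendZero]

lemma extendZero_restrict {A : Finset ℕ} (u : ℕ → ℝ) {i : ℕ} (hi : i ∈ A) :
    extendZero (fun j : A => u j) i = u i := by
  simp [extendZero, hi]

@[fun_prop]
lemma continuous_extendZero (A : Finset ℕ) : Continuous (extendZero : (A → ℝ) → ℕ → ℝ) := by
  refine continuous_pi fun i => ?_
  unfold extendZero
  split_ifs <;> fun_prop

@[fun_prop]
lemma measurable_extendZero (A : Finset ℕ) : Measurable (extendZero : (A → ℝ) → ℕ → ℝ) := by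
  rw [measurable_pi_iff]
  intro i
  unfold extendZero
  split_ifs <;> fun_prop

lemma ofReal_likelihood {η : ℝ} {A : Finset ℕ} (h : ℕ → ℝ) (u : A → ℝ) :
    ENNReal.ofReal (likelihood η A h (extendZero u)) =
      ∏ i : A, ENNReal.ofReal (tilt η (h i) (u i)) := by
  rw [← ENNReal.ofReal_prod_of_nonneg fun _ _ => (tilt_pos _ _ _).le, likelihood,
    ← Finset.prod_coe_sort A]
  simp

/-! ### Prediction errors at a fixed design: orthogonality and independence -/

section Model

variable {d : ℕ} {Ω W : Type*} [MeasurableSpace Ω] [MeasurableSpace W] {P : Measure Ω}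
  [IsProbabilityMeasure P] {D : Set (Pt d)} {k : Pt d → Pt d → ℝ} {η : ℝ} {f : Pt d → Ω → ℝ}
  {ε : ℕ → Ω → ℝ} {w : Ω → W}

lemma IsModel.hasGaussianLaw_f (hM : IsModel P D k η f ε w) {z : Pt d} (hz : z ∈ D) :
    HasGaussianLaw (f z) P :=
  hM.gaussian.hasGaussianLaw_eval ⟨z, hz⟩

lemma IsModel.memLp_f (hM : IsModel P D k η f ε w) {z : Pt d} (hz : z ∈ D) : MemLp (f z) 2 P :=
  (hM.hasGaussianLaw_f hz).memLp_two

lemma IsModel.hasGaussianLaw_noise (hM : IsModel P D k η f ε w) (i : ℕ) :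
    HasGaussianLaw (ε i) P where
  isGaussian_map := by rw [hM.law_noise i]; infer_instance

lemma IsModel.memLp_noise (hM : IsModel P D k η f ε w) (i : ℕ) : MemLp (ε i) 2 P :=
  (hM.hasGaussianLaw_noise i).memLp_two

lemma IsModel.integral_noise (hM : IsModel P D k η f ε w) (i : ℕ) : ∫ ω, ε i ω ∂P = 0 := by
  have h := integral_map (hM.measurable_noise i).aemeasurable (μ := P) (f := fun t : ℝ => t)
    (by fun_prop)
  rw [← h, hM.law_noise i, integral_id_gaussianReal]

lemma IsModel.integral_f_mul_f (hM : IsModel P D k η f ε w) {z z' : Pt d} (hz : z ∈ D)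
    (hz' : z' ∈ D) : ∫ ω, f z ω * f z' ω ∂P = k z z' := by
  have := covariance_eq_sub (hM.memLp_f hz) (hM.memLp_f hz')
  rw [hM.cov_eq _ hz _ hz', hM.mean_zero _ hz, hM.mean_zero _ hz'] at this
  simpa using this.symm

lemma IsModel.integral_f_mul_noise (hM : IsModel P D k η f ε w) {z : Pt d} (hz : z ∈ D) (i : ℕ) :
    ∫ ω, f z ω * ε i ω ∂P = 0 := by
  have hind : IndepFun (f z) (ε i) P :=
    hM.indep_f_noise.comp (φ := fun s : D → ℝ => s ⟨z, hz⟩) (ψ := fun s : ℕ → ℝ => s i)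
      (measurable_pi_apply _) (measurable_pi_apply _)
  have := hind.integral_mul_eq_mul_integral (hM.memLp_f hz).1 (hM.memLp_noise i).1
  rw [hM.mean_zero _ hz, zero_mul] at this
  exact this

lemma IsModel.integral_noise_mul_noise (hM : IsModel P D k η f ε w) (i j : ℕ) :
    ∫ ω, ε i ω * ε j ω ∂P = if i = j then η ^ 2 else 0 := by
  split_ifs with hij
  · subst hij
    have h1 : Var[ε i; P] = η ^ 2 := by
      have h := variance_map (X := fun t : ℝ => t) (μ := P) (Y := ε i) (by fun_prop)
        (hM.measurable_noise i).aemeasurable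
      rw [hM.law_noise i, variance_fun_id_gaussianReal] at h
      rw [Real.coe_toNNReal _ (by positivity)] at h
      exact h.symm
    rw [variance_eq_sub (hM.memLp_noise i), hM.integral_noise] at h1
    simpa [pow_two] using h1
  · have := (hM.indep_noise.indepFun hij).integral_mul_eq_mul_integral (hM.memLp_noise i).1
      (hM.memLp_noise j).1
    rw [hM.integral_noise i, zero_mul] at this
    exact this

open Classical in
/-- The values of `f` as elements of `L²`. -/
noncomputable def IsModel.feature (hM : IsModel P D k η f ε w) (z : Pt d) : Lp ℝ 2 P :=
  if hz : z ∈ D then (hM.memLp_f hz).toLp (f z) else 0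

/-- The noises as elements of `L²`. -/
noncomputable def IsModel.noiseVec (hM : IsModel P D k η f ε w) (i : ℕ) : Lp ℝ 2 P :=
  (hM.memLp_noise i).toLp (ε i)

lemma IsModel.feature_eq (hM : IsModel P D k η f ε w) {z : Pt d} (hz : z ∈ D) :
    hM.feature z = (hM.memLp_f hz).toLp (f z) := by
  rw [feature, dif_pos hz]

/-- Covariances are inner products in `L²`, and independence of centred variables is orthogonality.
The geometry of the feature map thus becomes statements about prediction errors. -/
lemma IsModel.isFeature (hM : IsModel P D k η f ε w) :
    IsFeature D k η hM.feature hM.noiseVec where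
  inner_feature z hz z' hz' := by
    rw [hM.feature_eq hz, hM.feature_eq hz', inner_toLp, hM.integral_f_mul_f hz hz']
  inner_feature_noise z hz i := by
    rw [hM.feature_eq hz, noiseVec, inner_toLp, hM.integral_f_mul_noise hz]
  inner_noise i j := by
    rw [noiseVec, noiseVec, inner_toLp, hM.integral_noise_mul_noise]

/-- The prediction error `f z - μ(z)` at a fixed design, as a random variable. -/
noncomputable def predError (k : Pt d → Pt d → ℝ) (η : ℝ) (f : Pt d → Ω → ℝ) (ε : ℕ → Ω → ℝ)
    (A : Finset ℕ) (x : ℕ → Pt d) (z : Pt d) (ω : Ω) : ℝ :=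
  f z ω - ∑ i : A, postCoef k η A x z i * (f (x i) ω + ε i ω)

variable {A : Finset ℕ} {x : ℕ → Pt d} {z : Pt d}

lemma IsModel.memLp_obs (hM : IsModel P D k η f ε w) (hx : ∀ i, x i ∈ D) (i : ℕ) :
    MemLp (fun ω => f (x i) ω + ε i ω) 2 P :=
  (hM.memLp_f (hx i)).add (hM.memLp_noise i)

lemma IsModel.toLp_obs (hM : IsModel P D k η f ε w) (hx : ∀ i, x i ∈ D) (i : ℕ) :
    (hM.memLp_obs hx i).toLp (fun ω => f (x i) ω + ε i ω) = hM.feature (x i) + hM.noiseVec i := by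
  rw [hM.feature_eq (hx i), noiseVec, ← MemLp.toLp_add]
  rfl

lemma IsModel.memLp_predError (hM : IsModel P D k η f ε w) (hx : ∀ i, x i ∈ D) (hz : z ∈ D) :
    MemLp (predError k η f ε A x z) 2 P :=
  (hM.memLp_f hz).sub (memLp_finsetSum _ fun i _ => (hM.memLp_obs hx i).const_mul _)

lemma IsModel.toLp_predError (hM : IsModel P D k η f ε w) (hx : ∀ i, x i ∈ D) (hz : z ∈ D) :
    (hM.memLp_predError hx hz).toLp (predError k η f ε A x z) =
      residual k η hM.feature hM.noiseVec A x z := by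
  have h1 : ∑ i : A, postCoef k η A x z i • (hM.feature (x i) + hM.noiseVec i) =
      ∑ i : A, ((hM.memLp_obs hx i).const_mul (postCoef k η A x z i)).toLp
        (fun ω => postCoef k η A x z i * (f (x i) ω + ε i ω)) := by
    refine Finset.sum_congr rfl fun i _ => ?_
    rw [← hM.toLp_obs hx, ← MemLp.toLp_const_smul]
    rfl
  rw [residual, h1, sum_toLp (g := fun (i : A) ω => postCoef k η A x z i * (f (x i) ω + ε i ω))
    _ (fun i => (hM.memLp_obs hx i).const_mul (postCoef k η A x z i)), hM.feature_eq hz,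
    ← MemLp.toLp_sub]
  rfl

lemma IsModel.integral_sq_predError (hM : IsModel P D k η f ε w) (hη : 0 < η)
    (hx : ∀ i, x i ∈ D) (hz : z ∈ D) :
    ∫ ω, predError k η f ε A x z ω ^ 2 ∂P = postVar k η A x z := by
  rw [hM.isFeature.postVar_eq hη hx hz, ← hM.toLp_predError hx hz, ← real_inner_self_eq_norm_sq,
    inner_toLp]
  simp only [pow_two]

lemma IsModel.integral_predError_mul_obs (hM : IsModel P D k η f ε w) (hη : 0 < η)
    (hx : ∀ i, x i ∈ D) (hz : z ∈ D) (i : A) :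
    ∫ ω, predError k η f ε A x z ω * (f (x i) ω + ε i ω) ∂P = 0 := by
  rw [← inner_toLp (hM.memLp_predError hx hz) (hM.memLp_obs hx i), hM.toLp_predError hx hz,
    hM.toLp_obs hx, real_inner_comm, hM.isFeature.inner_residual hη hx hz]

lemma IsModel.integral_predError (hM : IsModel P D k η f ε w) (hx : ∀ i, x i ∈ D) (hz : z ∈ D) :
    ∫ ω, predError k η f ε A x z ω ∂P = 0 := by
  have hi : ∀ i : ℕ, Integrable (fun ω => f (x i) ω + ε i ω) P := fun i =>
    (hM.memLp_obs hx i).integrable one_le_two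
  unfold predError
  rw [integral_sub ((hM.memLp_f hz).integrable one_le_two)
    (integrable_finsetSum Finset.univ fun (i : A) _ =>
      (hi i).const_mul (postCoef k η A x z i)), integral_finsetSum
    Finset.univ (fun (i : A) _ => (hi i).const_mul (postCoef k η A x z i)), hM.mean_zero _ hz]
  simp only [integral_const_mul]
  rw [Finset.sum_eq_zero, sub_zero]
  intro i _
  rw [integral_add ((hM.memLp_f (hx i)).integrable one_le_two)
    ((hM.memLp_noise i).integrable one_le_two), hM.mean_zero _ (hx i), hM.integral_noise]
  simp

lemma IsModel.indepFun_path_noise (hM : IsModel P D k η f ε w) (A : Finset ℕ) :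
    IndepFun (path D f) (fun ω (i : A) => ε i ω) P :=
  hM.indep_f_noise.comp (φ := id) (ψ := fun (s : ℕ → ℝ) (i : A) => s i) measurable_id
    (by fun_prop)

lemma IsModel.map_noise (hM : IsModel P D k η f ε w) (A : Finset ℕ) :
    P.map (fun ω (i : A) => ε i ω) = Measure.pi fun _ => noiseLaw η := by
  rw [(iIndepFun_iff_map_fun_eq_pi_map
    (fun i : A => (hM.measurable_noise i).aemeasurable)).mp
    (hM.indep_noise.precomp Subtype.val_injective)]
  congr 1
  funext i
  exact hM.law_noise i

lemma IsModel.measurable_path (hM : IsModel P D k η f ε w) : Measurable (path D f) :=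
  measurable_pi_iff.mpr fun z => hM.measurable_f z z.2

/-- The joint law of `f` and of the observations at a fixed design. -/
lemma IsModel.lintegral_path_obs (hM : IsModel P D k η f ε w) (hη : 0 < η) (hx : ∀ i, x i ∈ D)
    {G : (D → ℝ) × (A → ℝ) → ENNReal} (hG : Measurable G) :
    ∫⁻ ω, G (path D f ω, obs f ε A x ω) ∂P =
      ∫⁻ ω, ∫⁻ u, G (path D f ω, u) *
        ENNReal.ofReal (likelihood η A (fun i => f (x i) ω) (extendZero u))
        ∂(Measure.pi fun _ => noiseLaw η) ∂P := by
  have h := lintegral_adaptive_of_indepFun hη hM.measurable_path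
    (E := fun ω (i : A) => ε i ω) (measurable_pi_iff.mpr fun i => hM.measurable_noise i)
    (hM.map_noise A) (hM.indepFun_path_noise A)
    (c := fun s i _ => s ⟨x i, hx i⟩)
    (fun i => by fun_prop) (fun _ _ _ _ _ => rfl) hG
  have h1 : ∀ ω, driftSolution (fun (i : A) _ => path D f ω ⟨x i, hx i⟩)
      (fun i : A => ε i ω) = obs f ε A x ω := by
    intro ω
    funext i
    rw [driftSolution_apply (fun _ _ _ _ => rfl), obs, path, add_comm]
  simp only [h1] at h
  rw [h]
  refine lintegral_congr fun ω => lintegral_congr fun u => ?_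
  rw [ofReal_likelihood]
  rfl

lemma IsModel.hasGaussianLaw_predError_obs (hM : IsModel P D k η f ε w) (hx : ∀ i, x i ∈ D)
    (hz : z ∈ D) :
    HasGaussianLaw (fun ω => ((fun _ : Unit => predError k η f ε A x z ω), obs f ε A x ω)) P := by
  classical
  -- The index `none` stands for the prediction point and `some i` for the design points, so one
  -- finite-dimensional marginal contains them all.
  set pt : Option A → D := fun o => o.elim ⟨z, hz⟩ fun i => ⟨x i, hx i⟩ with hpt
  have h1 : HasGaussianLaw (fun ω (o : Option A) => f (pt o) ω) P := by
    have h := (hM.gaussian.hasGaussianLaw (Finset.univ.image pt)).map_fun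
      (ContinuousLinearMap.pi fun o : Option A =>
        ContinuousLinearMap.proj (R := ℝ) (φ := fun _ : ↥(Finset.univ.image pt) => ℝ)
          ⟨pt o, Finset.mem_image_of_mem _ (Finset.mem_univ o)⟩)
    exact h
  have h2 : HasGaussianLaw (fun ω (i : A) => ε i ω) P :=
    iIndepFun.hasGaussianLaw (fun i : A => hM.hasGaussianLaw_noise i)
      (hM.indep_noise.precomp Subtype.val_injective)
  have hind : IndepFun (fun ω (o : Option A) => f (pt o) ω) (fun ω (i : A) => ε i ω) P :=
    (hM.indepFun_path_noise A).comp (φ := fun (s : D → ℝ) (o : Option A) => s (pt o)) (ψ := id)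
      (by fun_prop) measurable_id
  have h3 := IndepFun.hasGaussianLaw h1 h2 hind
  let L : ((Option A → ℝ) × (A → ℝ)) →L[ℝ] ((Unit → ℝ) × (A → ℝ)) :=
    LinearMap.toContinuousLinearMap
      { toFun := fun p => ((fun _ => p.1 none - ∑ i : A, postCoef k η A x z i *
          (p.1 (some i) + p.2 i)), fun i => p.1 (some i) + p.2 i)
        map_add' := by
          intro p q
          ext
          · simp only [Prod.fst_add, Prod.snd_add, Pi.add_apply, mul_add, Finset.sum_add_distrib]
            ring
          · simp only [Prod.fst_add, Prod.snd_add, Pi.add_apply]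
            ring
        map_smul' := by
          intro r p
          ext
          · simp only [Prod.smul_fst, Prod.smul_snd, Pi.smul_apply, smul_eq_mul,
              RingHom.id_apply, mul_sub, Finset.mul_sum]
            congr 1
            refine Finset.sum_congr rfl fun i _ => ?_
            ring
          · simp only [Prod.smul_fst, Prod.smul_snd, Pi.smul_apply, smul_eq_mul,
              RingHom.id_apply]
            ring }
  exact h3.map_fun L

/-- The error and the observations are jointly Gaussian and uncorrelated by the normal equations,
hence independent. -/
lemma IsModel.indepFun_predError_obs (hM : IsModel P D k η f ε w) (hη : 0 < η)
    (hx : ∀ i, x i ∈ D) (hz : z ∈ D) :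
    IndepFun (predError k η f ε A x z) (obs f ε A x) P := by
  have h := HasGaussianLaw.indepFun_of_covariance_eval
    (X := fun _ : Unit => predError k η f ε A x z) (Y := fun (i : A) ω => f (x i) ω + ε i ω)
    (hM.hasGaussianLaw_predError_obs hx hz) (fun _ i => by
      rw [covariance_eq_sub (hM.memLp_predError hx hz) (hM.memLp_obs hx i),
        hM.integral_predError hx hz, zero_mul, sub_zero]
      exact hM.integral_predError_mul_obs hη hx hz i)
  exact h.comp (φ := fun s : Unit → ℝ => s ()) (ψ := id) (measurable_pi_apply _) measurable_id

lemma IsModel.map_predError (hM : IsModel P D k η f ε w) (hη : 0 < η)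
    (hx : ∀ i, x i ∈ D) (hz : z ∈ D) :
    P.map (predError k η f ε A x z) = gaussianReal 0 (postVar k η A x z).toNNReal := by
  have h : HasGaussianLaw (predError k η f ε A x z) P :=
    (hM.hasGaussianLaw_predError_obs (A := A) hx hz).fst.map_fun
      (ContinuousLinearMap.proj (R := ℝ) (φ := fun _ : Unit => ℝ) ())
  rw [h.map_eq_gaussianReal, variance_eq_sub (hM.memLp_predError hx hz),
    hM.integral_predError hx hz]
  congr 2
  simpa using hM.integral_sq_predError hη hx hz

end Model

/-- This lets an almost everywhere identity between continuous functions of the observations be read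
at every value. -/
lemma isOpenPosMeasure_noiseLaw {η : ℝ} (hη : 0 < η) : (noiseLaw η).IsOpenPosMeasure :=
  (gaussianReal_absolutelyContinuous' 0
    (by rw [Ne, Real.toNNReal_eq_zero, not_le]; positivity)).isOpenPosMeasure

lemma continuous_likelihood (η : ℝ) (A : Finset ℕ) (h : ℕ → ℝ) :
    Continuous fun u : ℕ → ℝ => likelihood η A h u := by
  unfold likelihood tilt; fun_prop

lemma measurable_likelihood (η : ℝ) (A : Finset ℕ) :
    Measurable fun p : (ℕ → ℝ) × (ℕ → ℝ) => likelihood η A p.1 p.2 := by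
  unfold likelihood tilt; fun_prop

open scoped BoundedContinuousFunction in
lemma exists_abs_le (g : ℝ →ᵇ NNReal) : ∃ C : ℝ, ∀ t, |((g t : NNReal) : ℝ)| ≤ C :=
  ⟨nndist g 0, fun t => by
    rw [abs_of_nonneg (NNReal.coe_nonneg _), NNReal.coe_le_coe]
    exact BoundedContinuousFunction.NNReal.upper_bound g t⟩

open scoped BoundedContinuousFunction in
lemma ofReal_integral_bounded {α : Type*} [MeasurableSpace α] {μ : Measure α} [IsFiniteMeasure μ]
    (g : ℝ →ᵇ NNReal) {φ : α → ℝ} (hφ : Measurable φ) :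
    ENNReal.ofReal (∫ t, (g (φ t) : ℝ) ∂μ) = ∫⁻ t, (g (φ t) : ENNReal) ∂μ := by
  obtain ⟨C, hC⟩ := exists_abs_le g
  have hgc : Continuous fun t => ((g t : NNReal) : ℝ) := by fun_prop
  have hi : Integrable (fun t => (g (φ t) : ℝ)) μ := Integrable.of_bound
    (hgc.measurable.comp hφ).aestronglyMeasurable C (Eventually.of_forall fun t => hC _)
  rw [ofReal_integral_eq_lintegral_ofReal hi (Eventually.of_forall fun ω => NNReal.coe_nonneg _)]
  simp

/-! ### Bayes' rule at a fixed design, for every value of the observations -/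

section Model

variable {d : ℕ} {Ω W : Type*} [MeasurableSpace Ω] [MeasurableSpace W] {P : Measure Ω}
  [IsProbabilityMeasure P] {D : Set (Pt d)} {k : Pt d → Pt d → ℝ} {η : ℝ} {f : Pt d → Ω → ℝ}
  {ε : ℕ → Ω → ℝ} {w : Ω → W} {A : Finset ℕ} {x : ℕ → Pt d} {z : Pt d}

lemma IsModel.measurable_likelihood (hM : IsModel P D k η f ε w) (hx : ∀ i, x i ∈ D)
    (u : ℕ → ℝ) : Measurable fun ω => likelihood η A (fun i => f (x i) ω) u := by
  unfold likelihood tilt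
  have : ∀ i, Measurable (f (x i)) := fun i => hM.measurable_f _ (hx i)
  fun_prop

lemma IsModel.integrable_mul_likelihood (hM : IsModel P D k η f ε w) (hη : 0 < η)
    (hx : ∀ i, x i ∈ D) {φ : Ω → ℝ} (hφ : Measurable φ) {C : ℝ} (hC : ∀ ω, |φ ω| ≤ C)
    (u : ℕ → ℝ) : Integrable (fun ω => φ ω * likelihood η A (fun i => f (x i) ω) u) P := by
  refine Integrable.bdd_mul (c := C) (Integrable.of_bound
    (hM.measurable_likelihood hx u).aestronglyMeasurable
    (Real.exp (∑ i ∈ A, u i ^ 2 / (2 * η ^ 2))) (Eventually.of_forall fun ω => ?_))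
    hφ.aestronglyMeasurable (Eventually.of_forall hC)
  rw [Real.norm_eq_abs, abs_of_pos (likelihood_pos _ _ _ _)]
  exact likelihood_le hη _ _ _

/-- Dominated convergence with the uniform bound of `likelihood_le` near `u₀`. Continuity in the
observed values is needed to pass from almost every to every value. -/
lemma IsModel.continuous_integral_likelihood (hM : IsModel P D k η f ε w) (hη : 0 < η)
    (hx : ∀ i, x i ∈ D) {φ : Ω → ℝ} (hφ : Measurable φ) {C : ℝ} (hC : ∀ ω, |φ ω| ≤ C) :
    Continuous fun u : A → ℝ =>
      ∫ ω, φ ω * likelihood η A (fun i => f (x i) ω) (extendZero u) ∂P := by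
  rw [continuous_iff_continuousAt]
  intro u₀
  have hC0 : 0 ≤ C ∨ IsEmpty Ω := by
    rcases isEmpty_or_nonempty Ω with h | ⟨⟨ω⟩⟩
    · exact Or.inr h
    · exact Or.inl ((abs_nonneg _).trans (hC ω))
  rcases hC0 with hC0 | hE
  swap
  · simp only [integral_of_isEmpty]; exact continuousAt_const
  refine continuousAt_of_dominated
    (bound := fun _ => C * Real.exp (∑ i ∈ A, (‖u₀‖ + 1) ^ 2 / (2 * η ^ 2)))
    (Eventually.of_forall fun u => (hφ.mul (hM.measurable_likelihood hx _)).aestronglyMeasurable)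
    ?_ (integrable_const _) (Eventually.of_forall fun ω => ?_)
  · have hnear : ∀ᶠ u in nhds u₀, ‖u‖ < ‖u₀‖ + 1 :=
      continuous_norm.continuousAt.eventually_lt continuousAt_const (by simp)
    filter_upwards [hnear] with u hu
    refine Eventually.of_forall fun ω => ?_
    rw [norm_mul, Real.norm_eq_abs, Real.norm_eq_abs, abs_of_pos (likelihood_pos _ _ _ _)]
    refine mul_le_mul (hC ω) ((likelihood_le hη _ _ _).trans (Real.exp_le_exp.mpr
      (Finset.sum_le_sum fun i hi => ?_))) (likelihood_pos _ _ _ _).le hC0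
    have h1 : |extendZero u i| ≤ ‖u₀‖ + 1 := by
      rw [extendZero, dif_pos hi]
      exact (norm_le_pi_norm u ⟨i, hi⟩).trans hu.le
    have h2 : extendZero u i ^ 2 ≤ (‖u₀‖ + 1) ^ 2 := by
      rw [← sq_abs]; exact pow_le_pow_left₀ (abs_nonneg _) h1 2
    gcongr
  · exact (continuous_const.mul ((continuous_likelihood η A _).comp
      (continuous_extendZero A))).continuousAt

lemma IsModel.postMean_congr (hM : IsModel P D k η f ε w) (hx : ∀ i, x i ∈ D)
    {y y' : ℕ → ℝ} (h : ∀ i ∈ A, y i = y' i) :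
    postMean k η A x y z = postMean k η A x y' z := by
  rw [hM.isFeature.postMean_eq hx, hM.isFeature.postMean_eq hx]
  exact Finset.sum_congr rfl fun i _ => by rw [h i i.2]

lemma IsModel.continuous_postMean (hM : IsModel P D k η f ε w) (hx : ∀ i, x i ∈ D) :
    Continuous fun u : A → ℝ => postMean k η A x (extendZero u) z := by
  simp only [hM.isFeature.postMean_eq hx, extendZero_coe]
  fun_prop

lemma IsModel.predError_eq (hM : IsModel P D k η f ε w) (hx : ∀ i, x i ∈ D) (ω : Ω) :
    predError k η f ε A x z ω = f z ω - postMean k η A x (fun i => f (x i) ω + ε i ω) z := by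
  rw [predError, hM.isFeature.postMean_eq hx]

lemma IsModel.measurable_obs (hM : IsModel P D k η f ε w) (hx : ∀ i, x i ∈ D) :
    Measurable (obs f ε A x) :=
  measurable_pi_iff.mpr fun i => (hM.measurable_f _ (hx i)).add (hM.measurable_noise i)

lemma IsModel.measurable_predError (hM : IsModel P D k η f ε w) (hx : ∀ i, x i ∈ D)
    (hz : z ∈ D) : Measurable (predError k η f ε A x z) := by
  have h1 : ∀ i, Measurable (f (x i)) := fun i => hM.measurable_f _ (hx i)
  have h2 := hM.measurable_f z hz
  have h3 := hM.measurable_noise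
  unfold predError
  fun_prop

/-- Given the observations, `f z` is Gaussian with the posterior mean and variance. -/
lemma IsModel.lintegral_f_obs (hM : IsModel P D k η f ε w) (hη : 0 < η) (hx : ∀ i, x i ∈ D)
    (hz : z ∈ D) {g : ℝ → ENNReal} (hg : Measurable g) {h : (A → ℝ) → ENNReal}
    (hh : Measurable h) :
    ∫⁻ ω, g (f z ω) * h (obs f ε A x ω) ∂P =
      ∫⁻ ω, (∫⁻ t, g (t + postMean k η A x (extendZero (obs f ε A x ω)) z)
        ∂(gaussianReal 0 (postVar k η A x z).toNNReal)) * h (obs f ε A x ω) ∂P := by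
  have hR := hM.measurable_predError (A := A) hx hz
  have hY := hM.measurable_obs (A := A) hx
  have hind := (indepFun_iff_map_prod_eq_prod_map_map hR.aemeasurable hY.aemeasurable).mp
    (hM.indepFun_predError_obs hη hx hz)
  have hG : Measurable fun p : ℝ × (A → ℝ) =>
      g (p.1 + postMean k η A x (extendZero p.2) z) * h p.2 := by
    have := (hM.continuous_postMean (A := A) (z := z) hx).measurable
    exact (hg.comp (measurable_fst.add (this.comp measurable_snd))).mul (hh.comp measurable_snd)
  have h1 : ∀ ω, g (f z ω) * h (obs f ε A x ω) = (fun p : ℝ × (A → ℝ) =>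
      g (p.1 + postMean k η A x (extendZero p.2) z) * h p.2)
      (predError k η f ε A x z ω, obs f ε A x ω) := by
    intro ω
    simp only
    rw [hM.predError_eq hx, hM.postMean_congr (y := extendZero (obs f ε A x ω))
      (y' := fun i => f (x i) ω + ε i ω) hx fun i hi => ?_]
    · simp
    · rw [extendZero, dif_pos hi, obs]
  simp only [h1]
  rw [← lintegral_map hG (hR.prodMk hY), hind, lintegral_prod_symm' _ hG, hM.map_predError hη hx hz,
    lintegral_map hG.lintegral_prod_left' hY]
  refine lintegral_congr fun ω => ?_
  simp only
  rw [lintegral_mul_const]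
  fun_prop

/-- The joint law of `f` and of the observations, with the observations integrated last. -/
lemma IsModel.lintegral_path_obs_swap (hM : IsModel P D k η f ε w) (hη : 0 < η)
    (hx : ∀ i, x i ∈ D) {G : (D → ℝ) × (A → ℝ) → ENNReal} (hG : Measurable G) :
    ∫⁻ ω, G (path D f ω, obs f ε A x ω) ∂P =
      ∫⁻ u, ∫⁻ ω, G (path D f ω, u) *
        ENNReal.ofReal (likelihood η A (fun i => f (x i) ω) (extendZero u)) ∂P
        ∂(Measure.pi fun _ => noiseLaw η) := by
  rw [hM.lintegral_path_obs hη hx hG]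
  refine lintegral_lintegral_swap (Measurable.aemeasurable ?_)
  refine (hG.comp ((hM.measurable_path.comp measurable_fst).prodMk measurable_snd)).mul
    (ENNReal.measurable_ofReal.comp ((AsyncBO.measurable_likelihood η A).comp
      (Measurable.prodMk (measurable_pi_iff.mpr fun i =>
        (hM.measurable_f _ (hx i)).comp measurable_fst)
        ((measurable_extendZero A).comp measurable_snd))))

/-- Both sides compute the expectation of `g (f z)` on the event that the observations lie in `s`:
one directly, the other after replacing `g (f z)` by its posterior average. In both, the
observations are integrated last. -/
lemma IsModel.lintegral_indicator_likelihood (hM : IsModel P D k η f ε w) (hη : 0 < η)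
    (hx : ∀ i, x i ∈ D) (hz : z ∈ D) {g : ℝ → ENNReal} (hg : Measurable g) {s : Set (A → ℝ)}
    (hs : MeasurableSet s) :
    ∫⁻ u : A → ℝ, (∫⁻ ω, g (f z ω) *
        ENNReal.ofReal (likelihood η A (fun i => f (x i) ω) (extendZero u)) ∂P) *
        s.indicator (fun _ => 1) u ∂(Measure.pi fun _ => noiseLaw η) =
      ∫⁻ u : A → ℝ, ((∫⁻ ω, ENNReal.ofReal
          (likelihood η A (fun i => f (x i) ω) (extendZero u)) ∂P) *
        ∫⁻ t, g (t + postMean k η A x (extendZero u) z)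
          ∂(gaussianReal 0 (postVar k η A x z).toNNReal)) *
        s.indicator (fun _ => 1) u ∂(Measure.pi fun _ => noiseLaw η) := by
  have hind : Measurable (s.indicator (fun _ => (1 : ENNReal))) := measurable_one.indicator hs
  set K : (A → ℝ) → ENNReal := fun u => ∫⁻ t, g (t + postMean k η A x (extendZero u) z)
    ∂(gaussianReal 0 (postVar k η A x z).toNNReal) with hK
  have hKm : Measurable K := by
    have := (hM.continuous_postMean (A := A) (z := z) hx).measurable
    refine Measurable.lintegral_prod_right' (f := fun p : (A → ℝ) × ℝ =>
      g (p.2 + postMean k η A x (extendZero p.1) z)) (hg.comp ?_)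
    exact measurable_snd.add (this.comp measurable_fst)
  have h1 := hM.lintegral_path_obs_swap (A := A) (x := x) hη hx
    (G := fun p => g (p.1 ⟨z, hz⟩) * s.indicator (fun _ => 1) p.2)
    ((hg.comp (by fun_prop)).mul (hind.comp measurable_snd))
  have h2 := hM.lintegral_path_obs_swap (A := A) (x := x) hη hx
    (G := fun p => K p.2 * s.indicator (fun _ => 1) p.2)
    ((hKm.comp measurable_snd).mul (hind.comp measurable_snd))
  have h3 := h1.symm.trans ((hM.lintegral_f_obs (A := A) hη hx hz hg hind).trans h2)
  have hlik : ∀ u : ℕ → ℝ, Measurable fun ω =>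
      ENNReal.ofReal (likelihood η A (fun i => f (x i) ω) u) := fun u =>
    ENNReal.measurable_ofReal.comp (hM.measurable_likelihood hx u)
  refine Eq.trans (lintegral_congr fun u => ?_) (h3.trans (lintegral_congr fun u => ?_))
  · have hm : Measurable fun ω => g (f z ω) *
        ENNReal.ofReal (likelihood η A (fun i => f (x i) ω) (extendZero u)) :=
      (hg.comp (hM.measurable_f z hz)).mul (hlik _)
    rw [← lintegral_mul_const _ hm]
    refine lintegral_congr fun ω => ?_
    simp only [path]
    ring
  · simp only []
    rw [lintegral_const_mul _ (hlik (extendZero u)), hK]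
    ring

open scoped BoundedContinuousFunction in
-- Testing on measurable sets gives the identity for almost every `u`; both sides are continuous in
-- `u` and the noise law charges open sets, so it holds for every `u`. This matters because in an
-- adaptive run the design varies with `u`, and uncountably many design-dependent null sets cannot
-- be discarded together.
lemma IsModel.integral_likelihood_eq (hM : IsModel P D k η f ε w) (hη : 0 < η)
    (hx : ∀ i, x i ∈ D) (hz : z ∈ D) (g : ℝ →ᵇ NNReal) (u : A → ℝ) :
    ∫ ω, (g (f z ω) : ℝ) * likelihood η A (fun i => f (x i) ω) (extendZero u) ∂P =
      (∫ ω, 1 * likelihood η A (fun i => f (x i) ω) (extendZero u) ∂P) *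
        ∫ t, (g (t + postMean k η A x (extendZero u) z) : ℝ)
          ∂(gaussianReal 0 (postVar k η A x z).toNNReal) := by
  obtain ⟨C, hC⟩ := exists_abs_le g
  have hgc : Continuous fun t => ((g t : NNReal) : ℝ) := by fun_prop
  have hφm : Measurable fun ω => ((g (f z ω) : NNReal) : ℝ) :=
    hgc.measurable.comp (hM.measurable_f z hz)
  have hcont1 := hM.continuous_integral_likelihood (A := A) hη hx hφm (fun ω => hC _)
  have hcont2 := hM.continuous_integral_likelihood (A := A) hη hx (φ := fun _ => 1)
    measurable_const (C := 1) (by simp)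
  have hcont3 : Continuous fun u : A → ℝ =>
      ∫ t, (g (t + postMean k η A x (extendZero u) z) : ℝ)
          ∂(gaussianReal 0 (postVar k η A x z).toNNReal) := by
    refine continuous_of_dominated (bound := fun _ => C) (fun u => ?_) (fun u => ?_)
      (integrable_const _) (Eventually.of_forall fun t => ?_)
    · exact (hgc.comp (by fun_prop)).aestronglyMeasurable
    · exact Eventually.of_forall fun t => hC _
    · exact hgc.comp (continuous_const.add (hM.continuous_postMean hx))
  have hopen : ∀ _ : A, (noiseLaw η).IsOpenPosMeasure := fun _ => isOpenPosMeasure_noiseLaw hη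
  suffices hae : (fun u : A → ℝ =>
      ∫ ω, (g (f z ω) : ℝ) * likelihood η A (fun i => f (x i) ω) (extendZero u) ∂P)
      =ᵐ[Measure.pi fun _ => noiseLaw η] fun u => _ from
    congrFun ((Continuous.ae_eq_iff_eq _ hcont1 (hcont2.mul hcont3)).mp hae) u
  have hnn1 : ∀ u : A → ℝ, 0 ≤
      ∫ ω, (g (f z ω) : ℝ) * likelihood η A (fun i => f (x i) ω) (extendZero u) ∂P :=
    fun u => integral_nonneg fun ω => mul_nonneg (NNReal.coe_nonneg _) (likelihood_pos _ _ _ _).le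
  have hnn2 : ∀ u : A → ℝ, 0 ≤
      ∫ ω, 1 * likelihood η A (fun i => f (x i) ω) (extendZero u) ∂P :=
    fun u => integral_nonneg fun ω => mul_nonneg zero_le_one (likelihood_pos _ _ _ _).le
  have hnn3 : ∀ u : A → ℝ, 0 ≤ ∫ t, (g (t + postMean k η A x (extendZero u) z) : ℝ)
          ∂(gaussianReal 0 (postVar k η A x z).toNNReal) :=
    fun u => integral_nonneg fun ω => NNReal.coe_nonneg _
  have e1 : ∀ u : A → ℝ, ENNReal.ofReal
      (∫ ω, (g (f z ω) : ℝ) * likelihood η A (fun i => f (x i) ω) (extendZero u) ∂P) =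
      ∫⁻ ω, (g (f z ω) : ENNReal) *
        ENNReal.ofReal (likelihood η A (fun i => f (x i) ω) (extendZero u)) ∂P := by
    intro u
    rw [ofReal_integral_eq_lintegral_ofReal
      (hM.integrable_mul_likelihood hη hx hφm (fun ω => hC _) _)
      (Eventually.of_forall fun ω => mul_nonneg (NNReal.coe_nonneg _) (likelihood_pos _ _ _ _).le)]
    refine lintegral_congr fun ω => ?_
    rw [ENNReal.ofReal_mul (NNReal.coe_nonneg _), ENNReal.ofReal_coe_nnreal]
  have e2 : ∀ u : A → ℝ, ENNReal.ofReal
      (∫ ω, 1 * likelihood η A (fun i => f (x i) ω) (extendZero u) ∂P) =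
      ∫⁻ ω, ENNReal.ofReal (likelihood η A (fun i => f (x i) ω) (extendZero u)) ∂P := by
    intro u
    rw [ofReal_integral_eq_lintegral_ofReal
      (hM.integrable_mul_likelihood hη hx measurable_const (C := 1) (by simp) _)
      (Eventually.of_forall fun ω => mul_nonneg zero_le_one (likelihood_pos _ _ _ _).le)]
    simp
  have e3 : ∀ u : A → ℝ, ENNReal.ofReal (∫ t, (g (t + postMean k η A x (extendZero u) z) : ℝ)
      ∂(gaussianReal 0 (postVar k η A x z).toNNReal)) =
      ∫⁻ t, (g (t + postMean k η A x (extendZero u) z) : ENNReal)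
        ∂(gaussianReal 0 (postVar k η A x z).toNNReal) := by
    intro u
    exact ofReal_integral_bounded g (by fun_prop)
  have hgm : Measurable fun t => (g t : ENNReal) := by
    have := g.continuous.measurable; fun_prop
  have hae' : (fun u : A → ℝ => ENNReal.ofReal
      (∫ ω, (g (f z ω) : ℝ) * likelihood η A (fun i => f (x i) ω) (extendZero u) ∂P))
      =ᵐ[Measure.pi fun _ => noiseLaw η] fun u => ENNReal.ofReal
      ((∫ ω, 1 * likelihood η A (fun i => f (x i) ω) (extendZero u) ∂P) *
        ∫ t, (g (t + postMean k η A x (extendZero u) z) : ℝ)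
          ∂(gaussianReal 0 (postVar k η A x z).toNNReal)) := by
    refine ae_eq_of_forall_setLIntegral_eq_of_sigmaFinite
      (ENNReal.measurable_ofReal.comp hcont1.measurable)
      (ENNReal.measurable_ofReal.comp (hcont2.mul hcont3).measurable) fun s hs _ => ?_
    rw [← lintegral_indicator hs, ← lintegral_indicator hs]
    refine Eq.trans (lintegral_congr fun u => ?_) ((hM.lintegral_indicator_likelihood hη hx hz hgm
      hs).trans (lintegral_congr fun u => ?_))
    · by_cases hu : u ∈ s
      · simp only [Set.indicator_of_mem hu, mul_one]
        exact e1 u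
      · simp [Set.indicator_of_notMem hu]
    · by_cases hu : u ∈ s
      · simp only [Set.indicator_of_mem hu, mul_one]
        rw [ENNReal.ofReal_mul (hnn2 u), e2, e3]
      · simp [Set.indicator_of_notMem hu]
  filter_upwards [hae'] with u hu
  exact (ENNReal.ofReal_eq_ofReal_iff (hnn1 u) (mul_nonneg (hnn2 u) (hnn3 u))).mp hu

/-- Bayes' rule at a fixed design, for every value `u` of the observations. -/
theorem IsModel.lintegral_mul_likelihood (hM : IsModel P D k η f ε w) (hη : 0 < η)
    (hx : ∀ i, x i ∈ D) (hz : z ∈ D) {g : ℝ → ENNReal} (hg : Measurable g) (u : ℕ → ℝ) :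
    ∫⁻ ω, g (f z ω) * ENNReal.ofReal (likelihood η A (fun i => f (x i) ω) u) ∂P =
      (∫⁻ ω, ENNReal.ofReal (likelihood η A (fun i => f (x i) ω) u) ∂P) *
        ∫⁻ t, g (t + postMean k η A x u z) ∂(gaussianReal 0 (postVar k η A x z).toNNReal) := by
  set u' : A → ℝ := fun i => u i
  have hu' : ∀ i ∈ A, u i = extendZero u' i := fun i hi => (extendZero_restrict u hi).symm
  simp only [likelihood_congr (η := η) (A := A) (h := fun i => f (x i) _) (fun _ _ => rfl) hu',
    hM.postMean_congr (z := z) hx hu']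
  set L : Ω → ℝ := fun ω => likelihood η A (fun i => f (x i) ω) (extendZero u') with hL
  have hLm : Measurable L := hM.measurable_likelihood hx _
  have hLo : Measurable fun ω => ENNReal.ofReal (L ω) := ENNReal.measurable_ofReal.comp hLm
  have hLi : Integrable L P := by
    simpa using hM.integrable_mul_likelihood (A := A) hη hx (φ := fun _ => 1) measurable_const
      (C := 1) (by simp) (extendZero u')
  have hLp : ∀ ω, 0 ≤ L ω := fun ω => (likelihood_pos _ _ _ _).le
  set c : ENNReal := ∫⁻ ω, ENNReal.ofReal (L ω) ∂P with hc
  have hcfin : c ≠ ⊤ := by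
    rw [hc, ← ofReal_integral_eq_lintegral_ofReal hLi (Eventually.of_forall hLp)]
    exact ENNReal.ofReal_ne_top
  set m := postMean k η A x (extendZero u') z
  set N := gaussianReal 0 (postVar k η A x z).toNNReal
  have hfz := hM.measurable_f z hz
  have hfin1 : IsFiniteMeasure (P.withDensity fun ω => ENNReal.ofReal (L ω)) :=
    isFiniteMeasure_withDensity hcfin
  have hfin2 : IsFiniteMeasure (c • N.map (· + m)) := by
    refine ⟨?_⟩
    rw [Measure.smul_apply, smul_eq_mul]
    exact ENNReal.mul_lt_top hcfin.lt_top (measure_lt_top _ _)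
  -- Bounded continuous test functions determine finite measures, which removes the continuity of
  -- `g`.
  have key : (P.withDensity fun ω => ENNReal.ofReal (L ω)).map (f z) = c • N.map (· + m) := by
    refine ext_of_forall_lintegral_eq_of_IsFiniteMeasure fun g => ?_
    have hgm : Measurable fun t => (g t : ENNReal) := by
      have := g.continuous.measurable; fun_prop
    have h := congrArg ENNReal.ofReal (hM.integral_likelihood_eq (A := A) hη hx hz g u')
    obtain ⟨C, hC⟩ := exists_abs_le g
    have hgc : Continuous fun t => ((g t : NNReal) : ℝ) := by fun_prop
    have hi1 : Integrable (fun ω => (g (f z ω) : ℝ) * L ω) P :=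
      hM.integrable_mul_likelihood hη hx (hgc.measurable.comp hfz) (fun ω => hC _) _
    have hi2 : Integrable (fun ω => 1 * L ω) P := by simpa using hLi
    rw [ENNReal.ofReal_mul (integral_nonneg fun ω => mul_nonneg zero_le_one (hLp ω)),
      ofReal_integral_eq_lintegral_ofReal hi1
        (Eventually.of_forall fun ω => mul_nonneg (NNReal.coe_nonneg _) (hLp ω)),
      ofReal_integral_eq_lintegral_ofReal hi2
        (Eventually.of_forall fun ω => mul_nonneg zero_le_one (hLp ω)),
      ofReal_integral_bounded g (by fun_prop)] at h
    simp only [ENNReal.ofReal_mul (NNReal.coe_nonneg _), ENNReal.ofReal_coe_nnreal, one_mul] at h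
    rw [lintegral_map hgm hfz, lintegral_withDensity_eq_lintegral_mul _ hLo
        (show Measurable fun ω => (g (f z ω) : ENNReal) from hgm.comp hfz),
      lintegral_smul_measure, lintegral_map hgm (by fun_prop), smul_eq_mul]
    simp only [Pi.mul_apply]
    rw [← h]
    refine lintegral_congr fun ω => mul_comm _ _
  have h := congrArg (fun μ => ∫⁻ t, g t ∂μ) key
  rw [lintegral_map hg hfz, lintegral_withDensity_eq_lintegral_mul _ hLo
      (show Measurable fun ω => g (f z ω) from hg.comp hfz),
    lintegral_smul_measure, lintegral_map hg (by fun_prop), smul_eq_mul] at h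
  rw [← h]
  exact lintegral_congr fun ω => mul_comm _ _

end Model

/-! ### The marginal likelihood and the information gain -/

/-- The Gaussian integral behind the predictive density of one observation. -/
lemma lintegral_tilt_gaussianReal {η : ℝ} (hη : 0 < η) (v : NNReal) (m y : ℝ) :
    ∫⁻ t, ENNReal.ofReal (tilt η (t + m) y) ∂(gaussianReal 0 v) =
      ENNReal.ofReal ((√(1 + v / η ^ 2))⁻¹ *
        Real.exp (y ^ 2 / (2 * η ^ 2) - (y - m) ^ 2 / (2 * (v + η ^ 2)))) := by
  have hη2 : 0 < η ^ 2 := by positivity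
  by_cases hv : v = 0
  · subst hv
    rw [gaussianReal_zero_var, lintegral_dirac' _ (by unfold tilt; fun_prop)]
    congr 1
    simp only [tilt, NNReal.coe_zero, zero_div, add_zero, Real.sqrt_one, inv_one, one_mul, zero_add]
    congr 1
    field_simp
    ring
  · have hv0 : (0 : ℝ) < v := NNReal.coe_pos.mpr (pos_iff_ne_zero.mpr hv)
    -- Completing the square: `v'` and `m'` below are the variance and mean of the centred variable
    -- after observing `y`, and the factor left over is the predictive density.
    set v' : NNReal := v * Real.toNNReal (η ^ 2) / (v + Real.toNNReal (η ^ 2)) with hv'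
    have hc : ((Real.toNNReal (η ^ 2) : NNReal) : ℝ) = η ^ 2 := Real.coe_toNNReal _ hη2.le
    have hv'c : (v' : ℝ) = v * η ^ 2 / (v + η ^ 2) := by
      rw [hv', NNReal.coe_div, NNReal.coe_mul, NNReal.coe_add, hc]
    have hv'pos : (0 : ℝ) < v' := by rw [hv'c]; positivity
    have hv'0 : v' ≠ 0 := fun h => by rw [h] at hv'pos; simp at hv'pos
    set m' : ℝ := v * (y - m) / (v + η ^ 2) with hm'
    rw [gaussianReal_of_var_ne_zero _ hv, lintegral_withDensity_eq_lintegral_mul _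
      (measurable_gaussianPDF _ _) (by unfold tilt; fun_prop)]
    have key : ∀ t, gaussianPDF 0 v t * ENNReal.ofReal (tilt η (t + m) y) =
        ENNReal.ofReal ((√(1 + v / η ^ 2))⁻¹ *
          Real.exp (y ^ 2 / (2 * η ^ 2) - (y - m) ^ 2 / (2 * (v + η ^ 2)))) *
        gaussianPDF m' v' t := by
      intro t
      rw [gaussianPDF, gaussianPDF, ← ENNReal.ofReal_mul (gaussianPDFReal_nonneg _ _ _),
        ← ENNReal.ofReal_mul (by positivity), gaussianPDFReal, gaussianPDFReal, tilt]
      congr 1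
      have h1 : √(2 * Real.pi * v) = √(1 + v / η ^ 2) * √(2 * Real.pi * v') := by
        rw [← Real.sqrt_mul (by positivity), hv'c]
        congr 1
        field_simp
        ring
      rw [h1, mul_inv, mul_assoc, ← Real.exp_add, mul_mul_mul_comm _ (Real.exp _),
        ← Real.exp_add]
      congr 2
      rw [hv'c, hm']
      field_simp
      ring
    simp only [Pi.mul_apply, key]
    rw [lintegral_const_mul _ (measurable_gaussianPDF _ _),
      lintegral_gaussianPDF_eq_one _ hv'0, mul_one]

lemma indepFun_prodMk_left {Ω α β γ : Type*} [MeasurableSpace Ω] [MeasurableSpace α]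
    [MeasurableSpace β] [MeasurableSpace γ] {P : Measure Ω} [IsProbabilityMeasure P]
    {X : Ω → α} {Y : Ω → β} {Z : Ω → γ} (hX : Measurable X) (hY : Measurable Y)
    (hZ : Measurable Z) (h : IndepFun X (fun ω => (Y ω, Z ω)) P) (h' : IndepFun Y Z P) :
    IndepFun (fun ω => (X ω, Y ω)) Z P := by
  have : IsProbabilityMeasure (P.map X) := Measure.isProbabilityMeasure_map hX.aemeasurable
  have : IsProbabilityMeasure (P.map Y) := Measure.isProbabilityMeasure_map hY.aemeasurable
  have : IsProbabilityMeasure (P.map Z) := Measure.isProbabilityMeasure_map hZ.aemeasurable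
  have hXY : IndepFun X Y P := h.comp (φ := id) (ψ := Prod.fst) measurable_id measurable_fst
  rw [indepFun_iff_map_prod_eq_prod_map_map (hX.prodMk hY).aemeasurable hZ.aemeasurable,
    (indepFun_iff_map_prod_eq_prod_map_map hX.aemeasurable hY.aemeasurable).mp hXY]
  have h1 := (indepFun_iff_map_prod_eq_prod_map_map hX.aemeasurable
    (hY.prodMk hZ).aemeasurable).mp h
  rw [(indepFun_iff_map_prod_eq_prod_map_map hY.aemeasurable hZ.aemeasurable).mp h'] at h1
  have h2 := congrArg (Measure.map MeasurableEquiv.prodAssoc.symm) h1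
  rw [← Measure.prodAssoc_prod, MeasurableEquiv.map_symm_map,
    Measure.map_map (MeasurableEquiv.measurable _) (hX.prodMk (hY.prodMk hZ))] at h2
  exact h2

lemma likelihood_insert {η : ℝ} {A : Finset ℕ} {i : ℕ} (hi : i ∉ A) (h u : ℕ → ℝ) :
    likelihood η (insert i A) h u = tilt η (h i) (u i) * likelihood η A h u :=
  Finset.prod_insert hi

lemma integral_increment {Ω : Type*} [MeasurableSpace Ω] {P : Measure Ω} [IsProbabilityMeasure P]
    {g a b r e : Ω → ℝ} {c : ℝ} (hg : Integrable g P) (ha : Integrable a P) (hb : Integrable b P)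
    (hr : Integrable r P) (he : Integrable e P) :
    ∫ ω, (g ω + ((a ω - b ω) + c - r ω + e ω)) ∂P =
      ∫ ω, g ω ∂P + ((∫ ω, a ω ∂P - ∫ ω, b ω ∂P) + c - ∫ ω, r ω ∂P + ∫ ω, e ω ∂P) := by
  have h1 : Integrable (fun ω => a ω - b ω) P := ha.sub hb
  have h2 : Integrable (fun ω => (a ω - b ω) + c) P := h1.add (integrable_const c)
  have h3 : Integrable (fun ω => (a ω - b ω) + c - r ω) P := h2.sub hr
  have h4 : Integrable (fun ω => (a ω - b ω) + c - r ω + e ω) P := h3.add he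
  rw [integral_add hg h4, integral_add h3 he, integral_sub h2 hr, integral_add h1
    (integrable_const c), integral_sub ha hb, integral_const]
  simp

/-! ### Evidence, information density and the chain rule -/

section Model

variable {d : ℕ} {Ω W : Type*} [MeasurableSpace Ω] [MeasurableSpace W] {P : Measure Ω}
  [IsProbabilityMeasure P] {D : Set (Pt d)} {k : Pt d → Pt d → ℝ} {η : ℝ} {f : Pt d → Ω → ℝ}
  {ε : ℕ → Ω → ℝ} {w : Ω → W} {A : Finset ℕ} {x : ℕ → Pt d} {z : Pt d}

/-- The density of the observations `u i`, `i ∈ A`, relative to the law of the noises. -/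
noncomputable def evidence (P : Measure Ω) (η : ℝ) (f : Pt d → Ω → ℝ) (x : ℕ → Pt d)
    (A : Finset ℕ) (u : ℕ → ℝ) : ENNReal :=
  ∫⁻ ω, ENNReal.ofReal (likelihood η A (fun i => f (x i) ω) u) ∂P

lemma IsModel.measurable_likelihood_prod (hM : IsModel P D k η f ε w) (hx : ∀ i, x i ∈ D) :
    Measurable fun p : (ℕ → ℝ) × Ω =>
      ENNReal.ofReal (likelihood η A (fun i => f (x i) p.2) p.1) :=
  ENNReal.measurable_ofReal.comp ((AsyncBO.measurable_likelihood η A).comp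
    ((measurable_pi_iff.mpr fun i => (hM.measurable_f _ (hx i)).comp measurable_snd).prodMk
      measurable_fst))

lemma IsModel.measurable_evidence (hM : IsModel P D k η f ε w) (hx : ∀ i, x i ∈ D) :
    Measurable (evidence P η f x A) :=
  Measurable.lintegral_prod_right' (hM.measurable_likelihood_prod hx)

lemma evidence_congr {u u' : ℕ → ℝ} (h : ∀ i ∈ A, u i = u' i) :
    evidence P η f x A u = evidence P η f x A u' := by
  unfold evidence
  simp only [likelihood_congr (fun _ _ => rfl) h]

lemma evidence_empty (u : ℕ → ℝ) : evidence P η f x ∅ u = 1 := by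
  simp [evidence, likelihood]

/-- Bayes' rule with the likelihood of the new observation as test function: the ratio of evidences
is the Gaussian predictive density of `u i`, relative to the noise law. -/
lemma IsModel.evidence_insert (hM : IsModel P D k η f ε w) (hη : 0 < η) (hx : ∀ i, x i ∈ D)
    {i : ℕ} (hi : i ∉ A) (u : ℕ → ℝ) :
    evidence P η f x (insert i A) u = evidence P η f x A u *
      ENNReal.ofReal ((√(1 + postVar k η A x (x i) / η ^ 2))⁻¹ *
        Real.exp (u i ^ 2 / (2 * η ^ 2) -
          (u i - postMean k η A x u (x i)) ^ 2 / (2 * (postVar k η A x (x i) + η ^ 2)))) := by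
  have h := hM.lintegral_mul_likelihood (A := A) hη hx (hx i)
    (g := fun t => ENNReal.ofReal (tilt η t (u i))) (by unfold tilt; fun_prop) u
  rw [lintegral_tilt_gaussianReal hη,
    Real.coe_toNNReal _ (hM.isFeature.postVar_nonneg hη hx (hx i))] at h
  rw [evidence, evidence, ← h]
  refine lintegral_congr fun ω => ?_
  rw [likelihood_insert hi, ENNReal.ofReal_mul (tilt_pos _ _ _).le]

lemma IsModel.evidence_ne_zero_ne_top (hM : IsModel P D k η f ε w) (hη : 0 < η)
    (hx : ∀ i, x i ∈ D) (u : ℕ → ℝ) :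
    evidence P η f x A u ≠ 0 ∧ evidence P η f x A u ≠ ⊤ := by
  induction A using Finset.induction_on with
  | empty => simp [evidence_empty]
  | insert i A hi ih =>
    have hv := hM.isFeature.postVar_nonneg (A := A) hη hx (hx i)
    rw [hM.evidence_insert hη hx hi]
    exact ⟨mul_ne_zero ih.1 (by rw [Ne, ENNReal.ofReal_eq_zero, not_le]; positivity),
      ENNReal.mul_ne_top ih.2 ENNReal.ofReal_ne_top⟩

lemma IsModel.log_evidence_insert (hM : IsModel P D k η f ε w) (hη : 0 < η) (hx : ∀ i, x i ∈ D)
    {i : ℕ} (hi : i ∉ A) (u : ℕ → ℝ) :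
    Real.log (evidence P η f x (insert i A) u).toReal =
      Real.log (evidence P η f x A u).toReal -
        1 / 2 * Real.log (1 + postVar k η A x (x i) / η ^ 2) + u i ^ 2 / (2 * η ^ 2) -
          (u i - postMean k η A x u (x i)) ^ 2 / (2 * (postVar k η A x (x i) + η ^ 2)) := by
  have hv := hM.isFeature.postVar_nonneg (A := A) hη hx (hx i)
  have he := hM.evidence_ne_zero_ne_top (A := A) hη hx u
  have h0 : (evidence P η f x A u).toReal ≠ 0 := ENNReal.toReal_ne_zero.mpr he
  rw [hM.evidence_insert hη hx hi, ENNReal.toReal_mul, ENNReal.toReal_ofReal (by positivity),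
    Real.log_mul h0 (by positivity), Real.log_mul (by positivity) (by positivity), Real.log_exp,
    Real.log_inv, Real.log_sqrt (by positivity)]
  ring

/-- The observation at every location of the design. -/
def fullObs (f : Pt d → Ω → ℝ) (ε : ℕ → Ω → ℝ) (x : ℕ → Pt d) (ω : Ω) (i : ℕ) : ℝ :=
  f (x i) ω + ε i ω

/-- The pointwise information density of the observations in `A`. -/
noncomputable def infoDensity (P : Measure Ω) (η : ℝ) (f : Pt d → Ω → ℝ) (ε : ℕ → Ω → ℝ)
    (x : ℕ → Pt d) (A : Finset ℕ) (ω : Ω) : ℝ :=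
  Real.log (likelihood η A (fun i => f (x i) ω) (fullObs f ε x ω)) -
    Real.log (evidence P η f x A (fullObs f ε x ω)).toReal

/-- The expected information density. -/
noncomputable def infoGain (P : Measure Ω) (η : ℝ) (f : Pt d → Ω → ℝ) (ε : ℕ → Ω → ℝ)
    (x : ℕ → Pt d) (A : Finset ℕ) : ℝ :=
  ∫ ω, infoDensity P η f ε x A ω ∂P

lemma IsModel.infoDensity_insert (hM : IsModel P D k η f ε w) (hη : 0 < η) (hx : ∀ i, x i ∈ D)
    {i : ℕ} (hi : i ∉ A) (ω : Ω) :
    infoDensity P η f ε x (insert i A) ω = infoDensity P η f ε x A ω +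
      ((f (x i) ω * (f (x i) ω + ε i ω) / η ^ 2 - f (x i) ω * f (x i) ω / (2 * η ^ 2)) +
        1 / 2 * Real.log (1 + postVar k η A x (x i) / η ^ 2) -
        (f (x i) ω + ε i ω) * (f (x i) ω + ε i ω) / (2 * η ^ 2) +
        (predError k η f ε A x (x i) ω + ε i ω) * (predError k η f ε A x (x i) ω + ε i ω) /
          (2 * (postVar k η A x (x i) + η ^ 2))) := by
  rw [infoDensity, hM.log_evidence_insert hη hx hi, infoDensity, likelihood_insert hi, Real.log_mul (tilt_pos _ _ _).ne' (likelihood_pos η A _ _).ne',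
    hM.predError_eq hx]
  simp only [tilt, Real.log_exp]
  unfold fullObs
  ring

lemma IsModel.inner_obs_self (hM : IsModel P D k η f ε w) (hx : ∀ i, x i ∈ D) (i : ℕ) :
    ∫ ω, (f (x i) ω + ε i ω) * (f (x i) ω + ε i ω) ∂P = k (x i) (x i) + η ^ 2 := by
  rw [← inner_toLp (hM.memLp_obs hx i) (hM.memLp_obs hx i), hM.toLp_obs hx,
    hM.isFeature.inner_obs hx]
  simp

/-- Because `i ∉ A`, the noise `ε i` is orthogonal to the prediction error, so the variances add. -/
lemma IsModel.inner_innovation (hM : IsModel P D k η f ε w) (hη : 0 < η) (hx : ∀ i, x i ∈ D)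
    {i : ℕ} (hi : i ∉ A) :
    ∫ ω, (predError k η f ε A x (x i) ω + ε i ω) * (predError k η f ε A x (x i) ω + ε i ω) ∂P =
      postVar k η A x (x i) + η ^ 2 := by
  have hp := hM.memLp_predError (A := A) hx (hx i)
  have h1 : (hp.add (hM.memLp_noise i)).toLp (fun ω => predError k η f ε A x (x i) ω + ε i ω) =
      residual k η hM.feature hM.noiseVec A x (x i) + hM.noiseVec i := by
    rw [← hM.toLp_predError hx (hx i), noiseVec, ← MemLp.toLp_add]
    rfl
  have h2 : inner ℝ (residual k η hM.feature hM.noiseVec A x (x i)) (hM.noiseVec i) = 0 := by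
    rw [residual, inner_sub_left, hM.isFeature.inner_feature_noise _ (hx i), sum_inner,
      Finset.sum_eq_zero, sub_zero]
    intro j _
    rw [inner_smul_left, inner_add_left, hM.isFeature.inner_feature_noise _ (hx j),
      hM.isFeature.inner_noise, if_neg (fun hji : (j : ℕ) = i => hi (hji ▸ j.2))]
    simp
  have h3 := inner_toLp (hp.add (hM.memLp_noise i)) (hp.add (hM.memLp_noise i))
  simp only [Pi.add_apply] at h3
  rw [← h3]
  erw [h1]
  rw [inner_add_left, inner_add_right, inner_add_right, h2,
    real_inner_comm (residual k η hM.feature hM.noiseVec A x (x i)) (hM.noiseVec i), h2,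
    real_inner_self_eq_norm_sq, ← hM.isFeature.postVar_eq hη hx (hx i), hM.isFeature.inner_noise]
  simp

lemma IsModel.integrable_infoDensity (hM : IsModel P D k η f ε w) (hη : 0 < η)
    (hx : ∀ i, x i ∈ D) : Integrable (infoDensity P η f ε x A) P := by
  induction A using Finset.induction_on with
  | empty => unfold infoDensity; simp [evidence_empty, likelihood]
  | insert i A hi ih =>
    have h := hM.infoDensity_insert (A := A) hη hx hi
    rw [show infoDensity P η f ε x (insert i A) = _ from funext h]
    have hf := hM.memLp_f (hx i)
    have ho := hM.memLp_obs hx i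
    have hp := (hM.memLp_predError (A := A) hx (hx i)).add (hM.memLp_noise i)
    exact ih.add ((((((hf.integrable_mul ho).div_const _).sub
      ((hf.integrable_mul hf).div_const _)).add (integrable_const _)).sub
      ((ho.integrable_mul ho).div_const _)).add ((hp.integrable_mul hp).div_const _))

lemma infoGain_empty : infoGain P η f ε x ∅ = 0 := by
  simp [infoGain, infoDensity, evidence_empty, likelihood]

/-- Chain rule for the information gain. -/
lemma IsModel.infoGain_insert (hM : IsModel P D k η f ε w) (hη : 0 < η) (hx : ∀ i, x i ∈ D)
    {i : ℕ} (hi : i ∉ A) :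
    infoGain P η f ε x (insert i A) = infoGain P η f ε x A +
      1 / 2 * Real.log (1 + postVar k η A x (x i) / η ^ 2) := by
  have hv := hM.isFeature.postVar_nonneg (A := A) hη hx (hx i)
  have hf := hM.memLp_f (hx i)
  have ho := hM.memLp_obs hx i
  have hp := (hM.memLp_predError (A := A) hx (hx i)).add (hM.memLp_noise i)
  have i1 : Integrable (fun ω => f (x i) ω * (f (x i) ω + ε i ω) / η ^ 2) P :=
    (hf.integrable_mul ho).div_const _
  have i2 : Integrable (fun ω => f (x i) ω * f (x i) ω / (2 * η ^ 2)) P :=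
    (hf.integrable_mul hf).div_const _
  have i3 : Integrable (fun ω => (f (x i) ω + ε i ω) * (f (x i) ω + ε i ω) / (2 * η ^ 2)) P :=
    (ho.integrable_mul ho).div_const _
  have i4 : Integrable (fun ω => (predError k η f ε A x (x i) ω + ε i ω) *
      (predError k η f ε A x (x i) ω + ε i ω) / (2 * (postVar k η A x (x i) + η ^ 2))) P :=
    (hp.integrable_mul hp).div_const _
  have e1 : ∫ ω, f (x i) ω * (f (x i) ω + ε i ω) ∂P = k (x i) (x i) := by
    rw [← inner_toLp hf ho, hM.toLp_obs hx, ← hM.feature_eq (hx i), inner_add_right,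
      hM.isFeature.inner_feature _ (hx i) _ (hx i), hM.isFeature.inner_feature_noise _ (hx i),
      add_zero]
  rw [infoGain, integral_congr_ae (Eventually.of_forall (hM.infoDensity_insert (A := A) hη hx hi)),
    integral_increment (hM.integrable_infoDensity hη hx) i1 i2 i3 i4, integral_div, integral_div,
    integral_div, integral_div, e1, hM.integral_f_mul_f (hx i) (hx i), hM.inner_obs_self hx,
    hM.inner_innovation hη hx hi, infoGain]
  -- The quadratic terms cancel in expectation: with `κ = k (x i) (x i)` they are `κ / η² - κ /
  -- (2η²) - (κ + η²) / (2η²) + 1 / 2 = 0`. Only the logarithm remains.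
  have : 0 < postVar k η A x (x i) + η ^ 2 := by positivity
  field_simp
  ring

end Model

/-- The Kullback-Leibler divergence of measures with positive densities. -/
lemma klDiv_withDensity {α : Type*} [MeasurableSpace α] {ν₀ : Measure α} [SigmaFinite ν₀]
    {p q : α → ℝ} (hp : Measurable p) (hq : Measurable q) (hp0 : ∀ a, 0 < p a)
    (hq0 : ∀ a, 0 < q a) {μ ν : Measure α} [IsProbabilityMeasure μ] [IsProbabilityMeasure ν]
    (hμ : μ = ν₀.withDensity fun a => ENNReal.ofReal (p a))
    (hν : ν = ν₀.withDensity fun a => ENNReal.ofReal (q a))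
    (hint : Integrable (fun a => Real.log (p a) - Real.log (q a)) μ) :
    InformationTheory.klDiv μ ν =
      ENNReal.ofReal (∫ a, (Real.log (p a) - Real.log (q a)) ∂μ) := by
  have hr : Measurable fun a => ENNReal.ofReal (p a / q a) :=
    (hp.div hq).ennreal_ofReal
  have h1 : μ = ν.withDensity fun a => ENNReal.ofReal (p a / q a) := by
    rw [hμ, hν, ← withDensity_mul _ hq.ennreal_ofReal hr]
    congr 1
    funext a
    rw [Pi.mul_apply, ← ENNReal.ofReal_mul (hq0 a).le,
      mul_div_cancel₀ _ (hq0 a).ne']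
  have hac : μ ≪ ν := h1 ▸ withDensity_absolutelyContinuous _ _
  have h2 : llr μ ν =ᵐ[μ] fun a => Real.log (p a) - Real.log (q a) := by
    have h3 : μ.rnDeriv ν =ᵐ[ν] fun a => ENNReal.ofReal (p a / q a) := by
      rw [h1]; exact Measure.rnDeriv_withDensity ν hr
    filter_upwards [hac.ae_le h3] with a ha
    rw [llr, ha, ENNReal.toReal_ofReal (div_pos (hp0 a) (hq0 a)).le,
      Real.log_div (hp0 a).ne' (hq0 a).ne']
  rw [InformationTheory.klDiv_of_ac_of_integrable hac ((integrable_congr h2).mpr hint),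
    integral_congr_ae h2]
  simp

/-! ### Mutual information at a fixed design as an expected information density -/

section Model

variable {d : ℕ} {Ω W : Type*} [MeasurableSpace Ω] [MeasurableSpace W] {P : Measure Ω}
  [IsProbabilityMeasure P] {D : Set (Pt d)} {k : Pt d → Pt d → ℝ} {η : ℝ} {f : Pt d → Ω → ℝ}
  {ε : ℕ → Ω → ℝ} {w : Ω → W} {A B : Finset ℕ} {x : ℕ → Pt d} {z : Pt d}

/-- The likelihood as a function of the path and of the observations. -/
noncomputable def pathLikelihood (η : ℝ) {x : ℕ → Pt d} (hx : ∀ i, x i ∈ D) (A : Finset ℕ)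
    (s : D → ℝ) (u : A → ℝ) : ℝ :=
  likelihood η A (fun i => s ⟨x i, hx i⟩) (extendZero u)

lemma measurable_pathLikelihood (hx : ∀ i, x i ∈ D) :
    Measurable fun p : (D → ℝ) × (A → ℝ) => pathLikelihood η hx A p.1 p.2 := by
  have h1 : Measurable fun p : (D → ℝ) × (A → ℝ) => (fun i => p.1 ⟨x i, hx i⟩ : ℕ → ℝ) := by
    fun_prop
  have h2 : Measurable fun p : (D → ℝ) × (A → ℝ) => (extendZero p.2 : ℕ → ℝ) :=
    (measurable_extendZero A).comp measurable_snd
  have h3 := (AsyncBO.measurable_likelihood η A).comp (h1.prodMk h2)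
  exact h3

lemma IsModel.toReal_evidence_pos (hM : IsModel P D k η f ε w) (hη : 0 < η) (hx : ∀ i, x i ∈ D)
    (u : ℕ → ℝ) : 0 < (evidence P η f x A u).toReal :=
  ENNReal.toReal_pos_iff.mpr ⟨pos_iff_ne_zero.mpr (hM.evidence_ne_zero_ne_top hη hx u).1,
    (hM.evidence_ne_zero_ne_top hη hx u).2.lt_top⟩

lemma IsModel.ofReal_evidence (hM : IsModel P D k η f ε w) (hη : 0 < η) (hx : ∀ i, x i ∈ D)
    (u : ℕ → ℝ) : ENNReal.ofReal (evidence P η f x A u).toReal = evidence P η f x A u :=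
  ENNReal.ofReal_toReal (hM.evidence_ne_zero_ne_top hη hx u).2

lemma evidence_extendZero_obs (ω : Ω) :
    evidence P η f x A (extendZero (obs f ε A x ω)) = evidence P η f x A (fullObs f ε x ω) :=
  evidence_congr fun i hi => by rw [extendZero, dif_pos hi, obs, fullObs]

lemma likelihood_extendZero_obs (h : ℕ → ℝ) (ω : Ω) :
    likelihood η A h (extendZero (obs f ε A x ω)) = likelihood η A h (fullObs f ε x ω) :=
  likelihood_congr (fun _ _ => rfl) fun i hi => by rw [extendZero, dif_pos hi, obs, fullObs]

lemma IsModel.map_path_obs (hM : IsModel P D k η f ε w) (hη : 0 < η) (hx : ∀ i, x i ∈ D) :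
    P.map (fun ω => (path D f ω, obs f ε A x ω)) =
      ((P.map (path D f)).prod (Measure.pi fun _ => noiseLaw η)).withDensity
        fun p => ENNReal.ofReal (pathLikelihood η hx A p.1 p.2) := by
  have hlm : Measurable fun p : (D → ℝ) × (A → ℝ) =>
      ENNReal.ofReal (pathLikelihood η hx A p.1 p.2) :=
    (measurable_pathLikelihood hx).ennreal_ofReal
  refine Measure.ext_of_lintegral _ fun G hG => ?_
  rw [lintegral_map hG (hM.measurable_path.prodMk (hM.measurable_obs hx)),
    hM.lintegral_path_obs hη hx hG, lintegral_withDensity_eq_lintegral_mul _ hlm hG,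
    lintegral_prod _ (hlm.mul hG).aemeasurable, lintegral_map (hlm.mul hG).lintegral_prod_right'
    hM.measurable_path]
  refine lintegral_congr fun ω => lintegral_congr fun u => ?_
  rw [Pi.mul_apply, mul_comm]
  rfl

lemma IsModel.map_obs (hM : IsModel P D k η f ε w) (hη : 0 < η) (hx : ∀ i, x i ∈ D) :
    P.map (obs f ε A x) = (Measure.pi fun _ => noiseLaw η).withDensity
      fun u => evidence P η f x A (extendZero u) := by
  have hem : Measurable fun u : A → ℝ => evidence P η f x A (extendZero u) :=
    (hM.measurable_evidence hx).comp (measurable_extendZero A)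
  refine Measure.ext_of_lintegral _ fun G hG => ?_
  have h := hM.lintegral_path_obs_swap (A := A) hη hx (G := fun p => G p.2)
    (hG.comp measurable_snd)
  simp only at h
  rw [lintegral_map hG (hM.measurable_obs hx), h,
    lintegral_withDensity_eq_lintegral_mul _ hem hG]
  refine lintegral_congr fun u => ?_
  rw [lintegral_const_mul _ (hM.measurable_likelihood hx _).ennreal_ofReal,
    Pi.mul_apply, mul_comm]
  rfl

/-- The information in the observations at a fixed design about the path. -/
theorem IsModel.mutualInfo_eq (hM : IsModel P D k η f ε w) (hη : 0 < η) (hx : ∀ i, x i ∈ D) :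
    mutualInfo P (path D f) (obs f ε A x) = ENNReal.ofReal (infoGain P η f ε x A) := by
  have hmJ : Measurable fun ω => (path D f ω, obs f ε A x ω) :=
    hM.measurable_path.prodMk (hM.measurable_obs hx)
  have := Measure.isProbabilityMeasure_map (μ := P) hmJ.aemeasurable
  have := Measure.isProbabilityMeasure_map (μ := P) hM.measurable_path.aemeasurable
  have := Measure.isProbabilityMeasure_map (μ := P) (hM.measurable_obs (A := A) hx).aemeasurable
  have hem : Measurable fun u : A → ℝ => evidence P η f x A (extendZero u) :=
    (hM.measurable_evidence hx).comp (measurable_extendZero A)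
  have hν : (P.map (path D f)).prod (P.map (obs f ε A x)) =
      ((P.map (path D f)).prod (Measure.pi fun _ => noiseLaw η)).withDensity
        fun p => ENNReal.ofReal (evidence P η f x A (extendZero p.2)).toReal := by
    rw [hM.map_obs hη hx, prod_withDensity_right hem]
    simp only [hM.ofReal_evidence hη hx]
  have hq : Measurable fun p : (D → ℝ) × (A → ℝ) =>
      (evidence P η f x A (extendZero p.2)).toReal := (hem.comp measurable_snd).ennreal_toReal
  have hlog : Measurable fun p : (D → ℝ) × (A → ℝ) =>
      Real.log (pathLikelihood η hx A p.1 p.2) -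
        Real.log (evidence P η f x A (extendZero p.2)).toReal :=
    (measurable_pathLikelihood hx).log.sub hq.log
  have heq : ∀ ω, Real.log (pathLikelihood η hx A (path D f ω) (obs f ε A x ω)) -
      Real.log (evidence P η f x A (extendZero (obs f ε A x ω))).toReal =
      infoDensity P η f ε x A ω := by
    intro ω
    rw [evidence_extendZero_obs, pathLikelihood, likelihood_extendZero_obs]
    rfl
  rw [mutualInfo, klDiv_withDensity (measurable_pathLikelihood hx)
    hq (fun _ => likelihood_pos _ _ _ _)
    (fun _ => hM.toReal_evidence_pos hη hx _) (hM.map_path_obs hη hx) hν,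
    integral_map hmJ.aemeasurable hlog.aestronglyMeasurable, infoGain]
  · simp only [heq]
  · rw [integrable_map_measure hlog.aestronglyMeasurable hmJ.aemeasurable]
    exact (hM.integrable_infoDensity (A := A) hη hx).congr
      (Eventually.of_forall fun ω => (heq ω).symm)

lemma likelihood_union (hAB : Disjoint A B) (h u : ℕ → ℝ) :
    likelihood η (A ∪ B) h u = likelihood η A h u * likelihood η B h u :=
  Finset.prod_union hAB

lemma extendZero_add_left (hAB : Disjoint A B) (a : A → ℝ) (b : B → ℝ) {i : ℕ} (hi : i ∈ A) :
    (extendZero a + extendZero b) i = extendZero a i := by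
  simp [extendZero, Finset.disjoint_left.mp hAB hi]

lemma extendZero_add_right (hAB : Disjoint A B) (a : A → ℝ) (b : B → ℝ) {i : ℕ} (hi : i ∈ B) :
    (extendZero a + extendZero b) i = extendZero b i := by
  simp [extendZero, Finset.disjoint_right.mp hAB hi]

lemma likelihood_union_add (hAB : Disjoint A B) (h : ℕ → ℝ) (a : A → ℝ) (b : B → ℝ) :
    likelihood η (A ∪ B) h (extendZero a + extendZero b) =
      likelihood η A h (extendZero a) * likelihood η B h (extendZero b) := by
  rw [likelihood_union hAB, likelihood_congr (A := A) (fun _ _ => rfl)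
    fun i hi => extendZero_add_left hAB a b hi, likelihood_congr (A := B) (fun _ _ => rfl)
    fun i hi => extendZero_add_right hAB a b hi]

/-- The change of measure again, now with the path and the observations in `A` as the random
element. Disjointness makes the noises in `B` independent of it. -/
lemma IsModel.lintegral_path_obs_obs (hM : IsModel P D k η f ε w) (hη : 0 < η)
    (hx : ∀ i, x i ∈ D) (hAB : Disjoint A B)
    {G : ((D → ℝ) × (A → ℝ)) × (B → ℝ) → ENNReal} (hG : Measurable G) :
    ∫⁻ ω, G ((path D f ω, obs f ε A x ω), obs f ε B x ω) ∂P =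
      ∫⁻ ω, ∫⁻ u, G ((path D f ω, obs f ε A x ω), u) *
        ENNReal.ofReal (pathLikelihood η hx B (path D f ω) u)
        ∂(Measure.pi fun _ => noiseLaw η) ∂P := by
  have hmA : Measurable fun ω (i : A) => ε i ω :=
    measurable_pi_iff.mpr fun i => hM.measurable_noise i
  have hmB : Measurable fun ω (i : B) => ε i ω :=
    measurable_pi_iff.mpr fun i => hM.measurable_noise i
  have hind1 : IndepFun (path D f) (fun ω => ((fun i : A => ε i ω), (fun i : B => ε i ω))) P :=
    hM.indep_f_noise.comp (φ := id) (ψ := fun s : ℕ → ℝ => ((fun i : A => s i), fun i : B => s i))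
      measurable_id (by fun_prop)
  have hind2 : IndepFun (fun ω => (path D f ω, fun i : A => ε i ω)) (fun ω (i : B) => ε i ω) P :=
    indepFun_prodMk_left hM.measurable_path hmA hmB hind1
      (hM.indep_noise.indepFun_finset A B hAB hM.measurable_noise)
  have hind : IndepFun (fun ω => (path D f ω, obs f ε A x ω)) (fun ω (i : B) => ε i ω) P :=
    hind2.comp (φ := fun s : (D → ℝ) × (A → ℝ) => (s.1, fun i : A => s.1 ⟨x i, hx i⟩ + s.2 i))
      (ψ := id) (by fun_prop) measurable_id
  have h := lintegral_adaptive_of_indepFun hη (hM.measurable_path.prodMk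
    (hM.measurable_obs (A := A) hx)) hmB (hM.map_noise B) hind
    (c := fun s i _ => s.1 ⟨x i, hx i⟩) (fun i => by fun_prop) (fun _ _ _ _ _ => rfl) hG
  have h1 : ∀ ω, driftSolution (fun (i : B) _ => path D f ω ⟨x i, hx i⟩)
      (fun i : B => ε i ω) = obs f ε B x ω := by
    intro ω
    funext i
    rw [driftSolution_apply (fun _ _ _ _ => rfl), obs, path, add_comm]
  simp only [h1] at h
  rw [h]
  refine lintegral_congr fun ω => lintegral_congr fun u => ?_
  rw [pathLikelihood, ofReal_likelihood]

/-- The predictive density of the observations in `B` given those in `A`. -/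
noncomputable def predictive (P : Measure Ω) (η : ℝ) (f : Pt d → Ω → ℝ) (x : ℕ → Pt d)
    (A B : Finset ℕ) (a : A → ℝ) (b : B → ℝ) : ℝ :=
  (evidence P η f x (A ∪ B) (extendZero a + extendZero b)).toReal /
    (evidence P η f x A (extendZero a)).toReal

lemma IsModel.measurable_predictive (hM : IsModel P D k η f ε w) (hx : ∀ i, x i ∈ D) :
    Measurable fun p : (A → ℝ) × (B → ℝ) => predictive P η f x A B p.1 p.2 := by
  have h1 := hM.measurable_evidence (A := A ∪ B) hx
  have h2 := hM.measurable_evidence (A := A) hx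
  have hA := measurable_extendZero A
  have hB := measurable_extendZero B
  exact (h1.comp ((hA.comp measurable_fst).add (hB.comp measurable_snd))).ennreal_toReal.div
    (h2.comp (hA.comp measurable_fst)).ennreal_toReal

lemma IsModel.predictive_pos (hM : IsModel P D k η f ε w) (hη : 0 < η) (hx : ∀ i, x i ∈ D)
    (a : A → ℝ) (b : B → ℝ) : 0 < predictive P η f x A B a b :=
  div_pos (hM.toReal_evidence_pos hη hx _) (hM.toReal_evidence_pos hη hx _)

lemma IsModel.evidence_mul_predictive (hM : IsModel P D k η f ε w) (hη : 0 < η)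
    (hx : ∀ i, x i ∈ D) (a : A → ℝ) (b : B → ℝ) :
    evidence P η f x A (extendZero a) * ENNReal.ofReal (predictive P η f x A B a b) =
      evidence P η f x (A ∪ B) (extendZero a + extendZero b) := by
  rw [← hM.ofReal_evidence (A := A) hη hx, ← hM.ofReal_evidence (A := A ∪ B) hη hx,
    ← ENNReal.ofReal_mul ENNReal.toReal_nonneg, predictive,
    mul_div_cancel₀ _ (hM.toReal_evidence_pos hη hx _).ne']

/-- Given the path, the likelihood of the observations in `B` is a probability density, so they
integrate out. This normalizes the predictive density. -/
lemma IsModel.lintegral_evidence_union (hM : IsModel P D k η f ε w) (hη : 0 < η)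
    (hx : ∀ i, x i ∈ D) (hAB : Disjoint A B) (a : A → ℝ) :
    ∫⁻ b : B → ℝ, evidence P η f x (A ∪ B) (extendZero a + extendZero b)
      ∂(Measure.pi fun _ => noiseLaw η) = evidence P η f x A (extendZero a) := by
  have hm : Measurable fun p : (B → ℝ) × Ω => ENNReal.ofReal (likelihood η (A ∪ B)
      (fun i => f (x i) p.2) (extendZero a + extendZero p.1)) := by
    have h1 : Measurable fun p : (B → ℝ) × Ω => (extendZero p.1 : ℕ → ℝ) :=
      (measurable_extendZero B).comp measurable_fst
    have h2 : Measurable fun p : (B → ℝ) × Ω => (extendZero a + extendZero p.1 : ℕ → ℝ) :=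
      measurable_const.add h1
    have h3 := (hM.measurable_likelihood_prod (A := A ∪ B) hx).comp (h2.prodMk measurable_snd)
    exact h3
  unfold evidence
  rw [lintegral_lintegral_swap hm.aemeasurable]
  refine lintegral_congr fun ω => ?_
  have h1 : ∀ b : B → ℝ, ENNReal.ofReal (likelihood η (A ∪ B) (fun i => f (x i) ω)
      (extendZero a + extendZero b)) = ENNReal.ofReal (likelihood η A (fun i => f (x i) ω)
      (extendZero a)) * ∏ i : B, ENNReal.ofReal (tilt η (f (x i) ω) (b i)) := by
    intro b
    rw [likelihood_union_add hAB, ENNReal.ofReal_mul (likelihood_pos _ _ _ _).le,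
      ofReal_likelihood (A := B)]
  simp only [h1]
  have h2 := lintegral_adaptive hη (ι := B) (c := fun i _ => f (x i) ω) (fun _ => measurable_const)
    (fun _ _ _ _ => rfl) (Y := fun e i => e i + f (x i) ω) (fun _ _ => rfl)
    (G := fun _ => 1) measurable_const
  simp only [one_mul, lintegral_one, measure_univ] at h2
  rw [lintegral_const_mul, ← h2, mul_one]
  unfold tilt; fun_prop

/-- The conditional law of the observations in `B` given those in `A`. -/
noncomputable def predictiveKernel (P : Measure Ω) (η : ℝ) (f : Pt d → Ω → ℝ) (x : ℕ → Pt d)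
    (A B : Finset ℕ) : Kernel (A → ℝ) (B → ℝ) :=
  (Kernel.const _ (Measure.pi fun _ => noiseLaw η)).withDensity
    fun a b => ENNReal.ofReal (predictive P η f x A B a b)

lemma IsModel.lintegral_predictiveKernel (hM : IsModel P D k η f ε w)
    (hx : ∀ i, x i ∈ D) (a : A → ℝ) {G : (B → ℝ) → ENNReal} (hG : Measurable G) :
    ∫⁻ b, G b ∂(predictiveKernel P η f x A B a) =
      ∫⁻ b, ENNReal.ofReal (predictive P η f x A B a b) * G b
        ∂(Measure.pi fun _ => noiseLaw η) := by
  have hm : Measurable (Function.uncurry fun (a : A → ℝ) (b : B → ℝ) =>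
      ENNReal.ofReal (predictive P η f x A B a b)) := (hM.measurable_predictive hx).ennreal_ofReal
  rw [predictiveKernel, Kernel.lintegral_withDensity _ hm _ hG, Kernel.const_apply]

lemma IsModel.isMarkovKernel_predictiveKernel (hM : IsModel P D k η f ε w) (hη : 0 < η)
    (hx : ∀ i, x i ∈ D) (hAB : Disjoint A B) : IsMarkovKernel (predictiveKernel P η f x A B) := by
  refine ⟨fun a => ⟨?_⟩⟩
  have h1 := hM.lintegral_predictiveKernel (A := A) (B := B) hx a (G := fun _ => 1)
    measurable_const
  have h2 := hM.lintegral_evidence_union hη hx hAB a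
  simp only [← hM.evidence_mul_predictive hη hx] at h2
  have hm : Measurable fun b : B → ℝ => predictive P η f x A B a b := by
    have h := (hM.measurable_predictive (A := A) (B := B) hx).comp
      (measurable_prodMk_left (x := a))
    exact h
  rw [lintegral_const_mul _ hm.ennreal_ofReal] at h2
  have he := hM.evidence_ne_zero_ne_top (A := A) hη hx (extendZero a)
  simp only [lintegral_one, mul_one] at h1
  rw [h1]
  have h3 : evidence P η f x A (extendZero a) * ∫⁻ b, ENNReal.ofReal (predictive P η f x A B a b)
      ∂(Measure.pi fun _ => noiseLaw η) = evidence P η f x A (extendZero a) * 1 := by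
    rw [mul_one]; exact h2
  exact (ENNReal.mul_right_inj he.1 he.2).mp h3

/-- Uniqueness of disintegrations: the evidence of `A` times the predictive density is the evidence
of `A ∪ B`, which is the joint density of the two blocks after the path is integrated out. -/
lemma IsModel.condDistrib_obs (hM : IsModel P D k η f ε w) (hη : 0 < η) (hx : ∀ i, x i ∈ D)
    (hAB : Disjoint A B) :
    condDistrib (obs f ε B x) (obs f ε A x) P =ᵐ[P.map (obs f ε A x)]
      predictiveKernel P η f x A B := by
  have hmk := hM.isMarkovKernel_predictiveKernel hη hx hAB
  have hA := hM.measurable_obs (A := A) hx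
  have hB := hM.measurable_obs (A := B) hx
  have := Measure.isProbabilityMeasure_map (μ := P) hA.aemeasurable
  refine condDistrib_ae_eq_of_measure_eq_compProd _ hB.aemeasurable ?_
  refine Measure.ext_of_lintegral _ fun G hG => ?_
  have hpm : Measurable fun p : (A → ℝ) × (B → ℝ) =>
      ENNReal.ofReal (predictive P η f x A B p.1 p.2) :=
    (hM.measurable_predictive hx).ennreal_ofReal
  have hem : Measurable fun u : A → ℝ => evidence P η f x A (extendZero u) :=
    (hM.measurable_evidence hx).comp (measurable_extendZero A)
  have hpl := (measurable_pathLikelihood (η := η) (A := B) hx).ennreal_ofReal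
  have h1 := hM.lintegral_path_obs_obs hη hx hAB (G := fun p => G (p.1.2, p.2))
    (hG.comp (by fun_prop))
  have hin : Measurable fun p : (D → ℝ) × (A → ℝ) => ∫⁻ u : B → ℝ, G (p.2, u) *
      ENNReal.ofReal (pathLikelihood η hx B p.1 u) ∂(Measure.pi fun _ => noiseLaw η) := by
    refine Measurable.lintegral_prod_right' (f := fun q : ((D → ℝ) × (A → ℝ)) × (B → ℝ) =>
      G (q.1.2, q.2) * ENNReal.ofReal (pathLikelihood η hx B q.1.1 q.2)) ?_
    have h3 : Measurable fun q : ((D → ℝ) × (A → ℝ)) × (B → ℝ) => (q.1.2, q.2) := by fun_prop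
    have h4 : Measurable fun q : ((D → ℝ) × (A → ℝ)) × (B → ℝ) => (q.1.1, q.2) := by fun_prop
    have h5 := hpl.comp h4
    exact (hG.comp h3).mul h5
  have h2 := hM.lintegral_path_obs_swap (A := A) hη hx hin
  rw [lintegral_map hG (hA.prodMk hB), Measure.lintegral_compProd hG]
  refine h1.trans (h2.trans ?_)
  rw [hM.map_obs hη hx, lintegral_withDensity_eq_lintegral_mul _ hem
    (hG.lintegral_kernel_prod_right' (κ := predictiveKernel P η f x A B))]
  refine lintegral_congr fun a => ?_
  have hl : Measurable fun q : Ω × (B → ℝ) =>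
      ENNReal.ofReal (pathLikelihood η hx B (path D f q.1) q.2) := by
    have h3 := hpl.comp ((hM.measurable_path.comp measurable_fst).prodMk measurable_snd)
    exact h3
  have hlA : Measurable fun q : Ω =>
      ENNReal.ofReal (likelihood η A (fun i => f (x i) q) (extendZero a)) :=
    (hM.measurable_likelihood hx _).ennreal_ofReal
  have hGa : Measurable fun u : B → ℝ => G (a, u) := hG.comp measurable_prodMk_left
  have hpa : Measurable fun u : B → ℝ => ENNReal.ofReal (predictive P η f x A B a u) := by
    have h3 := hpm.comp (measurable_prodMk_left (x := a))
    exact h3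
  have hpG : Measurable fun u : B → ℝ => ENNReal.ofReal (predictive P η f x A B a u) * G (a, u) :=
    hpa.mul hGa
  rw [Pi.mul_apply, hM.lintegral_predictiveKernel hx a hGa, ← lintegral_const_mul _ hpG]
  have h3 : ∀ ω, (∫⁻ u : B → ℝ, G (a, u) * ENNReal.ofReal (pathLikelihood η hx B (path D f ω) u)
      ∂(Measure.pi fun _ => noiseLaw η)) *
      ENNReal.ofReal (likelihood η A (fun i => f (x i) ω) (extendZero a)) =
      ∫⁻ u : B → ℝ, G (a, u) * ENNReal.ofReal (pathLikelihood η hx B (path D f ω) u) *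
        ENNReal.ofReal (likelihood η A (fun i => f (x i) ω) (extendZero a))
      ∂(Measure.pi fun _ => noiseLaw η) := fun ω =>
    (lintegral_mul_const _ (hGa.mul (hl.comp measurable_prodMk_left))).symm
  simp only [h3]
  rw [lintegral_lintegral_swap (((hGa.comp measurable_snd).mul hl).mul
    (hlA.comp measurable_fst)).aemeasurable]
  refine lintegral_congr fun b => ?_
  rw [← mul_assoc, hM.evidence_mul_predictive hη hx, mul_comm, evidence,
    ← lintegral_const_mul _ (hM.measurable_likelihood hx _).ennreal_ofReal]
  refine lintegral_congr fun ω => ?_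
  rw [likelihood_union_add hAB, ENNReal.ofReal_mul (likelihood_pos _ _ _ _).le, pathLikelihood]
  simp only [path]
  ring

/-- The information in further observations at a fixed design about the path. -/
theorem IsModel.condMutualInfo_eq (hM : IsModel P D k η f ε w) (hη : 0 < η) (hx : ∀ i, x i ∈ D)
    (hAB : Disjoint A B) :
    condMutualInfo P (path D f) (obs f ε B x) (obs f ε A x) =
      ENNReal.ofReal (infoGain P η f ε x (A ∪ B) - infoGain P η f ε x A) := by
  have hmk := hM.isMarkovKernel_predictiveKernel hη hx hAB
  have hA := hM.measurable_obs (A := A) hx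
  have hB := hM.measurable_obs (A := B) hx
  have hU : Measurable fun ω => (path D f ω, obs f ε A x ω) := hM.measurable_path.prodMk hA
  have hJ := hU.prodMk hB
  have := Measure.isProbabilityMeasure_map (μ := P) hU.aemeasurable
  have := Measure.isProbabilityMeasure_map (μ := P) hJ.aemeasurable
  have hpl := measurable_pathLikelihood (η := η) (A := B) hx
  have hp : Measurable fun q : ((D → ℝ) × (A → ℝ)) × (B → ℝ) =>
      pathLikelihood η hx B q.1.1 q.2 := by
    have h4 : Measurable fun q : ((D → ℝ) × (A → ℝ)) × (B → ℝ) => (q.1.1, q.2) := by fun_prop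
    have h5 := hpl.comp h4
    exact h5
  have hq : Measurable fun q : ((D → ℝ) × (A → ℝ)) × (B → ℝ) =>
      predictive P η f x A B q.1.2 q.2 := by
    have h4 : Measurable fun q : ((D → ℝ) × (A → ℝ)) × (B → ℝ) => (q.1.2, q.2) := by fun_prop
    have h5 := (hM.measurable_predictive (A := A) (B := B) hx).comp h4
    exact h5
  set ν₀ := (P.map fun ω => (path D f ω, obs f ε A x ω)).prod
    (Measure.pi fun _ : B => noiseLaw η) with hν₀
  have hμ : P.map (fun ω => ((path D f ω, obs f ε A x ω), obs f ε B x ω)) =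
      ν₀.withDensity fun q => ENNReal.ofReal (pathLikelihood η hx B q.1.1 q.2) := by
    refine Measure.ext_of_lintegral _ fun G hG => ?_
    have hp' := hp.ennreal_ofReal
    rw [lintegral_map hG hJ, hM.lintegral_path_obs_obs hη hx hAB hG,
      lintegral_withDensity_eq_lintegral_mul _ hp' hG, lintegral_prod _ (hp'.mul hG).aemeasurable,
      lintegral_map (hp'.mul hG).lintegral_prod_right' hU]
    refine lintegral_congr fun ω => lintegral_congr fun u => ?_
    rw [Pi.mul_apply, mul_comm]
  have hν : (P.map (fun ω => (path D f ω, obs f ε A x ω))) ⊗ₘ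
      (Kernel.prodMkLeft (D → ℝ) (condDistrib (obs f ε B x) (obs f ε A x) P)) =
      ν₀.withDensity fun q => ENNReal.ofReal (predictive P η f x A B q.1.2 q.2) := by
    -- The conditional law is determined only up to null sets of the observations in `A`; these pull
    -- back to null sets of the pair of path and observations.
    have hcong : Kernel.prodMkLeft (D → ℝ) (condDistrib (obs f ε B x) (obs f ε A x) P)
        =ᵐ[P.map (fun ω => (path D f ω, obs f ε A x ω))]
        Kernel.prodMkLeft (D → ℝ) (predictiveKernel P η f x A B) := by
      have h1 := hM.condDistrib_obs hη hx hAB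
      have h2 : P.map (obs f ε A x) =
          (P.map (fun ω => (path D f ω, obs f ε A x ω))).map Prod.snd := by
        rw [Measure.map_map measurable_snd hU]; rfl
      rw [h2] at h1
      filter_upwards [ae_of_ae_map measurable_snd.aemeasurable h1] with p hp
      rw [Kernel.prodMkLeft_apply, Kernel.prodMkLeft_apply, hp]
    rw [Measure.compProd_congr hcong]
    refine Measure.ext_of_lintegral _ fun G hG => ?_
    have hq' := hq.ennreal_ofReal
    rw [Measure.lintegral_compProd hG, lintegral_withDensity_eq_lintegral_mul _ hq' hG,
      lintegral_prod _ (hq'.mul hG).aemeasurable]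
    refine lintegral_congr fun p => ?_
    have hGp : Measurable fun u : B → ℝ => G (p, u) := hG.comp measurable_prodMk_left
    rw [Kernel.prodMkLeft_apply, hM.lintegral_predictiveKernel hx _ hGp]
    rfl
  have hlog : Measurable fun q : ((D → ℝ) × (A → ℝ)) × (B → ℝ) =>
      Real.log (pathLikelihood η hx B q.1.1 q.2) -
        Real.log (predictive P η f x A B q.1.2 q.2) := hp.log.sub hq.log
  have heq : ∀ ω, Real.log (pathLikelihood η hx B (path D f ω) (obs f ε B x ω)) -
      Real.log (predictive P η f x A B (obs f ε A x ω) (obs f ε B x ω)) =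
      infoDensity P η f ε x (A ∪ B) ω - infoDensity P η f ε x A ω := by
    intro ω
    have h1 : evidence P η f x (A ∪ B) (extendZero (obs f ε A x ω) + extendZero (obs f ε B x ω)) =
        evidence P η f x (A ∪ B) (fullObs f ε x ω) := by
      refine evidence_congr fun i hi => ?_
      rcases Finset.mem_union.mp hi with hi | hi
      · rw [extendZero_add_left hAB _ _ hi, extendZero, dif_pos hi, obs, fullObs]
      · rw [extendZero_add_right hAB _ _ hi, extendZero, dif_pos hi, obs, fullObs]
    rw [predictive, Real.log_div (hM.toReal_evidence_pos hη hx _).ne'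
      (hM.toReal_evidence_pos hη hx _).ne', h1, evidence_extendZero_obs, pathLikelihood,
      likelihood_extendZero_obs, infoDensity, infoDensity, likelihood_union hAB,
      Real.log_mul (likelihood_pos _ _ _ _).ne' (likelihood_pos _ _ _ _).ne']
    simp only [path]
    ring
  rw [condMutualInfo, klDiv_withDensity hp hq (fun _ => likelihood_pos _ _ _ _)
    (fun _ => hM.predictive_pos hη hx _ _) hμ hν,
    integral_map hJ.aemeasurable hlog.aestronglyMeasurable]
  · simp only [heq]
    rw [integral_sub (hM.integrable_infoDensity hη hx) (hM.integrable_infoDensity hη hx)]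
    rfl
  · rw [integrable_map_measure hlog.aestronglyMeasurable hJ.aemeasurable]
    exact ((hM.integrable_infoDensity (A := A ∪ B) hη hx).sub
      (hM.integrable_infoDensity (A := A) hη hx)).congr
      (Eventually.of_forall fun ω => (heq ω).symm)

end Model

/-! ### Information gain against posterior variances -/

section Model

variable {d : ℕ} {Ω W : Type*} [MeasurableSpace Ω] [MeasurableSpace W] {P : Measure Ω}
  [IsProbabilityMeasure P] {D X : Set (Pt d)} {k : Pt d → Pt d → ℝ} {η : ℝ} {f : Pt d → Ω → ℝ}
  {ε : ℕ → Ω → ℝ} {w : Ω → W} {A B : Finset ℕ} {x : ℕ → Pt d} {z : Pt d}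

/-- The convex set `D` serves only the Lipschitz estimate; the rest of the argument takes place on
`X`. -/
lemma IsModel.mono (hM : IsModel P D k η f ε w) (h : X ⊆ D) : IsModel P X k η f ε w where
  measurable_f z hz := hM.measurable_f z (h hz)
  gaussian := ⟨fun I => by
    classical
    have hg := hM.gaussian.hasGaussianLaw (I.map ⟨Set.inclusion h, Set.inclusion_injective h⟩)
    let L : ((I.map ⟨Set.inclusion h, Set.inclusion_injective h⟩ : Finset D) → ℝ) →L[ℝ] (I → ℝ) :=
      ContinuousLinearMap.pi fun i => ContinuousLinearMap.proj
        ⟨Set.inclusion h i.1, Finset.mem_map_of_mem _ i.2⟩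
    exact hg.map L⟩
  mean_zero z hz := hM.mean_zero z (h hz)
  cov_eq z hz z' hz' := hM.cov_eq z (h hz) z' (h hz')
  measurable_noise := hM.measurable_noise
  law_noise := hM.law_noise
  indep_noise := hM.indep_noise
  indep_f_noise := hM.indep_f_noise.comp (φ := fun (s : D → ℝ) (z : X) => s (Set.inclusion h z))
    (ψ := id) (by fun_prop) measurable_id
  measurable_w := hM.measurable_w
  indep_w := hM.indep_w.comp
    (φ := fun s : (D → ℝ) × (ℕ → ℝ) => ((fun z : X => s.1 (Set.inclusion h z)), s.2))
    (ψ := id) (by fun_prop) measurable_id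

lemma IsModel.infoGain_range (hM : IsModel P D k η f ε w) (hη : 0 < η) (hx : ∀ i, x i ∈ D)
    (n : ℕ) : infoGain P η f ε x (Finset.range n) =
      ∑ j ∈ Finset.range n, 1 / 2 * Real.log (1 + postVar k η (Finset.range j) x (x j) / η ^ 2) := by
  induction n with
  | zero => simp [infoGain_empty]
  | succ n ih =>
    rw [Finset.range_add_one, hM.infoGain_insert hη hx Finset.notMem_range_self, ih,
      Finset.sum_insert Finset.notMem_range_self, add_comm]

lemma IsModel.log_postVar_nonneg (hM : IsModel P D k η f ε w) (hη : 0 < η) (hx : ∀ i, x i ∈ D)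
    (hz : z ∈ D) : 0 ≤ Real.log (1 + postVar k η A x z / η ^ 2) := by
  have h := hM.isFeature.postVar_nonneg (A := A) hη hx hz
  exact Real.log_nonneg (le_add_of_nonneg_right (by positivity))

lemma IsModel.infoGain_range_nonneg (hM : IsModel P D k η f ε w) (hη : 0 < η) (hx : ∀ i, x i ∈ D)
    (n : ℕ) : 0 ≤ infoGain P η f ε x (Finset.range n) := by
  rw [hM.infoGain_range hη hx]
  exact Finset.sum_nonneg fun j _ => mul_nonneg (by norm_num) (hM.log_postVar_nonneg hη hx (hx j))

lemma IsModel.infoGain_range_le (hM : IsModel P D k η f ε w) (hη : 0 < η) (hx : ∀ i, x i ∈ D)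
    (hk : ∀ z ∈ D, k z z ≤ 1) (n : ℕ) :
    infoGain P η f ε x (Finset.range n) ≤ n * (1 / 2 * Real.log (1 + 1 / η ^ 2)) := by
  rw [hM.infoGain_range hη hx, ← nsmul_eq_mul, ← Finset.card_range n, ← Finset.sum_const]
  simp only [Finset.card_range]
  refine Finset.sum_le_sum fun j _ => ?_
  have h := hM.isFeature.postVar_nonneg (A := Finset.range j) hη hx (hx j)
  have h2 := (hM.isFeature.postVar_le_prior (A := Finset.range j) hη hx (hx j)).trans (hk _ (hx j))
  gcongr

/-- Each observation brings at most `1 / 2 * log (1 + η⁻²)`. Finiteness is essential because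
`maxInfoGain` takes `toReal`, which would turn an infinite supremum into zero. -/
lemma IsModel.bddAbove_mutualInfo (hM : IsModel P D k η f ε w) (hη : 0 < η)
    (hk : ∀ z ∈ D, k z z ≤ 1) (n : ℕ) :
    (⨆ x : ℕ → D, mutualInfo P (path D f) (obs f ε (Finset.range n) (fun i => x i))) ≠ ⊤ := by
  refine ((iSup_le fun x => ?_).trans_lt (ENNReal.ofReal_lt_top
    (r := n * (1 / 2 * Real.log (1 + 1 / η ^ 2))))).ne
  · rw [hM.mutualInfo_eq hη fun i => (x i).2]
    exact ENNReal.ofReal_le_ofReal (hM.infoGain_range_le hη (fun i => (x i).2) hk n)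

lemma IsModel.infoGain_le_maxInfoGain (hM : IsModel P D k η f ε w) (hη : 0 < η)
    (hk : ∀ z ∈ D, k z z ≤ 1) (hx : ∀ i, x i ∈ D) (n : ℕ) :
    infoGain P η f ε x (Finset.range n) ≤ maxInfoGain P D f ε n := by
  have h := le_iSup (fun x : ℕ → D => mutualInfo P (path D f)
    (obs f ε (Finset.range n) (fun i => x i))) (fun i => ⟨x i, hx i⟩)
  have h2 := ENNReal.toReal_mono (hM.bddAbove_mutualInfo hη hk n) h
  simp only [hM.mutualInfo_eq (A := Finset.range n) hη hx] at h2
  rwa [ENNReal.toReal_ofReal (hM.infoGain_range_nonneg hη hx n)] at h2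

lemma postVar_empty : postVar k η ∅ x z = k z z := by
  simp [postVar, dotProduct]

/-- Querying `z` repeatedly already yields the information of its first observation. A positive
lower bound on the gain lets the asymptotic form absorb the term of order `1 / n`. -/
lemma IsModel.le_maxInfoGain (hM : IsModel P D k η f ε w) (hη : 0 < η)
    (hk : ∀ z ∈ D, k z z ≤ 1) (hz : z ∈ D) {n : ℕ} (hn : 1 ≤ n) :
    1 / 2 * Real.log (1 + k z z / η ^ 2) ≤ maxInfoGain P D f ε n := by
  refine le_trans ?_ (hM.infoGain_le_maxInfoGain hη hk (x := fun _ => z) (fun _ => hz) n)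
  rw [hM.infoGain_range hη fun _ => hz]
  refine le_trans ?_ (Finset.single_le_sum (fun j _ => mul_nonneg (by norm_num)
    (hM.log_postVar_nonneg hη (fun _ => hz) hz)) (Finset.mem_range.mpr hn))
  simp [postVar_empty]

/-- Each new observation divides the variance by at most `1 + σ² / η²`, the exponential of twice its
information increment; the increments telescope. -/
lemma IsModel.postVar_le_exp (hM : IsModel P D k η f ε w) (hη : 0 < η) (hx : ∀ i, x i ∈ D)
    (hz : z ∈ D) (A B : Finset ℕ) :
    postVar k η A x z ≤ Real.exp (2 * (infoGain P η f ε x (A ∪ B) - infoGain P η f ε x A)) *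
      postVar k η (A ∪ B) x z := by
  induction B using Finset.induction_on with
  | empty => simp
  | insert i B hi ih =>
    rw [Finset.union_insert]
    by_cases hiA : i ∈ A ∪ B
    · rwa [Finset.insert_eq_of_mem hiA]
    · have h1 := hM.isFeature.postVar_le_insert hη hx hz hiA
      have h2 := hM.isFeature.postVar_nonneg (A := A ∪ B) hη hx (hx i)
      have h3 : (0 : ℝ) < 1 + postVar k η (A ∪ B) x (x i) / η ^ 2 := by positivity
      rw [hM.infoGain_insert hη hx hiA]
      refine ih.trans ((mul_le_mul_of_nonneg_left h1 (Real.exp_pos _).le).trans_eq ?_)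
      rw [show 2 * (infoGain P η f ε x (A ∪ B) + 1 / 2 *
        Real.log (1 + postVar k η (A ∪ B) x (x i) / η ^ 2) - infoGain P η f ε x A) =
        2 * (infoGain P η f ε x (A ∪ B) - infoGain P η f ε x A) +
        Real.log (1 + postVar k η (A ∪ B) x (x i) / η ^ 2) by ring, Real.exp_add, Real.exp_log h3]
      ring

/-- A bound on the information in pending evaluations bounds the reduction of the posterior
variance by these evaluations. -/
lemma IsModel.postVar_le_mul_of_condMutualInfo_le (hM : IsModel P D k η f ε w) (hη : 0 < η)
    (hx : ∀ i, x i ∈ D) (hz : z ∈ D) (hAB : Disjoint A B) {ξ : ℝ} (hξ : 1 ≤ ξ)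
    (h : condMutualInfo P (path D f) (obs f ε B x) (obs f ε A x) ≤
      ENNReal.ofReal (1 / 2 * Real.log ξ)) :
    postVar k η A x z ≤ ξ * postVar k η (A ∪ B) x z := by
  rw [hM.condMutualInfo_eq hη hx hAB] at h
  have hl := Real.log_nonneg hξ
  rw [ENNReal.ofReal_le_ofReal_iff (by positivity)] at h
  refine (hM.postVar_le_exp hη hx hz A B).trans (mul_le_mul_of_nonneg_right ?_
    (hM.isFeature.postVar_nonneg hη hx hz))
  rw [← Real.le_log_iff_exp_le (by linarith)]
  linarith

/-- Concavity of the logarithm, in the form of Bernoulli's inequality for the exponent `s`. -/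
lemma mul_log_one_add_le {s c : ℝ} (hs0 : 0 ≤ s) (hs1 : s ≤ 1) (hc : 0 ≤ c) :
    s * Real.log (1 + c) ≤ Real.log (1 + s * c) := by
  rw [← Real.log_rpow (by linarith)]
  refine Real.log_le_log (Real.rpow_pos_of_pos (by linarith) _) ?_
  exact rpow_one_add_le_one_add_mul_self (by linarith) hs0 hs1

/-- Since variances are at most one, `s * log (1 + η⁻²) ≤ log (1 + s / η²)`, and the right sides add
up to twice the information gain. -/
lemma IsModel.sum_postVar_le (hM : IsModel P D k η f ε w) (hη : 0 < η)
    (hk : ∀ z ∈ D, k z z ≤ 1) (hx : ∀ i, x i ∈ D) (n : ℕ) :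
    ∑ j ∈ Finset.range n, postVar k η (Finset.range j) x (x j) ≤
      2 * maxInfoGain P D f ε n / Real.log (1 + (η ^ 2)⁻¹) := by
  have hlog : 0 < Real.log (1 + (η ^ 2)⁻¹) := Real.log_pos (by simp; positivity)
  rw [le_div_iff₀ hlog, Finset.sum_mul]
  refine le_trans ?_ (mul_le_mul_of_nonneg_left
    (hM.infoGain_le_maxInfoGain hη hk hx n) zero_le_two)
  rw [hM.infoGain_range hη hx, Finset.mul_sum]
  refine Finset.sum_le_sum fun j _ => ?_
  have h := hM.isFeature.postVar_nonneg (A := Finset.range j) hη hx (hx j)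
  have h2 := (hM.isFeature.postVar_le_prior (A := Finset.range j) hη hx (hx j)).trans (hk _ (hx j))
  refine (mul_log_one_add_le h h2 (by positivity)).trans_eq ?_
  rw [← mul_assoc]
  norm_num
  rfl

/-- The sum of the posterior standard deviations along a design. -/
lemma IsModel.sum_sqrt_postVar_le (hM : IsModel P D k η f ε w) (hη : 0 < η)
    (hk : ∀ z ∈ D, k z z ≤ 1) (hx : ∀ i, x i ∈ D) {c : ℝ} (hc : 0 ≤ c) {n : ℕ} (hn : 1 ≤ n) :
    ∑ j ∈ Finset.range n, Real.sqrt c * Real.sqrt (postVar k η (Finset.range j) x (x j)) ≤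
      n * Real.sqrt (2 * c * maxInfoGain P D f ε n / (n * Real.log (1 + (η ^ 2)⁻¹))) := by
  set s : ℕ → ℝ := fun j => postVar k η (Finset.range j) x (x j) with hs
  have hs0 : ∀ j, 0 ≤ s j := fun j => hM.isFeature.postVar_nonneg hη hx (hx j)
  have hlog : 0 < Real.log (1 + (η ^ 2)⁻¹) := Real.log_pos (by simp; positivity)
  have hn0 : (0 : ℝ) < n := by exact_mod_cast hn
  rw [← Finset.mul_sum]
  -- Cauchy-Schwarz.
  have h2 : ∑ j ∈ Finset.range n, Real.sqrt (s j) ≤ Real.sqrt (n * ∑ j ∈ Finset.range n, s j) := by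
    refine Real.le_sqrt_of_sq_le ?_
    have := sq_sum_le_card_mul_sum_sq (s := Finset.range n) (f := fun j => Real.sqrt (s j))
    simpa only [Finset.card_range, Real.sq_sqrt (hs0 _)] using this
  have h3 := hM.sum_postVar_le hη hk hx n
  have h4 : Real.sqrt (n * ∑ j ∈ Finset.range n, s j) ≤
      Real.sqrt (n * (2 * maxInfoGain P D f ε n / Real.log (1 + (η ^ 2)⁻¹))) := by gcongr
  refine (mul_le_mul_of_nonneg_left (h2.trans h4) (Real.sqrt_nonneg _)).trans_eq ?_
  rw [← Real.sqrt_mul hc]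
  rw [← Real.sqrt_sq hn0.le, ← Real.sqrt_mul (by positivity), Real.sqrt_sq hn0.le]
  congr 1
  field_simp

end Model

/-! ### Sample paths -/

lemma lintegral_gaussian_tail {a b : ℝ} (ha : 0 < a) (hb : 0 < b) :
    ∫⁻ t in Set.Ioi 0, ENNReal.ofReal (a * Real.exp (-(t / b) ^ 2)) =
      ENNReal.ofReal (a * b * Real.sqrt Real.pi / 2) := by
  have h1 : ∀ t : ℝ, -(t / b) ^ 2 = -(1 / b ^ 2) * t ^ 2 := fun t => by ring
  have h2 : (0 : ℝ) < 1 / b ^ 2 := by positivity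
  simp only [h1]
  rw [← ofReal_integral_eq_lintegral_ofReal
    (((integrable_exp_neg_mul_sq h2).integrableOn).const_mul a)
    (Eventually.of_forall fun t => by positivity), integral_const_mul, integral_gaussian_Ioi]
  congr 1
  rw [div_div_eq_mul_div, div_one, Real.sqrt_mul Real.pi_pos.le, Real.sqrt_sq hb.le]
  ring

/-- A family of functions whose supremum has Gaussian tails in outer measure has an integrable
majorant. -/
lemma exists_integrable_majorant {Ω ι : Type*} [MeasurableSpace Ω] {P : Measure Ω}
    [IsProbabilityMeasure P] {h : ι → Ω → ℝ} {a b : ℝ} (ha : 0 < a) (hb : 0 < b)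
    (htail : ∀ J : ℝ, 0 < J →
      P {ω | ∃ z, J < |h z ω|} ≤ ENNReal.ofReal (a * Real.exp (-(J / b) ^ 2))) :
    ∃ M : Ω → ℝ, Measurable M ∧ (∀ ω, 0 ≤ M ω) ∧ Integrable M P ∧
      ∫ ω, M ω ∂P ≤ a * b * Real.sqrt Real.pi / 2 ∧ ∀ᵐ ω ∂P, ∀ z, |h z ω| ≤ M ω := by
  classical
  -- The supremum over an uncountable index set need not be measurable. Measurable hulls of its
  -- level sets at rational heights replace it, and `N` below is the least positive rational height
  -- whose hull is left, as an infimum.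
  set T : ℝ → Set Ω := fun r => toMeasurable P {ω | ∃ z, r < |h z ω|} with hT
  have hTm : ∀ r, MeasurableSet (T r) := fun r => measurableSet_toMeasurable _ _
  have hTP : ∀ r, 0 < r → P (T r) ≤ ENNReal.ofReal (a * Real.exp (-(r / b) ^ 2)) := fun r hr => by
    rw [hT, measure_toMeasurable]; exact htail r hr
  set N : Ω → ENNReal := fun ω => ⨅ r : ℚ, if 0 < r ∧ ω ∉ T r then ENNReal.ofReal r else ⊤ with hN
  have hNm : Measurable N := by
    refine Measurable.iInf fun r => ?_
    refine Measurable.ite ?_ measurable_const measurable_const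
    by_cases hr : 0 < r
    · simp only [hr, true_and]
      exact (hTm r).compl
    · simp [hr]
  have hmem : ∀ ω (t : ℝ) (r : ℚ), ENNReal.ofReal t < N ω → 0 < r → (r : ℝ) ≤ t → ω ∈ T r := by
    intro ω t r ht hr hrt
    by_contra hω
    refine absurd ht (not_lt.mpr ((iInf_le _ r).trans ?_))
    rw [if_pos ⟨hr, hω⟩]
    exact ENNReal.ofReal_le_ofReal hrt
  have htailN : ∀ t : ℝ, 0 < t →
      P {ω | ENNReal.ofReal t < N ω} ≤ ENNReal.ofReal (a * Real.exp (-(t / b) ^ 2)) := by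
    intro t ht
    -- Rational heights below `t` carry the tail bound; letting them increase to `t` loses nothing,
    -- as the bound is continuous.
    obtain ⟨u, -, hu2, hu3⟩ := Real.exists_seq_rat_strictMono_tendsto t
    have hcont : Continuous fun s : ℝ => ENNReal.ofReal (a * Real.exp (-(s / b) ^ 2)) :=
      ENNReal.continuous_ofReal.comp (by fun_prop)
    refine ge_of_tendsto ((hcont.tendsto t).comp hu3) ?_
    filter_upwards [hu3.eventually (lt_mem_nhds ht)] with n hn
    have hn' : 0 < u n := by exact_mod_cast hn
    exact (measure_mono fun ω hω => hmem ω t (u n) hω hn' (hu2 n).le).trans (hTP _ hn)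
  have hfin : ∀ᵐ ω ∂P, N ω ≠ ⊤ := by
    rw [ae_iff]
    simp only [not_not]
    have hlim : Tendsto (fun n : ℕ => ENNReal.ofReal (a * Real.exp (-((n : ℝ) / b) ^ 2))) atTop
        (nhds 0) := by
      have h1 : Tendsto (fun n : ℕ => ((n : ℝ) / b) ^ 2) atTop atTop :=
        (tendsto_pow_atTop two_ne_zero).comp
          (tendsto_natCast_atTop_atTop.atTop_div_const hb)
      have h2 := (Real.tendsto_exp_neg_atTop_nhds_zero.comp h1).const_mul a
      have h3 := (ENNReal.continuous_ofReal.tendsto _).comp h2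
      rw [mul_zero, ENNReal.ofReal_zero] at h3
      exact h3
    refine le_antisymm (ge_of_tendsto hlim ?_) zero_le
    filter_upwards [eventually_gt_atTop 0] with n hn
    refine (measure_mono fun ω hω => ?_).trans (htailN n (by exact_mod_cast hn))
    simp only [Set.mem_ofPred_eq] at hω ⊢
    rw [hω]
    exact ENNReal.ofReal_lt_top
  have hlint : ∫⁻ ω, ENNReal.ofReal (N ω).toReal ∂P ≤
      ENNReal.ofReal (a * b * Real.sqrt Real.pi / 2) := by
    rw [lintegral_eq_lintegral_meas_lt P (Eventually.of_forall fun _ => ENNReal.toReal_nonneg)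
      hNm.ennreal_toReal.aemeasurable, ← lintegral_gaussian_tail ha hb]
    refine setLIntegral_mono_ae (by fun_prop) (Eventually.of_forall fun t ht => ?_)
    refine (measure_mono fun ω hω => ?_).trans (htailN t ht)
    simp only [Set.mem_ofPred_eq] at hω ⊢
    have : N ω ≠ ⊤ := by
      intro h
      rw [h, ENNReal.toReal_top] at hω
      exact lt_asymm hω ht
    exact (ENNReal.ofReal_lt_iff_lt_toReal (le_of_lt ht) this).mpr hω
  have hint : Integrable (fun ω => (N ω).toReal) P := by
    refine ⟨hNm.ennreal_toReal.aestronglyMeasurable, ?_⟩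
    rw [hasFiniteIntegral_iff_ofReal (Eventually.of_forall fun _ => ENNReal.toReal_nonneg)]
    exact hlint.trans_lt ENNReal.ofReal_lt_top
  refine ⟨fun ω => (N ω).toReal, hNm.ennreal_toReal, fun _ => ENNReal.toReal_nonneg, hint, ?_, ?_⟩
  · rw [integral_eq_lintegral_of_nonneg_ae (Eventually.of_forall fun _ => ENNReal.toReal_nonneg)
      hNm.ennreal_toReal.aestronglyMeasurable]
    exact ENNReal.toReal_le_of_le_ofReal (by positivity) hlint
  · filter_upwards [hfin] with ω hω z
    by_contra! hlt
    have h1 : N ω < ENNReal.ofReal |h z ω| := by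
      rwa [← ENNReal.toReal_lt_toReal hω ENNReal.ofReal_ne_top,
        ENNReal.toReal_ofReal (abs_nonneg _)]
    obtain ⟨r, hr⟩ := iInf_lt_iff.mp h1
    split_ifs at hr with hc
    · refine hc.2 (subset_toMeasurable _ _ ⟨z, ?_⟩)
      exact (ENNReal.ofReal_lt_ofReal_iff_of_nonneg (by exact_mod_cast hc.1.le)).mp hr
    · exact not_top_lt hr

/-! ### Random Lipschitz constants of the paths -/

section Lipschitz

variable {d : ℕ} {Ω : Type*} [MeasurableSpace Ω] {P : Measure Ω} [IsProbabilityMeasure P]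
  {D X : Set (Pt d)} {f : Pt d → Ω → ℝ} {a b : ℝ}

/-- Mean value inequality along the segment, which stays in `D` by convexity. The derivative in the
direction `z - z'` is at most the sum of the bounds on the partials times the largest coordinate
difference. -/
lemma abs_image_sub_le_of_abs_partial_le (hD : Convex ℝ D) {g : Pt d → ℝ}
    {g' : Pt d → Pt d →L[ℝ] ℝ} (hg : ∀ z ∈ D, HasFDerivWithinAt g (g' z) D z) {M : Fin d → ℝ}
    (hM : ∀ z ∈ D, ∀ i, |g' z (EuclideanSpace.single i 1)| ≤ M i) {z z' : Pt d} (hz : z ∈ D)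
    (hz' : z' ∈ D) {δ : ℝ} (hδ : ∀ i, |z i - z' i| ≤ δ) : |g z - g z'| ≤ (∑ i, M i) * δ := by
  set v := z - z' with hv
  have hmem : ∀ t ∈ Set.Icc (0 : ℝ) 1, z' + t • v ∈ D := fun t ht => by
    have := hD.add_smul_sub_mem hz' hz ht
    exact this
  have hline : ∀ t ∈ Set.Icc (0 : ℝ) 1, HasDerivWithinAt (fun t : ℝ => g (z' + t • v))
      (g' (z' + t • v) v) (Set.Icc 0 1) t := by
    intro t ht
    have h1 : HasDerivWithinAt (fun t : ℝ => z' + t • v) v (Set.Icc 0 1) t := by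
      have := ((hasDerivAt_id t).smul_const v).const_add z'
      simpa using this.hasDerivWithinAt
    exact (hg _ (hmem t ht)).comp_hasDerivWithinAt t h1 hmem
  have hbound : ∀ t ∈ Set.Ico (0 : ℝ) 1, ‖g' (z' + t • v) v‖ ≤ (∑ i, M i) * δ := by
    intro t ht
    have hy := hmem t ⟨ht.1, ht.2.le⟩
    have hsum : v = ∑ i, v i • EuclideanSpace.single i (1 : ℝ) := by
      ext j
      simp [Finset.sum_apply, Pi.single_apply]
    conv_lhs => rw [show g' (z' + t • v) v = g' (z' + t • v)
      (∑ i, v i • EuclideanSpace.single i (1 : ℝ)) from congrArg _ hsum]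
    rw [map_sum, Real.norm_eq_abs, Finset.sum_mul]
    refine (Finset.abs_sum_le_sum_abs _ _).trans (Finset.sum_le_sum fun i _ => ?_)
    rw [map_smul, smul_eq_mul, abs_mul, mul_comm]
    exact mul_le_mul (hM _ hy i) (hδ i) (abs_nonneg _) ((abs_nonneg _).trans (hM _ hy i))
  have := norm_image_sub_le_of_norm_deriv_le_segment_01' hline hbound
  simpa [hv] using this

/-- Almost every path is Lipschitz, with an integrable Lipschitz constant. -/
theorem GradientTails.exists_lipschitz (hgrad : GradientTails P D f a b) (ha : 0 < a) (hb : 0 < b)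
    (hD : Convex ℝ D) :
    ∃ L : Ω → ℝ, Measurable L ∧ (∀ ω, 0 ≤ L ω) ∧ Integrable L P ∧
      ∫ ω, L ω ∂P ≤ d * a * b * Real.sqrt Real.pi / 2 ∧
      ∀ᵐ ω ∂P, ∀ z ∈ D, ∀ z' ∈ D, ∀ δ, (∀ i, |z i - z' i| ≤ δ) → |f z ω - f z' ω| ≤ L ω * δ := by
  obtain ⟨f', hf', htail⟩ := hgrad
  have h := fun i : Fin d => exists_integrable_majorant (P := P)
    (h := fun (z : D) ω => f' z ω (EuclideanSpace.single i 1)) ha hb (fun J hJ => by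
      refine (measure_mono ?_).trans (htail i J hJ)
      rintro ω ⟨z, hz⟩
      exact ⟨z, z.2, hz⟩)
  choose M hMm hM0 hMi hMint hMle using h
  refine ⟨fun ω => ∑ i, M i ω, by fun_prop, fun ω => Finset.sum_nonneg fun i _ => hM0 i ω,
    integrable_finsetSum _ fun i _ => hMi i, ?_, ?_⟩
  · rw [integral_finsetSum _ fun i _ => hMi i]
    refine (Finset.sum_le_sum fun i _ => hMint i).trans_eq ?_
    simp
    ring
  · filter_upwards [hf', ae_all_iff.mpr hMle] with ω h1 h2 z hz z' hz' δ hδ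
    exact abs_image_sub_le_of_abs_partial_le hD h1 (fun y hy i => h2 i ⟨y, hy⟩) hz hz' hδ

end Lipschitz

/-! ### Measurable evaluation of a path at a random point -/

section Evaluation

variable {d : ℕ}

/-- The slack is measured from the infimal distance, not from zero, so that an index exists for
every `z` and the least one is a total measurable selection. -/
lemma exists_nearest_index (q : ℕ → Pt d) (n : ℕ) (z : Pt d) :
    ∃ m, dist z (q m) < Metric.infDist z (Set.range q) + 1 / ((n : ℝ) + 1) := by
  have h : Metric.infDist z (Set.range q) <
      Metric.infDist z (Set.range q) + 1 / ((n : ℝ) + 1) := by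
    have : (0 : ℝ) < 1 / ((n : ℝ) + 1) := by positivity
    linarith
  obtain ⟨y, ⟨m, rfl⟩, hm⟩ := (Metric.infDist_lt_iff (Set.range_nonempty q)).mp h
  exact ⟨m, hm⟩

open Classical in
/-- The value at `z` of a function known along the sequence `q`, by approximation. -/
noncomputable def evalAlong (q : ℕ → Pt d) (v : ℕ → ℝ) (z : Pt d) : ℝ :=
  limsup (fun n : ℕ => v (Nat.find (exists_nearest_index q n z))) atTop

lemma measurable_evalAlong (q : ℕ → Pt d) :
    Measurable fun p : (ℕ → ℝ) × Pt d => evalAlong q p.1 p.2 := by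
  classical
  refine Measurable.limsup fun n => ?_
  have h1 : Measurable fun z : Pt d => Nat.find (exists_nearest_index q n z) := by
    refine measurable_find _ fun m => ?_
    exact measurableSet_lt (by fun_prop) (by fun_prop)
  have h2 : Measurable fun p : (ℕ → ℝ) × ℕ => p.1 p.2 :=
    measurable_from_prod_countable_left fun m => measurable_pi_apply m
  have h3 := h2.comp (measurable_fst.prodMk
    (h1.comp (measurable_snd (α := ℕ → ℝ) (β := Pt d))))
  exact h3

/-- For `z` in `X` the infimal distance vanishes, the selected points converge to `z` within `X`,
and the upper limit is a limit. -/
lemma evalAlong_eq {q : ℕ → Pt d} {X : Set (Pt d)} (hq : ∀ m, q m ∈ X)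
    (hdense : X ⊆ closure (Set.range q)) {g : Pt d → ℝ} {z : Pt d} (hz : z ∈ X)
    (hg : ContinuousWithinAt g X z) : evalAlong q (fun m => g (q m)) z = g z := by
  classical
  have h0 : Metric.infDist z (Set.range q) = 0 :=
    (Metric.mem_closure_iff_infDist_zero (Set.range_nonempty q)).mp (hdense hz)
  refine Tendsto.limsup_eq ?_
  have h1 : Tendsto (fun n : ℕ => q (Nat.find (exists_nearest_index q n z))) atTop
      (nhdsWithin z X) := by
    refine tendsto_nhdsWithin_iff.mpr ⟨?_, Eventually.of_forall fun n => hq _⟩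
    rw [tendsto_iff_dist_tendsto_zero]
    refine squeeze_zero (fun _ => dist_nonneg) (fun n => ?_) tendsto_one_div_add_atTop_nhds_zero_nat
    have := Nat.find_spec (exists_nearest_index q n z)
    rw [dist_comm]
    linarith
  exact hg.tendsto.comp h1

lemma exists_dense_sequence {X : Set (Pt d)} (hX : X.Nonempty) :
    ∃ q : ℕ → Pt d, (∀ m, q m ∈ X) ∧ X ⊆ closure (Set.range q) := by
  have := hX.to_subtype
  obtain ⟨u, hu⟩ := TopologicalSpace.exists_dense_seq X
  refine ⟨fun m => u m, fun m => (u m).2, fun z hz => ?_⟩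
  have h1 := image_closure_subset_closure_image (s := Set.range u) continuous_subtype_val
    ⟨⟨z, hz⟩, hu _, rfl⟩
  rwa [← Set.range_comp] at h1

end Evaluation

/-! ### Adaptive designs -/

section Measurability

variable {α : Type*} [MeasurableSpace α] {d : ℕ}

lemma measurable_matrix_det {ι : Type*} [Fintype ι] [DecidableEq ι] {M : α → Matrix ι ι ℝ}
    (hM : ∀ i j, Measurable fun a => M a i j) : Measurable fun a => (M a).det := by
  simp only [Matrix.det_apply']
  exact Finset.measurable_sum _ fun σ _ => measurable_const.mul
    (Finset.measurable_prod _ fun i _ => hM _ _)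

lemma measurable_matrix_inv {ι : Type*} [Fintype ι] [DecidableEq ι] {M : α → Matrix ι ι ℝ}
    (hM : ∀ i j, Measurable fun a => M a i j) (i j : ι) : Measurable fun a => (M a)⁻¹ i j := by
  simp only [Matrix.inv_def, Matrix.smul_apply, smul_eq_mul, Ring.inverse_eq_inv',
    Matrix.adjugate_apply]
  refine (measurable_matrix_det hM).inv.mul (measurable_matrix_det fun i' j' => ?_)
  simp only [Matrix.updateRow_apply]
  split_ifs
  · exact measurable_const
  · exact hM _ _

variable {k : Pt d → Pt d → ℝ} {η : ℝ} {B : Finset ℕ} {xs : α → ℕ → Pt d} {u : α → ℕ → ℝ}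
  {z : α → Pt d}

lemma measurable_kernelVec (hk : Measurable fun p : Pt d × Pt d => k p.1 p.2)
    (hxs : ∀ i, Measurable fun a => xs a i) (hz : Measurable z) (i : B) :
    Measurable fun a => kernelVec k B (xs a) (z a) i :=
  hk.comp ((hxs i).prodMk hz)

lemma measurable_noisyGram_inv (hk : Measurable fun p : Pt d × Pt d => k p.1 p.2)
    (hxs : ∀ i, Measurable fun a => xs a i) (i j : B) :
    Measurable fun a => (noisyGram k η B (xs a))⁻¹ i j := by
  refine measurable_matrix_inv (fun i j => ?_) i j
  simp only [noisyGram, Matrix.add_apply, Matrix.of_apply]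
  exact (hk.comp ((hxs i).prodMk (hxs j))).add measurable_const

lemma measurable_postMean (hk : Measurable fun p : Pt d × Pt d => k p.1 p.2)
    (hxs : ∀ i, Measurable fun a => xs a i) (hu : ∀ i, Measurable fun a => u a i)
    (hz : Measurable z) : Measurable fun a => postMean k η B (xs a) (u a) (z a) := by
  simp only [postMean, dotProduct, Matrix.mulVec]
  exact Finset.measurable_sum _ fun i _ => (measurable_kernelVec hk hxs hz i).mul
    (Finset.measurable_sum _ fun j _ => (measurable_noisyGram_inv hk hxs i j).mul (hu j))

lemma measurable_postVar (hk : Measurable fun p : Pt d × Pt d => k p.1 p.2)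
    (hxs : ∀ i, Measurable fun a => xs a i) (hz : Measurable z) :
    Measurable fun a => postVar k η B (xs a) (z a) := by
  simp only [postVar, dotProduct, Matrix.mulVec]
  exact (hk.comp (hz.prodMk hz)).sub (Finset.measurable_sum _ fun i _ =>
    (measurable_kernelVec hk hxs hz i).mul (Finset.measurable_sum _ fun j _ =>
      (measurable_noisyGram_inv hk hxs i j).mul (measurable_kernelVec hk hxs hz j)))

variable {k' : Pt d → Pt d → ℝ} {X : Set (Pt d)} {x x' : ℕ → Pt d} {y y' : ℕ → ℝ} {p : Pt d}

lemma noisyGram_congr (hk : ∀ z ∈ X, ∀ z' ∈ X, k z z' = k' z z') (hx : ∀ i, x i ∈ X)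
    (hxx : ∀ i ∈ B, x i = x' i) :
    noisyGram k η B x = noisyGram k' η B x' := by
  ext i j
  simp only [noisyGram, Matrix.add_apply, Matrix.of_apply]
  rw [hk _ (hx i) _ (hx j), hxx i i.2, hxx j j.2]

lemma kernelVec_congr (hk : ∀ z ∈ X, ∀ z' ∈ X, k z z' = k' z z') (hx : ∀ i, x i ∈ X)
    (hxx : ∀ i ∈ B, x i = x' i) (hp : p ∈ X) : kernelVec k B x p = kernelVec k' B x' p := by
  funext i
  rw [kernelVec, kernelVec, hk _ (hx i) _ hp, hxx i i.2]

lemma postVar_congr (hk : ∀ z ∈ X, ∀ z' ∈ X, k z z' = k' z z') (hx : ∀ i, x i ∈ X)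
    (hxx : ∀ i ∈ B, x i = x' i) (hp : p ∈ X) : postVar k η B x p = postVar k' η B x' p := by
  rw [postVar, postVar, hk _ hp _ hp, noisyGram_congr hk hx hxx, kernelVec_congr hk hx hxx hp]

lemma postMean_congr (hk : ∀ z ∈ X, ∀ z' ∈ X, k z z' = k' z z') (hx : ∀ i, x i ∈ X)
    (hxx : ∀ i ∈ B, x i = x' i) (hy : ∀ i ∈ B, y i = y' i) (hp : p ∈ X) :
    postMean k η B x y p = postMean k' η B x' y' p := by
  rw [postMean, postMean, noisyGram_congr hk hx hxx, kernelVec_congr hk hx hxx hp,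
    show (fun i : B => y i) = fun i : B => y' i from funext fun i => hy i i.2]

lemma measurable_evalAlong_comp {q : ℕ → Pt d} {v : α → ℕ → ℝ} (hv : Measurable v)
    (hz : Measurable z) : Measurable fun a => evalAlong q (v a) (z a) := by
  have h := (measurable_evalAlong q).comp (hv.prodMk hz)
  exact h

lemma measurable_of_countable_cases {β ι : Type*} [MeasurableSpace β] [Countable ι] {c : α → ι}
    (hc : ∀ i, MeasurableSet {a | c a = i}) {F : ι → α → β} (hF : ∀ i, Measurable (F i)) :
    Measurable fun a => F (c a) a := by
  intro s hs
  have : (fun a => F (c a) a) ⁻¹' s = ⋃ i, {a | c a = i} ∩ F i ⁻¹' s := by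
    ext a; simp
  rw [this]
  exact MeasurableSet.iUnion fun i => (hc i).inter (hF i hs)

end Measurability

/-! ### Posterior law for adaptive designs -/

section Adaptive

variable {d : ℕ} {Ω W : Type*} [MeasurableSpace Ω] [MeasurableSpace W] {P : Measure Ω}
  [IsProbabilityMeasure P] {X : Set (Pt d)} {k : Pt d → Pt d → ℝ} {η : ℝ} {f : Pt d → Ω → ℝ}
  {ε : ℕ → Ω → ℝ} {w : Ω → W} {q : ℕ → Pt d}

/-- Almost every path on `X` is recovered from its values along the sequence `q` of points of
`X`. -/
structure IsDetermining (P : Measure Ω) (X : Set (Pt d)) (f : Pt d → Ω → ℝ) (q : ℕ → Pt d) :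
    Prop where
  mem : ∀ m, q m ∈ X
  eval_eq : ∀ᵐ ω ∂P, ∀ z ∈ X, evalAlong q (fun m => f (q m) ω) z = f z ω

/-- The covariance of the path reconstructed along `q`; it agrees with the kernel on `X` and is
measurable. -/
noncomputable def evalCov (P : Measure Ω) (f : Pt d → Ω → ℝ) (q : ℕ → Pt d) (z z' : Pt d) : ℝ :=
  ∫ ω, evalAlong q (fun m => f (q m) ω) z * evalAlong q (fun m => f (q m) ω) z' ∂P

lemma IsModel.measurable_samples (hM : IsModel P X k η f ε w) (hq : IsDetermining P X f q) :
    Measurable fun ω m => f (q m) ω :=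
  measurable_pi_iff.mpr fun m => hM.measurable_f _ (hq.mem m)

lemma IsModel.measurable_evalCov (hM : IsModel P X k η f ε w) (hq : IsDetermining P X f q) :
    Measurable fun p : Pt d × Pt d => evalCov P f q p.1 p.2 := by
  have hs := hM.measurable_samples hq
  have hs' : Measurable fun p : (Pt d × Pt d) × Ω => fun m => f (q m) p.2 := hs.comp measurable_snd
  have h1 : Measurable fun p : (Pt d × Pt d) × Ω => evalAlong q (fun m => f (q m) p.2) p.1.1 :=
    measurable_evalAlong_comp hs' (by fun_prop)
  have h2 : Measurable fun p : (Pt d × Pt d) × Ω => evalAlong q (fun m => f (q m) p.2) p.1.2 :=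
    measurable_evalAlong_comp hs' (by fun_prop)
  exact ((h1.mul h2).stronglyMeasurable.integral_prod_right' (ν := P)).measurable

lemma IsModel.evalCov_eq (hM : IsModel P X k η f ε w) (hq : IsDetermining P X f q) :
    ∀ z ∈ X, ∀ z' ∈ X, evalCov P f q z z' = k z z' := by
  intro z hz z' hz'
  rw [← hM.integral_f_mul_f hz hz']
  refine integral_congr_ae ?_
  filter_upwards [hq.eval_eq] with ω hω
  rw [hω z hz, hω z' hz']

lemma lintegral_gaussianReal_eq_scale {s : ℝ} (hs : 0 ≤ s) {g : ℝ → ENNReal} (hg : Measurable g) :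
    ∫⁻ t, g t ∂(gaussianReal 0 s.toNNReal) =
      ∫⁻ t, g (Real.sqrt s * t) ∂(gaussianReal 0 1) := by
  have h := gaussianReal_map_const_mul (μ := 0) (v := 1) (Real.sqrt s)
  have h2 : (gaussianReal 0 1).map (Real.sqrt s * ·) = gaussianReal 0 s.toNNReal := by
    rw [h, mul_zero, mul_one]
    congr 1
    ext
    simp [Real.sq_sqrt hs, hs]
  rw [← h2, lintegral_map hg (by fun_prop)]

variable {B : Finset ℕ} {xs : W × (B → ℝ) → ℕ → Pt d} {z : W × (B → ℝ) → Pt d}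
  {e : W × (B → ℝ) → ENNReal}

/-- The values observed in `B` when the design is adapted to them. -/
noncomputable def adaptiveObs (q : ℕ → Pt d) (f : Pt d → Ω → ℝ) (ε : ℕ → Ω → ℝ) (w : Ω → W)
    {B : Finset ℕ} (xs : W × (B → ℝ) → ℕ → Pt d) (ω : Ω) : B → ℝ :=
  driftSolution (fun i u => evalAlong q (fun m => f (q m) ω) (xs (w ω, u) i)) fun i : B => ε i ω

lemma IsModel.indepFun_w_samples_noise (hM : IsModel P X k η f ε w) (hq : IsDetermining P X f q)
    (B : Finset ℕ) :
    IndepFun (fun ω => (w ω, fun m => f (q m) ω)) (fun ω (i : B) => ε i ω) P := by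
  refine indepFun_prodMk_left hM.measurable_w (hM.measurable_samples hq)
    (measurable_pi_iff.mpr fun i => hM.measurable_noise i) ?_ ?_
  · exact (hM.indep_w.comp (φ := fun s : (X → ℝ) × (ℕ → ℝ) =>
      ((fun m => s.1 ⟨q m, hq.mem m⟩ : ℕ → ℝ), (fun i => s.2 i : B → ℝ))) (ψ := id)
      (by fun_prop) measurable_id).symm
  · exact (hM.indepFun_path_noise B).comp
      (φ := fun (s : X → ℝ) (m : ℕ) => s ⟨q m, hq.mem m⟩) (ψ := id) (by fun_prop) measurable_id

lemma IsModel.indepFun_w_samples (hM : IsModel P X k η f ε w) (hq : IsDetermining P X f q) :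
    IndepFun w (fun ω m => f (q m) ω) P :=
  (hM.indep_w.comp (φ := fun (s : (X → ℝ) × (ℕ → ℝ)) (m : ℕ) => s.1 ⟨q m, hq.mem m⟩) (ψ := id)
      (by fun_prop) measurable_id).symm

lemma IsModel.lintegral_w_samples (hM : IsModel P X k η f ε w) (hq : IsDetermining P X f q)
    {K : W × (ℕ → ℝ) → ENNReal} (hK : Measurable K) :
    ∫⁻ ω, K (w ω, fun m => f (q m) ω) ∂P =
      ∫⁻ v, ∫⁻ ω, K (v, fun m => f (q m) ω) ∂P ∂(P.map w) := by
  have hs := hM.measurable_samples hq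
  have h := (indepFun_iff_map_prod_eq_prod_map_map hM.measurable_w.aemeasurable
    hs.aemeasurable).mp (hM.indepFun_w_samples hq)
  rw [← lintegral_map (f := K) (g := fun ω => (w ω, fun m => f (q m) ω)) hK
    (hM.measurable_w.prodMk hs), h, lintegral_prod _ hK.aemeasurable]
  refine lintegral_congr fun v => ?_
  have hKv : Measurable fun y : ℕ → ℝ => K (v, y) := hK.comp measurable_prodMk_left
  rw [lintegral_map hKv hs]

/-- After the change of measure the observed values are integration variables independent of `f`.
With `w` frozen as well, design and evaluation point are fixed, and only a fixed-design integral
over the path remains. -/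
lemma IsModel.lintegral_adaptiveObs (hM : IsModel P X k η f ε w) (hη : 0 < η)
    (hq : IsDetermining P X f q) (hxs : ∀ i, Measurable fun a => xs a i) (hxX : ∀ a i, xs a i ∈ X)
    (hadapt : ∀ v (i : B) u u', (∀ l < i, u l = u' l) → xs (v, u) i = xs (v, u') i)
    (hz : Measurable z) (hzX : ∀ a, z a ∈ X) (he : Measurable e)
    {g : ℝ × ℝ → ENNReal} (hg : Measurable g) :
    ∫⁻ ω, e (w ω, adaptiveObs q f ε w xs ω) *
      g (evalAlong q (fun m => f (q m) ω) (z (w ω, adaptiveObs q f ε w xs ω)) -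
        postMean (evalCov P f q) η B (xs (w ω, adaptiveObs q f ε w xs ω))
          (extendZero (adaptiveObs q f ε w xs ω)) (z (w ω, adaptiveObs q f ε w xs ω)),
        postVar (evalCov P f q) η B (xs (w ω, adaptiveObs q f ε w xs ω))
          (z (w ω, adaptiveObs q f ε w xs ω))) ∂P =
      ∫⁻ v, ∫⁻ u, e (v, u) * (evidence P η f (xs (v, u)) B (extendZero u) *
        ∫⁻ t, g (Real.sqrt (postVar (evalCov P f q) η B (xs (v, u)) (z (v, u))) * t,
          postVar (evalCov P f q) η B (xs (v, u)) (z (v, u))) ∂(gaussianReal 0 1))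
        ∂(Measure.pi fun _ => noiseLaw η) ∂(P.map w) := by
  have hs := hM.measurable_samples hq
  have hk := hM.measurable_evalCov hq
  have hmB : Measurable fun ω (i : B) => ε i ω :=
    measurable_pi_iff.mpr fun i => hM.measurable_noise i
  have hext : ∀ i, Measurable fun a : W × (B → ℝ) => extendZero a.2 i := fun i =>
    (measurable_pi_apply i).comp ((measurable_extendZero B).comp measurable_snd)
  have hμ : Measurable fun a : W × (B → ℝ) =>
      postMean (evalCov P f q) η B (xs a) (extendZero a.2) (z a) :=
    measurable_postMean hk hxs hext hz
  have hσ : Measurable fun a : W × (B → ℝ) => postVar (evalCov P f q) η B (xs a) (z a) :=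
    measurable_postVar hk hxs hz
  have hpr : Measurable fun p : (W × (ℕ → ℝ)) × (B → ℝ) => (p.1.1, p.2) := by fun_prop
  have hdrift : ∀ i : B, Measurable fun p : (W × (ℕ → ℝ)) × (B → ℝ) =>
      evalAlong q p.1.2 (xs (p.1.1, p.2) i) := fun i =>
    measurable_evalAlong_comp (by fun_prop) ((hxs i).comp hpr)
  set G : (W × (ℕ → ℝ)) × (B → ℝ) → ENNReal := fun p => e (p.1.1, p.2) *
    g (evalAlong q p.1.2 (z (p.1.1, p.2)) -
      postMean (evalCov P f q) η B (xs (p.1.1, p.2)) (extendZero p.2) (z (p.1.1, p.2)),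
      postVar (evalCov P f q) η B (xs (p.1.1, p.2)) (z (p.1.1, p.2))) with hGdef
  have hG : Measurable G := by
    have h1 : Measurable fun p : (W × (ℕ → ℝ)) × (B → ℝ) =>
        evalAlong q p.1.2 (z (p.1.1, p.2)) :=
      measurable_evalAlong_comp (by fun_prop) (hz.comp hpr)
    have h2 := hμ.comp hpr
    have h3 := hσ.comp hpr
    exact (he.comp hpr).mul (hg.comp ((h1.sub h2).prodMk h3))
  -- The random element carries `w` and the samples of `f` along `q`; together they determine the
  -- drift as a measurable function of the earlier observations.
  have h := lintegral_adaptive_of_indepFun hη (hM.measurable_w.prodMk hs) hmB (hM.map_noise B)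
    (hM.indepFun_w_samples_noise hq B)
    (c := fun (s : W × (ℕ → ℝ)) (i : B) u => evalAlong q s.2 (xs (s.1, u) i)) hdrift
    (fun s i u u' huu => by rw [hadapt s.1 i u u' huu]) hG
  refine h.trans ?_
  have hT : Measurable fun p : (W × (ℕ → ℝ)) × (B → ℝ) =>
      G p * ∏ i : B, ENNReal.ofReal (tilt η (evalAlong q p.1.2 (xs (p.1.1, p.2) i)) (p.2 i)) := by
    refine hG.mul (Finset.measurable_prod _ fun i _ => ?_)
    have h1 : Measurable fun p : (W × (ℕ → ℝ)) × (B → ℝ) =>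
        (evalAlong q p.1.2 (xs (p.1.1, p.2) i), p.2 i) := (hdrift i).prodMk (by fun_prop)
    have h2 := ((measurable_tilt η).comp h1).ennreal_ofReal
    exact h2
  have hTK : Measurable fun s : W × (ℕ → ℝ) => ∫⁻ u, G (s, u) *
      ∏ i : B, ENNReal.ofReal (tilt η (evalAlong q s.2 (xs (s.1, u) i)) (u i))
      ∂(Measure.pi fun _ => noiseLaw η) := hT.lintegral_prod_right'
  refine (hM.lintegral_w_samples hq hTK).trans (lintegral_congr fun v => ?_)
  have hTv : Measurable fun p : Ω × (B → ℝ) => G ((v, fun m => f (q m) p.1), p.2) *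
      ∏ i : B, ENNReal.ofReal (tilt η (evalAlong q (fun m => f (q m) p.1) (xs (v, p.2) i))
        (p.2 i)) := by
    have h1 : Measurable fun p : Ω × (B → ℝ) => (((v, fun m => f (q m) p.1), p.2) :
        (W × (ℕ → ℝ)) × (B → ℝ)) :=
      (measurable_const.prodMk (hs.comp measurable_fst)).prodMk measurable_snd
    have h2 := hT.comp h1
    exact h2
  rw [lintegral_lintegral_swap hTv.aemeasurable]
  refine lintegral_congr fun u => ?_
  have hkk := hM.evalCov_eq hq
  have hmean : postMean (evalCov P f q) η B (xs (v, u)) (extendZero u) (z (v, u)) =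
      postMean k η B (xs (v, u)) (extendZero u) (z (v, u)) :=
    AsyncBO.postMean_congr hkk (hxX _) (fun _ _ => rfl) (fun _ _ => rfl) (hzX _)
  have hvar : postVar (evalCov P f q) η B (xs (v, u)) (z (v, u)) =
      postVar k η B (xs (v, u)) (z (v, u)) :=
    postVar_congr hkk (hxX _) (fun _ _ => rfl) (hzX _)
  have hgm : Measurable fun t : ℝ =>
      g (t - postMean k η B (xs (v, u)) (extendZero u) (z (v, u)),
        postVar k η B (xs (v, u)) (z (v, u))) :=
    hg.comp ((measurable_id.sub measurable_const).prodMk measurable_const)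
  have hgm2 : Measurable fun t : ℝ => g (t, postVar k η B (xs (v, u)) (z (v, u))) :=
    hg.comp (measurable_id.prodMk measurable_const)
  -- Bayes' rule for the design `xs (v, u)` at the value `u` that produced it; this needs the rule
  -- at every `u`.
  have hkey := hM.lintegral_mul_likelihood (A := B) hη (hxX (v, u)) (hzX (v, u)) hgm (extendZero u)
  simp only [add_sub_cancel_right] at hkey
  rw [lintegral_gaussianReal_eq_scale (hM.isFeature.postVar_nonneg hη (hxX _) (hzX _)) hgm2]
    at hkey
  rw [hvar, evidence, ← hkey, ← lintegral_const_mul]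
  · refine lintegral_congr_ae ?_
    filter_upwards [hq.eval_eq] with ω hω
    simp only [hGdef]
    rw [hmean, hvar, hω _ (hzX _), mul_assoc]
    congr 2
    rw [ofReal_likelihood]
    refine Finset.prod_congr rfl fun i _ => ?_
    rw [hω _ (hxX _ _)]
  · exact (hgm.comp (hM.measurable_f _ (hzX _))).mul
      (hM.measurable_likelihood (hxX _) _).ennreal_ofReal

/-- Given the observations at an adaptive design, `f` at a point computed from the observations is
Gaussian with the posterior mean and the posterior variance of the fixed design. -/
theorem IsModel.lintegral_adaptive_posterior (hM : IsModel P X k η f ε w) (hη : 0 < η)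
    (hq : IsDetermining P X f q) (hxs : ∀ i, Measurable fun a => xs a i) (hxX : ∀ a i, xs a i ∈ X)
    (hadapt : ∀ v (i : B) u u', (∀ l < i, u l = u' l) → xs (v, u) i = xs (v, u') i)
    (hz : Measurable z) (hzX : ∀ a, z a ∈ X) (he : Measurable e)
    {g : ℝ × ℝ → ENNReal} (hg : Measurable g) :
    ∫⁻ ω, e (w ω, adaptiveObs q f ε w xs ω) *
      g (evalAlong q (fun m => f (q m) ω) (z (w ω, adaptiveObs q f ε w xs ω)) -
        postMean (evalCov P f q) η B (xs (w ω, adaptiveObs q f ε w xs ω))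
          (extendZero (adaptiveObs q f ε w xs ω)) (z (w ω, adaptiveObs q f ε w xs ω)),
        postVar (evalCov P f q) η B (xs (w ω, adaptiveObs q f ε w xs ω))
          (z (w ω, adaptiveObs q f ε w xs ω))) ∂P =
      ∫⁻ ω, e (w ω, adaptiveObs q f ε w xs ω) *
        ∫⁻ t, g (Real.sqrt (postVar (evalCov P f q) η B (xs (w ω, adaptiveObs q f ε w xs ω))
          (z (w ω, adaptiveObs q f ε w xs ω))) * t,
          postVar (evalCov P f q) η B (xs (w ω, adaptiveObs q f ε w xs ω))
          (z (w ω, adaptiveObs q f ε w xs ω))) ∂(gaussianReal 0 1) ∂P := by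
  -- The preceding formula is applied twice, to `g` and to its Gaussian average. The average depends
  -- only on the variance, so averaging it again changes nothing and the two results coincide.
  have hg' : Measurable fun p : ℝ × ℝ =>
      ∫⁻ t, g (Real.sqrt p.2 * t, p.2) ∂(gaussianReal 0 1) := by
    refine Measurable.lintegral_prod_right' (f := fun r : (ℝ × ℝ) × ℝ =>
      g (Real.sqrt r.1.2 * r.2, r.1.2)) (hg.comp (by fun_prop))
  rw [hM.lintegral_adaptiveObs hη hq hxs hxX hadapt hz hzX he hg]
  refine Eq.trans ?_ (hM.lintegral_adaptiveObs hη hq hxs hxX hadapt hz hzX he hg').symm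
  simp

end Adaptive

/-! ### The run as a function of the observed values -/

section DeterministicRun

variable {d : ℕ} {W : Type*} (S : ℕ → W → (ℕ → Pt d) → Finset ℕ)
  (R : ℕ → Finset ℕ → W → (ℕ → Pt d × ℝ) → Pt d) (X : Set (Pt d)) (x₀ : Pt d)

open Classical in
/-- The point itself if it lies in `X`, and `x₀` otherwise. -/
noncomputable def projTo (p : Pt d) : Pt d := if p ∈ X then p else x₀

/-- The next location, computed from the earlier locations and the observed values. -/
noncomputable def runStep (v : W) (u : ℕ → ℝ) (m : ℕ) (xs : ℕ → Pt d) : Pt d :=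
  projTo X x₀ (R m (S m v fun i => if i < m then xs i else 0) v fun i =>
    if i ∈ S m v (fun i => if i < m then xs i else 0) ∧ i < m then (xs i, u i) else (0, 0))

/-- The first `m` locations. -/
noncomputable def runPrefix (v : W) (u : ℕ → ℝ) : ℕ → ℕ → Pt d
  | 0 => fun _ => x₀
  | m + 1 => Function.update (runPrefix v u m) m (runStep S R X x₀ v u m (runPrefix v u m))

/-- The locations of the run with observed values `u` and exogenous randomness `v`. -/
noncomputable def runLoc (v : W) (u : ℕ → ℝ) (i : ℕ) : Pt d := runPrefix S R X x₀ v u (i + 1) i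

/-- The completed evaluations of the run with observed values `u`. -/
noncomputable def runSched (v : W) (u : ℕ → ℝ) (j : ℕ) : Finset ℕ :=
  S j v fun i => if i < j then runLoc S R X x₀ v u i else 0

variable {S R X x₀} {v : W} {u u' : ℕ → ℝ}

lemma projTo_of_mem {p : Pt d} (hp : p ∈ X) : projTo X x₀ p = p := if_pos hp

lemma projTo_mem (hx₀ : x₀ ∈ X) (p : Pt d) : projTo X x₀ p ∈ X := by
  unfold projTo; split_ifs <;> assumption

lemma measurable_projTo (hX : MeasurableSet X) : Measurable (projTo X x₀) :=
  Measurable.ite hX measurable_id measurable_const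

lemma runPrefix_eq {m i : ℕ} (h : i < m) :
    runPrefix S R X x₀ v u m i = runLoc S R X x₀ v u i := by
  induction m with
  | zero => omega
  | succ m ih =>
    rcases Nat.lt_succ_iff_lt_or_eq.mp h with h1 | rfl
    · rw [runPrefix, Function.update_of_ne h1.ne, ih h1]
    · rfl

lemma runLoc_eq (v : W) (u : ℕ → ℝ) (j : ℕ) :
    runLoc S R X x₀ v u j = projTo X x₀ (R j (runSched S R X x₀ v u j) v fun i =>
      if i ∈ runSched S R X x₀ v u j ∧ i < j then (runLoc S R X x₀ v u i, u i) else (0, 0)) := by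
  have h : (fun i => if i < j then runPrefix S R X x₀ v u j i else 0) =
      fun i => if i < j then runLoc S R X x₀ v u i else 0 := by
    funext i
    split_ifs with hi
    · exact runPrefix_eq hi
    · rfl
  rw [runLoc, runPrefix, Function.update_self, runStep, h, runSched]
  congr 2
  funext i
  split_ifs with hi
  · rw [runPrefix_eq hi.2]
  · rfl

lemma runLoc_mem (hx₀ : x₀ ∈ X) (v : W) (u : ℕ → ℝ) (j : ℕ) : runLoc S R X x₀ v u j ∈ X := by
  rw [runLoc_eq]; exact projTo_mem hx₀ _

lemma runSched_congr {j : ℕ} (h : ∀ i < j, runLoc S R X x₀ v u i = runLoc S R X x₀ v u' i) :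
    runSched S R X x₀ v u j = runSched S R X x₀ v u' j := by
  rw [runSched, runSched]
  congr 1
  funext i
  split_ifs with hi
  · exact h i hi
  · rfl

/-- The guard `i < m` in `runStep` makes this hold for arbitrary schedule functions, which may
return later indices away from actual runs. -/
lemma runLoc_congr (j : ℕ) (h : ∀ i < j, u i = u' i) :
    runLoc S R X x₀ v u j = runLoc S R X x₀ v u' j := by
  induction j using Nat.strong_induction_on with
  | _ j ih =>
    have h1 : ∀ i < j, runLoc S R X x₀ v u i = runLoc S R X x₀ v u' i := fun i hi =>
      ih i hi fun l hl => h l (hl.trans hi)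
    rw [runLoc_eq, runLoc_eq, runSched_congr h1]
    congr 2
    funext i
    split_ifs with hi
    · rw [h1 i hi.2, h i hi.2]
    · rfl

variable [MeasurableSpace W]

lemma measurable_if_mem (p : ℕ → Prop) [DecidablePred p] {α β : Type*} [MeasurableSpace α]
    [MeasurableSpace β] {F : ℕ → α → β} (hF : ∀ i, p i → Measurable (F i)) (c : β) :
    Measurable fun a i => if p i then F i a else c := by
  refine measurable_pi_iff.mpr fun i => ?_
  by_cases h : p i
  · simpa [h] using hF i h
  · simp [h]

lemma measurableSet_runSched
    (hS : ∀ j B, MeasurableSet {p : W × (ℕ → Pt d) | S j p.1 p.2 = B}) {j : ℕ}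
    (h : ∀ i < j, Measurable fun p : W × (ℕ → ℝ) => runLoc S R X x₀ p.1 p.2 i) (B : Finset ℕ) :
    MeasurableSet {p : W × (ℕ → ℝ) | runSched S R X x₀ p.1 p.2 j = B} := by
  have h1 : Measurable fun p : W × (ℕ → ℝ) =>
      (p.1, fun i => if i < j then runLoc S R X x₀ p.1 p.2 i else 0) :=
    measurable_fst.prodMk (measurable_if_mem (fun i => i < j) h 0)
  exact h1 (hS j B)

/-- The completed set takes countably many values; on each of them the location is a fixed
measurable function of earlier locations and values. -/
lemma measurable_runLoc (hX : MeasurableSet X)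
    (hS : ∀ j B, MeasurableSet {p : W × (ℕ → Pt d) | S j p.1 p.2 = B})
    (hR : ∀ j B, Measurable fun p : W × (ℕ → Pt d × ℝ) => R j B p.1 p.2) (j : ℕ) :
    Measurable fun p : W × (ℕ → ℝ) => runLoc S R X x₀ p.1 p.2 j := by
  induction j using Nat.strong_induction_on with
  | _ j ih =>
    simp only [runLoc_eq (S := S) (R := R) (X := X) (x₀ := x₀) _ _ j]
    refine measurable_of_countable_cases (c := fun p : W × (ℕ → ℝ) => runSched S R X x₀ p.1 p.2 j)
      (F := fun B p => projTo X x₀ (R j B p.1 fun i =>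
        if i ∈ B ∧ i < j then (runLoc S R X x₀ p.1 p.2 i, p.2 i) else (0, 0)))
      (fun B => measurableSet_runSched hS ih B) fun B => ?_
    have h1 : Measurable fun p : W × (ℕ → ℝ) => (p.1, fun i =>
        if i ∈ B ∧ i < j then (runLoc S R X x₀ p.1 p.2 i, p.2 i) else (0, 0)) :=
      measurable_fst.prodMk (measurable_if_mem (fun i => i ∈ B ∧ i < j)
        (fun i hi => (ih i hi.2).prodMk (by fun_prop)) (0, 0))
    exact (measurable_projTo hX).comp ((hR j B).comp h1)

end DeterministicRun

/-! ### Coupling with the run that observes only the values in `B` -/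

section Coupling

variable {d : ℕ} {Ω W : Type*} [MeasurableSpace Ω] [MeasurableSpace W] {P : Measure Ω}
  [IsProbabilityMeasure P] {X : Set (Pt d)} {k : Pt d → Pt d → ℝ} {η : ℝ} {f : Pt d → Ω → ℝ}
  {ε : ℕ → Ω → ℝ} {w : Ω → W} {q : ℕ → Pt d}
  {S : ℕ → W → (ℕ → Pt d) → Finset ℕ} {R : ℕ → Finset ℕ → W → (ℕ → Pt d × ℝ) → Pt d} {x₀ : Pt d}
  {A : ℕ → Ω → Finset ℕ} {x : ℕ → Ω → Pt d}

variable (S R X x₀) in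
/-- The locations of the run in which only the values in `B` are observed. -/
noncomputable def restrictedLoc {B : Finset ℕ} (p : W × (B → ℝ)) (i : ℕ) : Pt d :=
  runLoc S R X x₀ p.1 (extendZero p.2) i

lemma extendZero_congr_lt {B : Finset ℕ} {u u' : B → ℝ} {i : ℕ}
    (h : ∀ l : B, (l : ℕ) < i → u l = u' l) : ∀ l < i, extendZero u l = extendZero u' l := by
  intro l hl
  unfold extendZero
  split_ifs with hB
  · exact h ⟨l, hB⟩ hl
  · rfl

lemma restrictedLoc_adapted {B : Finset ℕ} (v : W) (i : B) (u u' : B → ℝ)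
    (h : ∀ l < i, u l = u' l) :
    restrictedLoc X S R x₀ (v, u) i = restrictedLoc X S R x₀ (v, u') i :=
  runLoc_congr _ (extendZero_congr_lt fun l hl => h l hl)

lemma adaptiveObs_apply {B : Finset ℕ} (ω : Ω) (i : B) :
    adaptiveObs q f ε w (restrictedLoc X S R x₀ (B := B)) ω i = ε i ω +
      evalAlong q (fun m => f (q m) ω)
        (restrictedLoc X S R x₀ (w ω, adaptiveObs q f ε w (restrictedLoc X S R x₀ (B := B)) ω) i) :=
  driftSolution_apply (fun i u u' h => by rw [restrictedLoc_adapted _ _ u u' h]) _ i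

/-- As long as the completed evaluations stay in `B`, the run agrees with the run in which only the
values in `B` are observed. -/
lemma restricted_run_eq
    (hS : ∀ j ω, A j ω = S j (w ω) (fun i => if i < j then x i ω else 0))
    (hR : ∀ j ω, x j ω = R j (A j ω) (w ω)
      (fun i => if i ∈ A j ω then (x i ω, value f ε x i ω) else (0, 0)))
    (hxX : ∀ j ω, x j ω ∈ X) (hsub : ∀ j ω, A j ω ⊆ Finset.range j) {ω : Ω}
    (hω : ∀ z ∈ X, evalAlong q (fun m => f (q m) ω) z = f z ω) {B : Finset ℕ} {j : ℕ}
    {u : B → ℝ} (hu : u = adaptiveObs q f ε w (restrictedLoc X S R x₀ (B := B)) ω)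
    (hB : ∀ i ≤ j, A i ω = runSched S R X x₀ (w ω) (extendZero u) i → A i ω ⊆ B) :
    ∀ i ≤ j, A i ω = runSched S R X x₀ (w ω) (extendZero u) i ∧
      x i ω = runLoc S R X x₀ (w ω) (extendZero u) i ∧
      (i ∈ B → extendZero u i = value f ε x i ω) := by
  intro i
  induction i using Nat.strong_induction_on with
  | _ i ih =>
    intro hij
    have hA : A i ω = runSched S R X x₀ (w ω) (extendZero u) i := by
      rw [hS, runSched]
      congr 1
      funext l
      split_ifs with hl
      · exact (ih l hl (hl.le.trans hij)).2.1
      · rfl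
    have hx : x i ω = runLoc S R X x₀ (w ω) (extendZero u) i := by
      rw [runLoc_eq, ← hA]
      -- Only values with index in `A i ω ⊆ B` are read, where the restricted run carries the true
      -- observations. The zeros standing for the other values never enter.
      have hdata : (fun l => if l ∈ A i ω ∧ l < i then
          (runLoc S R X x₀ (w ω) (extendZero u) l, extendZero u l) else (0, 0)) =
          fun l => if l ∈ A i ω then (x l ω, value f ε x l ω) else (0, 0) := by
        funext l
        by_cases hl : l ∈ A i ω
        · have hli := Finset.mem_range.mp (hsub i ω hl)
          have hlB := hB i hij hA hl
          have h1 := ih l hli (hli.le.trans hij)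
          rw [if_pos ⟨hl, hli⟩, if_pos hl, h1.2.1, h1.2.2 hlB]
        · rw [if_neg (fun h => hl h.1), if_neg hl]
      rw [hdata, ← hR, projTo_of_mem (hxX i ω)]
    refine ⟨hA, hx, fun hiB => ?_⟩
    have h1 := adaptiveObs_apply (q := q) (f := f) (ε := ε) (w := w) (S := S) (R := R) (X := X)
      (x₀ := x₀) ω ⟨i, hiB⟩
    rw [← hu] at h1
    rw [extendZero, dif_pos hiB, h1, restrictedLoc]
    simp only
    rw [← hx, hω _ (hxX i ω), value, add_comm]

end Coupling

/-- The case events of `c` need not be measurable themselves; almost surely they agree with the sets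
`E B`, on which the pieces are glued. -/
lemma ae_eq_sum_indicator {Ω ι M : Type*} [MeasurableSpace Ω] {P : Measure Ω} [AddCommMonoid M]
    {s : Finset ι} {c : Ω → ι} (hc : ∀ ω, c ω ∈ s) {E : ι → Set Ω} {T : Ω → M} {T' : ι → Ω → M}
    (h : ∀ᵐ ω ∂P, ∀ B ∈ s, (c ω = B ↔ ω ∈ E B) ∧ (c ω = B → T ω = T' B ω)) :
    T =ᵐ[P] fun ω => ∑ B ∈ s, (E B).indicator (T' B) ω := by
  filter_upwards [h] with ω hω
  rw [Finset.sum_eq_single (c ω), Set.indicator_of_mem, (hω _ (hc ω)).2 rfl]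
  · exact (hω _ (hc ω)).1.mp rfl
  · intro B hB hne
    exact Set.indicator_of_notMem (fun h' => hne ((hω B hB).1.mpr h').symm) _
  · exact fun h' => absurd (hc ω) h'

lemma aemeasurable_of_cases {Ω ι M : Type*} [MeasurableSpace Ω] {P : Measure Ω} [AddCommMonoid M]
    [MeasurableSpace M] [MeasurableAdd₂ M]
    {s : Finset ι} {c : Ω → ι} (hc : ∀ ω, c ω ∈ s) {E : ι → Set Ω} {T : Ω → M} {T' : ι → Ω → M}
    (h : ∀ᵐ ω ∂P, ∀ B ∈ s, (c ω = B ↔ ω ∈ E B) ∧ (c ω = B → T ω = T' B ω))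
    (hE : ∀ B, MeasurableSet (E B)) (hT' : ∀ B, Measurable (T' B)) : AEMeasurable T P :=
  (Finset.measurable_sum _ fun B _ => (hT' B).indicator (hE B)).aemeasurable.congr
    (ae_eq_sum_indicator hc h).symm

lemma lintegral_eq_sum_cases {Ω ι : Type*} [MeasurableSpace Ω] {P : Measure Ω}
    {s : Finset ι} {c : Ω → ι} (hc : ∀ ω, c ω ∈ s) {E : ι → Set Ω} {T : Ω → ENNReal}
    {T' : ι → Ω → ENNReal}
    (h : ∀ᵐ ω ∂P, ∀ B ∈ s, (c ω = B ↔ ω ∈ E B) ∧ (c ω = B → T ω = T' B ω))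
    (hE : ∀ B, MeasurableSet (E B)) (hT' : ∀ B, Measurable (T' B)) :
    ∫⁻ ω, T ω ∂P = ∑ B ∈ s, ∫⁻ ω, (E B).indicator (T' B) ω ∂P := by
  rw [lintegral_congr_ae (ae_eq_sum_indicator hc h),
    lintegral_finsetSum _ fun B _ => (hT' B).indicator (hE B)]

/-! ### Posterior law given the completed evaluations -/

section Coupling

variable {d : ℕ} {Ω W : Type*} [MeasurableSpace Ω] [MeasurableSpace W] {P : Measure Ω}
  [IsProbabilityMeasure P] {X : Set (Pt d)} {k : Pt d → Pt d → ℝ} {η : ℝ} {f : Pt d → Ω → ℝ}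
  {ε : ℕ → Ω → ℝ} {w : Ω → W} {q : ℕ → Pt d} {β : ℕ → ℝ} {m : ℕ}
  {S : ℕ → W → (ℕ → Pt d) → Finset ℕ} {R : ℕ → Finset ℕ → W → (ℕ → Pt d × ℝ) → Pt d} {x₀ : Pt d}
  {A : ℕ → Ω → Finset ℕ} {x : ℕ → Ω → Pt d} {j : ℕ} {B : Finset ℕ}
  {T : Finset ℕ → W → (ℕ → Pt d × ℝ) → Pt d} {Z : Ω → Pt d}

lemma IsAsyncUCB.completed_subset_of_le (hrun : IsAsyncUCB X k η β m f ε w A x) {i : ℕ}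
    (h : i ≤ j) (ω : Ω) : A i ω ⊆ A j ω := by
  induction j, h using Nat.le_induction with
  | base => exact subset_rfl
  | succ j _ ih => exact ih.trans (hrun.completed_mono j ω)

variable (X S R x₀) in
/-- The event that exactly the evaluations in `B` are completed at acquisition `j`, in terms of the
values in `B`. -/
def restrictedEvent (j : ℕ) (B : Finset ℕ) : Set (W × (B → ℝ)) :=
  {p | (∀ i ≤ j, runSched S R X x₀ p.1 (extendZero p.2) i ⊆ B) ∧
    runSched S R X x₀ p.1 (extendZero p.2) j = B}

variable (X S R x₀ T) in
/-- A point computed from the evaluations in `B`. -/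
noncomputable def restrictedPoint (B : Finset ℕ) (p : W × (B → ℝ)) : Pt d :=
  projTo X x₀ (T B p.1 fun i =>
    if i ∈ B then (restrictedLoc X S R x₀ p i, extendZero p.2 i) else (0, 0))

lemma measurable_prod_extendZero (B : Finset ℕ) :
    Measurable fun p : W × (B → ℝ) => (p.1, (extendZero p.2 : ℕ → ℝ)) :=
  measurable_fst.prodMk ((measurable_extendZero B).comp measurable_snd)

lemma measurable_restrictedLoc (hX : MeasurableSet X)
    (hS : ∀ j B, MeasurableSet {p : W × (ℕ → Pt d) | S j p.1 p.2 = B})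
    (hR : ∀ j B, Measurable fun p : W × (ℕ → Pt d × ℝ) => R j B p.1 p.2) (i : ℕ) :
    Measurable fun p : W × (B → ℝ) => restrictedLoc X S R x₀ p i := by
  have h := (measurable_runLoc (x₀ := x₀) hX hS hR i).comp (measurable_prod_extendZero B)
  exact h

lemma measurableSet_restrictedEvent (hX : MeasurableSet X)
    (hS : ∀ j B, MeasurableSet {p : W × (ℕ → Pt d) | S j p.1 p.2 = B})
    (hR : ∀ j B, Measurable fun p : W × (ℕ → Pt d × ℝ) => R j B p.1 p.2) :
    MeasurableSet (restrictedEvent X S R x₀ j B) := by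
  have h1 : ∀ i C, MeasurableSet {p : W × (B → ℝ) |
      runSched S R X x₀ p.1 (extendZero p.2) i = C} := fun i C => by
    have h2 := measurableSet_runSched (S := S) (R := R) (X := X) (x₀ := x₀) (j := i) hS
      (fun l _ => measurable_runLoc hX hS hR l) C
    exact measurable_prod_extendZero B h2
  have h3 : restrictedEvent X S R x₀ j B = (⋂ i, ⋂ (_ : i ≤ j), ⋃ C, ⋃ (_ : C ⊆ B),
      {p : W × (B → ℝ) | runSched S R X x₀ p.1 (extendZero p.2) i = C}) ∩
      {p | runSched S R X x₀ p.1 (extendZero p.2) j = B} := by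
    ext p
    simp [restrictedEvent]
  rw [h3]
  exact (MeasurableSet.iInter fun i => MeasurableSet.iInter fun _ => MeasurableSet.iUnion fun C =>
    MeasurableSet.iUnion fun _ => h1 i C).inter (h1 j B)

lemma measurable_restrictedPoint (hX : MeasurableSet X)
    (hS : ∀ j B, MeasurableSet {p : W × (ℕ → Pt d) | S j p.1 p.2 = B})
    (hR : ∀ j B, Measurable fun p : W × (ℕ → Pt d × ℝ) => R j B p.1 p.2)
    (hT : ∀ B, Measurable fun p : W × (ℕ → Pt d × ℝ) => T B p.1 p.2) :
    Measurable (restrictedPoint X S R x₀ T B) := by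
  have h1 : Measurable fun p : W × (B → ℝ) => (p.1, fun i =>
      if i ∈ B then (restrictedLoc X S R x₀ p i, extendZero p.2 i) else (0, 0)) :=
    measurable_fst.prodMk (measurable_if_mem (fun i => i ∈ B) (fun i _ =>
      (measurable_restrictedLoc hX hS hR i).prodMk
        ((measurable_pi_apply i).comp ((measurable_extendZero B).comp measurable_snd))) (0, 0))
  exact (measurable_projTo hX).comp ((hT B).comp h1)

lemma IsModel.measurable_adaptiveObs (hM : IsModel P X k η f ε w) (hq : IsDetermining P X f q)
    (hX : MeasurableSet X)
    (hS : ∀ j B, MeasurableSet {p : W × (ℕ → Pt d) | S j p.1 p.2 = B})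
    (hR : ∀ j B, Measurable fun p : W × (ℕ → Pt d × ℝ) => R j B p.1 p.2) :
    Measurable (adaptiveObs q f ε w (restrictedLoc X S R x₀ (B := B))) := by
  have h1 := measurable_driftSolution (S := W × (ℕ → ℝ)) (ι := B)
    (c := fun s i u => evalAlong q s.2 (restrictedLoc X S R x₀ (s.1, u) i)) fun i =>
    measurable_evalAlong_comp (by fun_prop) ((measurable_restrictedLoc hX hS hR i).comp
      (measurable_fst.fst.prodMk measurable_snd))
  have h2 : Measurable fun ω => (((w ω, fun m => f (q m) ω), fun i : B => ε i ω) :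
      (W × (ℕ → ℝ)) × (B → ℝ)) :=
    (hM.measurable_w.prodMk (hM.measurable_samples hq)).prodMk
      (measurable_pi_iff.mpr fun i => hM.measurable_noise i)
  have h3 := h1.comp h2
  exact h3

/-- The run and the run restricted to `B` agree when exactly the evaluations in `B` are
completed. -/
lemma IsAsyncUCB.restricted_eq (hM : IsModel P X k η f ε w) (hq : IsDetermining P X f q)
    (hrun : IsAsyncUCB X k η β m f ε w A x) (hx₀ : x₀ ∈ X)
    (hS : ∀ j ω, A j ω = S j (w ω) (fun i => if i < j then x i ω else 0))
    (hR : ∀ j ω, x j ω = R j (A j ω) (w ω)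
      (fun i => if i ∈ A j ω then (x i ω, value f ε x i ω) else (0, 0)))
    (hZ : ∀ ω, Z ω = T (A j ω) (w ω)
      (fun i => if i ∈ A j ω then (x i ω, value f ε x i ω) else (0, 0)))
    (hZX : ∀ ω, Z ω ∈ X) {ω : Ω}
    (hω : ∀ z ∈ X, evalAlong q (fun m => f (q m) ω) z = f z ω) (B : Finset ℕ) {u : B → ℝ}
    (hu : u = adaptiveObs q f ε w (restrictedLoc X S R x₀ (B := B)) ω) :
    (A j ω = B ↔ (w ω, u) ∈ restrictedEvent X S R x₀ j B) ∧
    (A j ω = B →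
      evalAlong q (fun m => f (q m) ω) (restrictedPoint X S R x₀ T B (w ω, u)) = f (Z ω) ω ∧
      postMean (evalCov P f q) η B (restrictedLoc X S R x₀ (w ω, u)) (extendZero u)
        (restrictedPoint X S R x₀ T B (w ω, u)) =
        postMean k η (A j ω) (fun i => x i ω) (fun i => value f ε x i ω) (Z ω) ∧
      postVar (evalCov P f q) η B (restrictedLoc X S R x₀ (w ω, u))
        (restrictedPoint X S R x₀ T B (w ω, u)) =
        postVar k η (A j ω) (fun i => x i ω) (Z ω)) := by
  have key := fun hB => restricted_run_eq hS hR hrun.mem hrun.completed_subset hω (B := B)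
    (j := j) hu hB
  -- Completed evaluations stay completed, so all earlier completed sets lie in the final one.
  have hAB : A j ω = B → ∀ i ≤ j, A i ω = runSched S R X x₀ (w ω) (extendZero u) i →
      A i ω ⊆ B := fun h i hi _ => h ▸ hrun.completed_subset_of_le hi ω
  refine ⟨⟨fun h => ?_, fun h => ?_⟩, fun h => ?_⟩
  · have h1 := key (hAB h)
    refine ⟨fun i hi => ?_, ?_⟩
    · rw [← (h1 i hi).1, ← h]
      exact hrun.completed_subset_of_le hi ω
    · rw [← (h1 j le_rfl).1, h]
  -- The inclusions recorded in the event drive the coupling induction without knowing beforehand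
  -- that `A j ω = B`.
  · have h1 := key fun i hi hA => hA ▸ h.1 i hi
    rw [(h1 j le_rfl).1]
    exact h.2
  · have h1 := key (hAB h)
    have hBj : ∀ i ∈ B, i ≤ j := fun i hi =>
      (Finset.mem_range.mp (hrun.completed_subset j ω (h ▸ hi))).le
    have hloc : ∀ i ∈ B, restrictedLoc X S R x₀ (w ω, u) i = x i ω := fun i hi =>
      (h1 i (hBj i hi)).2.1.symm
    have hval : ∀ i ∈ B, extendZero u i = value f ε x i ω := fun i hi =>
      (h1 i (hBj i hi)).2.2 hi
    have hpt : restrictedPoint X S R x₀ T B (w ω, u) = Z ω := by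
      have hdata : (fun i => if i ∈ B then (restrictedLoc X S R x₀ (w ω, u) i, extendZero u i)
          else (0, 0)) = fun i => if i ∈ A j ω then (x i ω, value f ε x i ω) else (0, 0) := by
        funext i
        rw [h]
        split_ifs with hi
        · rw [hloc i hi, hval i hi]
        · rfl
      rw [restrictedPoint]
      simp only
      rw [hdata, ← h, ← hZ, projTo_of_mem (hZX ω)]
    have hkk := hM.evalCov_eq hq
    have hlX : ∀ i, restrictedLoc X S R x₀ (w ω, u) i ∈ X := fun i => runLoc_mem hx₀ _ _ _
    rw [hpt, h]
    exact ⟨hω _ (hZX ω), AsyncBO.postMean_congr hkk hlX hloc hval (hZX ω),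
      postVar_congr hkk hlX hloc (hZX ω)⟩

/-- Given the completed evaluations, `f` at a point computed from them is Gaussian with the posterior
mean and variance. -/
theorem IsAsyncUCB.posterior_law (hM : IsModel P X k η f ε w) (hη : 0 < η)
    (hq : IsDetermining P X f q) (hX : MeasurableSet X)
    (hrun : IsAsyncUCB X k η β m f ε w A x)
    (hT : ∀ B, Measurable fun p : W × (ℕ → Pt d × ℝ) => T B p.1 p.2)
    (hZ : ∀ ω, Z ω = T (A j ω) (w ω)
      (fun i => if i ∈ A j ω then (x i ω, value f ε x i ω) else (0, 0)))
    (hZX : ∀ ω, Z ω ∈ X) :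
    AEMeasurable (fun ω => f (Z ω) ω) P ∧
    AEMeasurable (fun ω =>
      postMean k η (A j ω) (fun i => x i ω) (fun i => value f ε x i ω) (Z ω)) P ∧
    AEMeasurable (fun ω => postVar k η (A j ω) (fun i => x i ω) (Z ω)) P ∧
    ∀ g : ℝ × ℝ → ENNReal, Measurable g →
      ∫⁻ ω, g (f (Z ω) ω -
          postMean k η (A j ω) (fun i => x i ω) (fun i => value f ε x i ω) (Z ω),
          postVar k η (A j ω) (fun i => x i ω) (Z ω)) ∂P =
        ∫⁻ ω, ∫⁻ t, g (Real.sqrt (postVar k η (A j ω) (fun i => x i ω) (Z ω)) * t,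
          postVar k η (A j ω) (fun i => x i ω) (Z ω)) ∂(gaussianReal 0 1) ∂P := by
  classical
  have hne : Nonempty Ω := nonempty_of_isProbabilityMeasure P
  obtain ⟨ω₀⟩ := hne
  -- Any point of `X` serves as the default value of the reconstructed run.
  have hx₀ := hrun.mem 0 ω₀
  set x₀ := x 0 ω₀
  choose S hSm hS using hrun.schedule
  choose R hRm hR using hrun.nonanticipating
  have hU := fun B : Finset ℕ =>
    hM.measurable_adaptiveObs (B := B) (x₀ := x₀) hq hX hSm hRm
  set U := fun (B : Finset ℕ) ω => adaptiveObs q f ε w (restrictedLoc X S R x₀ (B := B)) ω with hUdef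
  have hwU : ∀ B : Finset ℕ, Measurable fun ω => (w ω, U B ω) := fun B =>
    hM.measurable_w.prodMk (hU B)
  have hEm := fun B : Finset ℕ =>
    measurableSet_restrictedEvent (x₀ := x₀) (j := j) (B := B) hX hSm hRm
  have hE : ∀ B, MeasurableSet {ω | (w ω, U B ω) ∈ restrictedEvent X S R x₀ j B} := fun B =>
    hwU B (hEm B)
  -- The completed set is one of finitely many subsets, so the law can be checked case by case.
  have hc : ∀ ω, A j ω ∈ (Finset.range j).powerset := fun ω =>
    Finset.mem_powerset.mpr (hrun.completed_subset j ω)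
  have hloc := fun (B : Finset ℕ) (i : ℕ) =>
    measurable_restrictedLoc (x₀ := x₀) (B := B) hX hSm hRm i
  have hpt := fun B : Finset ℕ =>
    measurable_restrictedPoint (x₀ := x₀) (T := T) (B := B) hX hSm hRm hT
  have hcase := fun (ω : Ω) (hω : ∀ z ∈ X, evalAlong q (fun m => f (q m) ω) z = f z ω)
      (B : Finset ℕ) => IsAsyncUCB.restricted_eq hM hq hrun hx₀ hS hR hZ hZX hω B (u := U B ω) rfl
  have hk := hM.measurable_evalCov hq
  have hext : ∀ (B : Finset ℕ) i, Measurable fun a : W × (B → ℝ) => extendZero a.2 i := fun B i =>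
    (measurable_pi_apply i).comp ((measurable_extendZero B).comp measurable_snd)
  have hfm : ∀ B : Finset ℕ, Measurable fun ω => evalAlong q (fun m => f (q m) ω)
      (restrictedPoint X S R x₀ T B (w ω, U B ω)) := fun B =>
    measurable_evalAlong_comp (hM.measurable_samples hq) ((hpt B).comp (hwU B))
  have hμm : ∀ B : Finset ℕ, Measurable fun ω => postMean (evalCov P f q) η B
      (restrictedLoc X S R x₀ (w ω, U B ω)) (extendZero (U B ω))
      (restrictedPoint X S R x₀ T B (w ω, U B ω)) := fun B =>
    (measurable_postMean hk (hloc B) (hext B) (hpt B)).comp (hwU B)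
  have hσm : ∀ B : Finset ℕ, Measurable fun ω => postVar (evalCov P f q) η B
      (restrictedLoc X S R x₀ (w ω, U B ω))
      (restrictedPoint X S R x₀ T B (w ω, U B ω)) := fun B =>
    (measurable_postVar hk (hloc B) (hpt B)).comp (hwU B)
  refine ⟨aemeasurable_of_cases hc ?_ hE hfm, aemeasurable_of_cases hc ?_ hE hμm,
    aemeasurable_of_cases hc ?_ hE hσm, fun g hg => ?_⟩
  · filter_upwards [hq.eval_eq] with ω hω B _
    exact ⟨(hcase ω hω B).1, fun h => ((hcase ω hω B).2 h).1.symm⟩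
  · filter_upwards [hq.eval_eq] with ω hω B _
    exact ⟨(hcase ω hω B).1, fun h => ((hcase ω hω B).2 h).2.1.symm⟩
  · filter_upwards [hq.eval_eq] with ω hω B _
    exact ⟨(hcase ω hω B).1, fun h => ((hcase ω hω B).2 h).2.2.symm⟩
  have hg' : Measurable fun s : ℝ => ∫⁻ t, g (Real.sqrt s * t, s) ∂(gaussianReal 0 1) := by
    refine Measurable.lintegral_prod_right' (f := fun r : ℝ × ℝ =>
      g (Real.sqrt r.1 * r.2, r.1)) (hg.comp (by fun_prop))
  rw [lintegral_eq_sum_cases hc (E := fun B => {ω | (w ω, U B ω) ∈ restrictedEvent X S R x₀ j B})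
      (T' := fun B ω => g (evalAlong q (fun m => f (q m) ω)
        (restrictedPoint X S R x₀ T B (w ω, U B ω)) - postMean (evalCov P f q) η B
        (restrictedLoc X S R x₀ (w ω, U B ω)) (extendZero (U B ω))
        (restrictedPoint X S R x₀ T B (w ω, U B ω)), postVar (evalCov P f q) η B
        (restrictedLoc X S R x₀ (w ω, U B ω)) (restrictedPoint X S R x₀ T B (w ω, U B ω))))
      ?_ hE fun B => hg.comp (((hfm B).sub (hμm B)).prodMk (hσm B)),
    lintegral_eq_sum_cases hc (E := fun B => {ω | (w ω, U B ω) ∈ restrictedEvent X S R x₀ j B})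
      (T' := fun B ω => ∫⁻ t, g (Real.sqrt (postVar (evalCov P f q) η B
        (restrictedLoc X S R x₀ (w ω, U B ω)) (restrictedPoint X S R x₀ T B (w ω, U B ω))) * t,
        postVar (evalCov P f q) η B (restrictedLoc X S R x₀ (w ω, U B ω))
        (restrictedPoint X S R x₀ T B (w ω, U B ω))) ∂(gaussianReal 0 1))
      ?_ hE fun B => hg'.comp (hσm B)]
  · refine Finset.sum_congr rfl fun B _ => ?_
    -- The event of exactly `B` being completed is a function of `w` and the values in `B`, so its
    -- indicator may serve as the weight `e`.
    have h := hM.lintegral_adaptive_posterior hη hq (hloc B) (fun a i => runLoc_mem hx₀ _ _ _)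
      (fun v i u u' h => restrictedLoc_adapted v i u u' h) (hpt B)
      (fun a => projTo_mem hx₀ _) (e := (restrictedEvent X S R x₀ j B).indicator 1)
      (measurable_one.indicator (hEm B)) hg
    refine Eq.trans (lintegral_congr fun ω => ?_) (h.trans (lintegral_congr fun ω => ?_))
    · by_cases hω : (w ω, U B ω) ∈ restrictedEvent X S R x₀ j B
      · rw [Set.indicator_of_mem (by exact hω), Set.indicator_of_mem (by exact hω), Pi.one_apply,
          one_mul]
      · rw [Set.indicator_of_notMem (by exact hω), Set.indicator_of_notMem (by exact hω), zero_mul]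
    · by_cases hω : (w ω, U B ω) ∈ restrictedEvent X S R x₀ j B
      · rw [Set.indicator_of_mem (by exact hω), Set.indicator_of_mem (by exact hω), Pi.one_apply,
          one_mul]
      · rw [Set.indicator_of_notMem (by exact hω), Set.indicator_of_notMem (by exact hω), zero_mul]
  · filter_upwards [hq.eval_eq] with ω hω B _
    refine ⟨(hcase ω hω B).1, fun h => ?_⟩
    obtain ⟨h1, h2, h3⟩ := (hcase ω hω B).2 h
    rw [h3]
  · filter_upwards [hq.eval_eq] with ω hω B _
    refine ⟨(hcase ω hω B).1, fun h => ?_⟩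
    obtain ⟨h1, h2, h3⟩ := (hcase ω hω B).2 h
    rw [h1, h2, h3]

end Coupling

/-! ### Prediction errors -/

/-- From `y ≤ exp (y - 1)` with `y = τ * (t - τ)`, the excess is dominated by an exponential, whose
Gaussian mean is the moment generating function at `τ`. The factor `1 / e` saved here is needed for
the constant of the theorem. -/
lemma lintegral_gaussian_excess {τ : ℝ} (hτ : 0 < τ) :
    ∫⁻ t, ENNReal.ofReal (t - τ) ∂(gaussianReal 0 1) ≤
      ENNReal.ofReal (Real.exp (-τ ^ 2 / 2) / (Real.exp 1 * τ)) := by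
  have h1 : ∀ t : ℝ, t - τ ≤ Real.exp (-τ ^ 2 - 1) / τ * Real.exp (τ * t) := by
    intro t
    have h := Real.add_one_le_exp (τ * (t - τ) - 1)
    rw [div_mul_eq_mul_div, ← Real.exp_add, le_div_iff₀ hτ]
    calc (t - τ) * τ = τ * (t - τ) - 1 + 1 := by ring
      _ ≤ _ := h
      _ = _ := by congr 1; ring
  have hi : Integrable (fun t => Real.exp (-τ ^ 2 - 1) / τ * Real.exp (τ * t))
      (gaussianReal 0 1) := (integrable_exp_mul_gaussianReal τ).const_mul _
  have hm : ∫ t, Real.exp (τ * t) ∂(gaussianReal 0 1) = Real.exp (τ ^ 2 / 2) := by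
    have h := mgf_gaussianReal (p := gaussianReal 0 1) (X := id) (μ := 0) (v := 1)
      (by simp) τ
    rw [mgf] at h
    simpa using h
  refine (lintegral_mono fun t => ENNReal.ofReal_le_ofReal (h1 t)).trans_eq ?_
  rw [← ofReal_integral_eq_lintegral_ofReal hi (Eventually.of_forall fun t => by positivity),
    integral_const_mul, hm, div_mul_eq_mul_div, ← Real.exp_add]
  congr 1
  rw [← div_div, ← Real.exp_sub]
  congr 2
  ring

/-- Conditionally on `s`, the variable `D` is centred Gaussian with variance `s`. -/
structure IsGaussianMixture {Ω : Type*} [MeasurableSpace Ω] (P : Measure Ω) (D s : Ω → ℝ) :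
    Prop where
  aemeasurable_error : AEMeasurable D P
  aemeasurable_var : AEMeasurable s P
  var_nonneg : ∀ ω, 0 ≤ s ω
  var_le_one : ∀ ω, s ω ≤ 1
  law : ∀ g : ℝ × ℝ → ENNReal, Measurable g →
    ∫⁻ ω, g (D ω, s ω) ∂P = ∫⁻ ω, ∫⁻ t, g (Real.sqrt (s ω) * t, s ω) ∂(gaussianReal 0 1) ∂P

namespace IsGaussianMixture

variable {Ω : Type*} [MeasurableSpace Ω] {P : Measure Ω} [IsProbabilityMeasure P] {D s : Ω → ℝ}

lemma sqrt_le_one (h : IsGaussianMixture P D s) (ω : Ω) : Real.sqrt (s ω) ≤ 1 :=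
  Real.sqrt_le_one.mpr (h.var_le_one ω)

lemma integrable (h : IsGaussianMixture P D s) : Integrable D P := by
  refine ⟨h.aemeasurable_error.aestronglyMeasurable, ?_⟩
  have h1 := h.law (fun p => ENNReal.ofReal |p.1|) (by fun_prop)
  have h2 : Integrable (fun t : ℝ => t) (gaussianReal 0 1) :=
    (memLp_id_gaussianReal 1).integrable le_rfl
  have h3 := (hasFiniteIntegral_iff_norm _).mp h2.2
  rw [hasFiniteIntegral_iff_norm]
  simp only [Real.norm_eq_abs] at h3 ⊢
  refine lt_of_le_of_lt ?_ h3
  rw [h1]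
  have h4 : ∀ ω, ∫⁻ t, ENNReal.ofReal |Real.sqrt (s ω) * t| ∂(gaussianReal 0 1) ≤
      ∫⁻ t, ENNReal.ofReal |t| ∂(gaussianReal 0 1) := by
    refine fun ω => lintegral_mono fun t => ENNReal.ofReal_le_ofReal ?_
    rw [abs_mul, abs_of_nonneg (Real.sqrt_nonneg _)]
    exact mul_le_of_le_one_left (abs_nonneg _) (h.sqrt_le_one ω)
  exact (lintegral_mono h4).trans_eq (by simp)

lemma integral_eq_zero (h : IsGaussianMixture P D s) : ∫ ω, D ω ∂P = 0 := by
  rw [integral_eq_lintegral_pos_part_sub_lintegral_neg_part h.integrable,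
    h.law (fun p => ENNReal.ofReal p.1) (by fun_prop),
    h.law (fun p => ENNReal.ofReal (-p.1)) (by fun_prop), sub_eq_zero]
  congr 1
  refine lintegral_congr fun ω => ?_
  have h1 : (gaussianReal 0 1).map (fun t : ℝ => -t) = gaussianReal 0 1 := by
    rw [gaussianReal_map_neg, neg_zero]
  conv_lhs => rw [← h1]
  rw [lintegral_map (by fun_prop) (by fun_prop)]
  simp

/-- Conditionally the excess is `√s * (t - √b)` with `√s ≤ 1`, hence at most the standard Gaussian
excess over `√b`. -/
lemma lintegral_excess_le (h : IsGaussianMixture P D s) {b : ℝ} (hb : 0 < b) :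
    ∫⁻ ω, ENNReal.ofReal (D ω - Real.sqrt b * Real.sqrt (s ω)) ∂P ≤
      ENNReal.ofReal (Real.exp (-b / 2) / (Real.exp 1 * Real.sqrt b)) := by
  rw [h.law (fun p => ENNReal.ofReal (p.1 - Real.sqrt b * Real.sqrt p.2)) (by fun_prop)]
  have h1 : ∀ ω, ∫⁻ t, ENNReal.ofReal (Real.sqrt (s ω) * t - Real.sqrt b * Real.sqrt (s ω))
      ∂(gaussianReal 0 1) ≤
      ENNReal.ofReal (Real.exp (-b / 2) / (Real.exp 1 * Real.sqrt b)) := by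
    intro ω
    have h2 := lintegral_gaussian_excess (Real.sqrt_pos.mpr hb)
    rw [Real.sq_sqrt hb.le] at h2
    refine le_trans (lintegral_mono fun t => ?_) h2
    rw [show Real.sqrt (s ω) * t - Real.sqrt b * Real.sqrt (s ω) =
      Real.sqrt (s ω) * (t - Real.sqrt b) by ring, ENNReal.ofReal_mul (Real.sqrt_nonneg _)]
    exact mul_le_of_le_one_left' (ENNReal.ofReal_le_one.mpr (h.sqrt_le_one ω))
  exact (lintegral_mono h1).trans_eq (by simp)

lemma integrable_excess (h : IsGaussianMixture P D s) (b : ℝ) :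
    Integrable (fun ω => max (D ω - Real.sqrt b * Real.sqrt (s ω)) 0) P := by
  have hs : Integrable (fun ω => Real.sqrt b * Real.sqrt (s ω)) P := by
    refine Integrable.of_bound (h.aemeasurable_var.sqrt.const_mul _).aestronglyMeasurable
      (Real.sqrt b) (Eventually.of_forall fun ω => ?_)
    rw [Real.norm_eq_abs, abs_of_nonneg (by positivity)]
    exact mul_le_of_le_one_right (Real.sqrt_nonneg _) (h.sqrt_le_one ω)
  exact (h.integrable.sub hs).pos_part

lemma integral_excess_le (h : IsGaussianMixture P D s) {b : ℝ} (hb : 0 < b) :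
    ∫ ω, max (D ω - Real.sqrt b * Real.sqrt (s ω)) 0 ∂P ≤
      Real.exp (-b / 2) / (Real.exp 1 * Real.sqrt b) := by
  have h0 : 0 ≤ᵐ[P] fun ω => max (D ω - Real.sqrt b * Real.sqrt (s ω)) 0 :=
    Eventually.of_forall fun _ => le_max_right _ _
  rw [integral_eq_lintegral_of_nonneg_ae h0
    (h.integrable_excess b).aestronglyMeasurable]
  refine ENNReal.toReal_le_of_le_ofReal (by positivity) (le_trans (lintegral_mono fun ω => ?_)
    (h.lintegral_excess_le hb))
  rw [ENNReal.ofReal_max, ENNReal.ofReal_zero, max_eq_left (zero_le)]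

end IsGaussianMixture

/-! ### Discretization of the search space -/

/-- Each cell of side `1 / N` that meets `X` contributes one representative taken from `X`, since
the query is maximal only against points of `X`. -/
lemma exists_grid {d : ℕ} {X : Set (Pt d)} (hcube : ∀ z ∈ X, ∀ i, z i ∈ Set.Icc (0 : ℝ) 1) {N : ℕ}
    (hN : 1 ≤ N) : ∃ G : Finset (Pt d), (∀ g ∈ G, g ∈ X) ∧ G.card ≤ N ^ d ∧
      ∀ z ∈ X, ∃ g ∈ G, ∀ i, |z i - g i| ≤ 1 / (N : ℝ) := by
  classical
  have hN0 : (0 : ℝ) < N := by exact_mod_cast hN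
  -- The minimum puts the coordinate value `1` into the last cell.
  let cell : Pt d → Fin d → Fin N := fun z i => ⟨min ⌊N * z i⌋₊ (N - 1), by omega⟩
  have hcell : ∀ z ∈ X, ∀ i, ((cell z i : ℕ) : ℝ) ≤ N * z i ∧ N * z i ≤ (cell z i : ℕ) + 1 := by
    intro z hz i
    obtain ⟨h0, h1⟩ := hcube z hz i
    have hnn : 0 ≤ N * z i := by positivity
    have hle : N * z i ≤ N := by nlinarith
    simp only [cell]
    rcases le_total ⌊N * z i⌋₊ (N - 1) with h | h
    · rw [min_eq_left h]
      exact ⟨Nat.floor_le hnn, (Nat.lt_floor_add_one _).le⟩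
    · rw [min_eq_right h]
      refine ⟨(Nat.cast_le.mpr h).trans (Nat.floor_le hnn), hle.trans ?_⟩
      rw [Nat.cast_sub hN]
      simp
  let C := Finset.univ.filter fun c : Fin d → Fin N => ∃ z ∈ X, cell z = c
  have hrep : ∀ c : C, ∃ z ∈ X, cell z = c := fun c => (Finset.mem_filter.mp c.2).2
  choose rep hrepX hrepc using hrep
  refine ⟨Finset.univ.image rep, ?_, ?_, fun z hz => ?_⟩
  · intro g hg
    obtain ⟨c, -, rfl⟩ := Finset.mem_image.mp hg
    exact hrepX c
  · refine Finset.card_image_le.trans ?_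
    rw [Finset.card_univ, Fintype.card_coe]
    refine (Finset.card_filter_le _ _).trans ?_
    simp
  · have hc : cell z ∈ C := Finset.mem_filter.mpr ⟨Finset.mem_univ _, z, hz, rfl⟩
    refine ⟨rep ⟨cell z, hc⟩, Finset.mem_image_of_mem _ (Finset.mem_univ _), fun i => ?_⟩
    obtain ⟨h1, h2⟩ := hcell z hz i
    obtain ⟨h3, h4⟩ := hcell _ (hrepX ⟨cell z, hc⟩) i
    rw [hrepc] at h3 h4
    simp only at h3 h4
    rw [le_div_iff₀ hN0, ← abs_of_pos hN0, ← abs_mul, abs_le]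
    constructor <;> linarith

/-! ### The supremum of the path -/

/-- Almost every path is Lipschitz on `X` for the supremum distance, with the constant `L`. -/
structure IsPathModulus {d : ℕ} {Ω : Type*} [MeasurableSpace Ω] (P : Measure Ω) (X : Set (Pt d))
    (f : Pt d → Ω → ℝ) (L : Ω → ℝ) : Prop where
  measurable : Measurable L
  nonneg : ∀ ω, 0 ≤ L ω
  integrable : Integrable L P
  abs_sub_le : ∀ᵐ ω ∂P, ∀ z ∈ X, ∀ z' ∈ X, ∀ δ, (∀ i, |z i - z' i| ≤ δ) →
    |f z ω - f z' ω| ≤ L ω * δ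

section Path

variable {d : ℕ} {Ω W : Type*} [MeasurableSpace Ω] [MeasurableSpace W] {P : Measure Ω}
  [IsProbabilityMeasure P] {X : Set (Pt d)} {k : Pt d → Pt d → ℝ} {η : ℝ} {f : Pt d → Ω → ℝ}
  {ε : ℕ → Ω → ℝ} {w : Ω → W} {q : ℕ → Pt d} {L : Ω → ℝ}

lemma abs_coord_sub_le (z z' : Pt d) (i : Fin d) : |z i - z' i| ≤ dist z z' := by
  rw [dist_eq_norm]
  exact PiLp.norm_apply_le (z - z') i

lemma abs_coord_sub_le_one (hcube : ∀ z ∈ X, ∀ i, z i ∈ Set.Icc (0 : ℝ) 1) {z z' : Pt d}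
    (hz : z ∈ X) (hz' : z' ∈ X) (i : Fin d) : |z i - z' i| ≤ 1 := by
  obtain ⟨h1, h2⟩ := hcube z hz i
  obtain ⟨h3, h4⟩ := hcube z' hz' i
  rw [abs_le]
  constructor <;> linarith

lemma IsPathModulus.isDetermining (hL : IsPathModulus P X f L) (hq : ∀ m, q m ∈ X)
    (hdense : X ⊆ closure (Set.range q)) : IsDetermining P X f q where
  mem := hq
  eval_eq := by
    filter_upwards [hL.abs_sub_le] with ω hω z hz
    refine evalAlong_eq (g := fun z => f z ω) hq hdense hz ?_
    have hlip : LipschitzOnWith ⟨L ω, hL.nonneg ω⟩ (fun z => f z ω) X :=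
      LipschitzOnWith.of_dist_le_mul fun z hz z' hz' =>
        hω z hz z' hz' _ (abs_coord_sub_le z z')
    exact hlip.continuousOn z hz

lemma IsPathModulus.ae_abs_sub_le (hL : IsPathModulus P X f L)
    (hcube : ∀ z ∈ X, ∀ i, z i ∈ Set.Icc (0 : ℝ) 1) :
    ∀ᵐ ω ∂P, ∀ z ∈ X, ∀ z' ∈ X, |f z ω - f z' ω| ≤ L ω := by
  filter_upwards [hL.abs_sub_le] with ω hω z hz z' hz'
  simpa using hω z hz z' hz' 1 (abs_coord_sub_le_one hcube hz hz')

lemma IsPathModulus.ae_bddAbove (hL : IsPathModulus P X f L)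
    (hcube : ∀ z ∈ X, ∀ i, z i ∈ Set.Icc (0 : ℝ) 1) :
    ∀ᵐ ω ∂P, BddAbove (Set.range fun z : X => f z ω) := by
  filter_upwards [hL.ae_abs_sub_le hcube] with ω hω
  rcases isEmpty_or_nonempty X with hX | ⟨⟨z₀⟩⟩
  · simp
  · refine ⟨f z₀ ω + L ω, ?_⟩
    rintro _ ⟨z, rfl⟩
    have := abs_le.mp (hω z z.2 z₀ z₀.2)
    simp only
    linarith [this.2]

/-- Replacing the uncountable supremum by a countable one is what makes the maximum of the path
measurable up to null sets. -/
lemma iSup_seq_eq_iSup {g : Pt d → ℝ} {c : ℝ} (hc : 0 ≤ c)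
    (hg : ∀ z ∈ X, ∀ z' ∈ X, |g z - g z'| ≤ c * dist z z') (hq : ∀ m, q m ∈ X)
    (hdense : X ⊆ closure (Set.range q)) (hb : BddAbove (Set.range fun z : X => g z)) :
    ⨆ m, g (q m) = ⨆ z : X, g z := by
  have hne : Nonempty X := ⟨⟨q 0, hq 0⟩⟩
  obtain ⟨M, hM⟩ := hb
  have hMX : ∀ z ∈ X, g z ≤ M := fun z hz => hM ⟨⟨z, hz⟩, rfl⟩
  have hle : ∀ z ∈ X, g z ≤ ⨆ z : X, g z := fun z hz =>
    le_ciSup (f := fun z : X => g z) ⟨M, hM⟩ ⟨z, hz⟩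
  have hb' : BddAbove (Set.range fun m => g (q m)) := by
    refine ⟨M, ?_⟩
    rintro _ ⟨m, rfl⟩
    exact hMX _ (hq m)
  have hle' : ∀ m, g (q m) ≤ ⨆ m, g (q m) := fun m => le_ciSup hb' m
  refine le_antisymm (ciSup_le fun m => hle _ (hq m)) (ciSup_le fun z => ?_)
  refine le_of_forall_pos_le_add fun r hr => ?_
  have hc1 : 0 < c + 1 := by linarith
  have hr' : 0 < r / (c + 1) := div_pos hr hc1
  obtain ⟨_, ⟨m, rfl⟩, hm⟩ := Metric.mem_closure_iff.mp (hdense z.2) _ hr'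
  have h1 := (abs_le.mp (hg z z.2 (q m) (hq m))).2
  have h2 : c * dist (z : Pt d) (q m) ≤ c * (r / (c + 1)) := by gcongr
  have h3 : c * (r / (c + 1)) ≤ r := by
    rw [mul_div_assoc', div_le_iff₀ hc1]
    nlinarith
  linarith [hle' m]

lemma IsPathModulus.aemeasurable_iSup (hM : IsModel P X k η f ε w) (hL : IsPathModulus P X f L)
    (hcube : ∀ z ∈ X, ∀ i, z i ∈ Set.Icc (0 : ℝ) 1) (hq : ∀ m, q m ∈ X)
    (hdense : X ⊆ closure (Set.range q)) : AEMeasurable (fun ω => ⨆ z : X, f z ω) P := by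
  have hm : Measurable fun ω => ⨆ m, f (q m) ω := Measurable.iSup fun m => hM.measurable_f _ (hq m)
  refine hm.aemeasurable.congr ?_
  filter_upwards [hL.abs_sub_le, hL.ae_bddAbove hcube] with ω hω hb
  exact iSup_seq_eq_iSup (g := fun z => f z ω) (hL.nonneg ω)
    (fun z hz z' hz' => hω z hz z' hz' _ (abs_coord_sub_le z z')) hq hdense hb

lemma IsModel.integrable_f (hM : IsModel P X k η f ε w) {z : Pt d} (hz : z ∈ X) :
    Integrable (f z) P := (hM.memLp_f hz).integrable one_le_two

/-- A variable between values of the path is integrable. -/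
lemma IsPathModulus.integrable_of_between (hM : IsModel P X k η f ε w)
    (hL : IsPathModulus P X f L) {z₀ : Pt d} (hz₀ : z₀ ∈ X) {Y : Ω → ℝ} (hY : AEMeasurable Y P)
    (h : ∀ᵐ ω ∂P, |Y ω - f z₀ ω| ≤ L ω) : Integrable Y P := by
  refine Integrable.mono' (hL.integrable.add (hM.integrable_f hz₀).abs) hY.aestronglyMeasurable ?_
  filter_upwards [h] with ω hω
  rw [Real.norm_eq_abs, Pi.add_apply]
  have := abs_add_le (Y ω - f z₀ ω) (f z₀ ω)
  rw [sub_add_cancel] at this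
  linarith

end Path

/-! ### The expected regret of one query -/

section Regret

variable {d : ℕ} {Ω W : Type*} [MeasurableSpace Ω] [MeasurableSpace W] {P : Measure Ω}
  [IsProbabilityMeasure P] {X : Set (Pt d)} {k : Pt d → Pt d → ℝ} {η : ℝ} {f : Pt d → Ω → ℝ}
  {ε : ℕ → Ω → ℝ} {w : Ω → W} {β : ℕ → ℝ} {m : ℕ} {L : Ω → ℝ}
  {A : ℕ → Ω → Finset ℕ} {x : ℕ → Ω → Pt d}

/-- The prediction error at `z` given the evaluations completed at acquisition `j`. -/
noncomputable def runError (k : Pt d → Pt d → ℝ) (η : ℝ) (f : Pt d → Ω → ℝ) (ε : ℕ → Ω → ℝ)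
    (A : ℕ → Ω → Finset ℕ) (x : ℕ → Ω → Pt d) (j : ℕ) (z : Pt d) (ω : Ω) : ℝ :=
  f z ω - postMean k η (A j ω) (fun i => x i ω) (fun i => value f ε x i ω) z

/-- The posterior variance at `z` given the evaluations completed at acquisition `j`. -/
noncomputable def runVar (k : Pt d → Pt d → ℝ) (η : ℝ)
    (A : ℕ → Ω → Finset ℕ) (x : ℕ → Ω → Pt d) (j : ℕ) (z : Pt d) (ω : Ω) : ℝ :=
  postVar k η (A j ω) (fun i => x i ω) z

/-- The exploration bonus of acquisition `j`. -/
noncomputable def bonus (k : Pt d → Pt d → ℝ) (η : ℝ) (β : ℕ → ℝ)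
    (A : ℕ → Ω → Finset ℕ) (x : ℕ → Ω → Pt d) (j : ℕ) (ω : Ω) : ℝ :=
  Real.sqrt (β (j + 1)) * Real.sqrt (runVar k η A x j (x j ω) ω)

/-- The expected difference between the maximum and the value at acquisition `j`. -/
noncomputable def expectedGap (P : Measure Ω) (X : Set (Pt d)) (f : Pt d → Ω → ℝ)
    (x : ℕ → Ω → Pt d) (j : ℕ) : ℝ :=
  ∫ ω, ((⨆ z : X, f z ω) - f (x j ω) ω) ∂P

lemma IsModel.exists_isDetermining (hL : IsPathModulus P X f L) (hX : X.Nonempty) :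
    ∃ q, (∀ m, q m ∈ X) ∧ X ⊆ closure (Set.range q) ∧ IsDetermining P X f q := by
  obtain ⟨q, hq, hdense⟩ := exists_dense_sequence hX
  exact ⟨q, hq, hdense, hL.isDetermining hq hdense⟩

lemma IsAsyncUCB.nonempty (P : Measure Ω) [IsProbabilityMeasure P]
    (hrun : IsAsyncUCB X k η β m f ε w A x) : X.Nonempty := by
  obtain ⟨ω⟩ := nonempty_of_isProbabilityMeasure P
  exact ⟨_, hrun.mem 0 ω⟩

/-- The query is itself computed from the completed data and the exogenous randomness, so the
posterior law holds at this random point. -/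
lemma IsAsyncUCB.isGaussianMixture_query (hM : IsModel P X k η f ε w) (hη : 0 < η)
    (hX : IsCompact X) (hk : ∀ z ∈ X, k z z ≤ 1) (hL : IsPathModulus P X f L)
    (hrun : IsAsyncUCB X k η β m f ε w A x) (j : ℕ) :
    AEMeasurable (fun ω => f (x j ω) ω) P ∧
    IsGaussianMixture P (fun ω => runError k η f ε A x j (x j ω) ω)
      (fun ω => runVar k η A x j (x j ω) ω) := by
  obtain ⟨q, -, -, hq⟩ := IsModel.exists_isDetermining hL (hrun.nonempty P)
  obtain ⟨R, hRm, hR⟩ := hrun.nonanticipating j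
  obtain ⟨h1, h2, h3, h4⟩ := hrun.posterior_law (j := j) (T := R) (Z := x j) hM hη hq
    hX.measurableSet hRm hR (hrun.mem j)
  exact ⟨h1, h1.sub h2, h3,
    fun ω => hM.isFeature.postVar_nonneg hη (fun i => hrun.mem i ω) (hrun.mem j ω),
    fun ω => (hM.isFeature.postVar_le_prior hη (fun i => hrun.mem i ω) (hrun.mem j ω)).trans
      (hk _ (hrun.mem j ω)), h4⟩

lemma IsAsyncUCB.isGaussianMixture_point (hM : IsModel P X k η f ε w) (hη : 0 < η)
    (hX : IsCompact X) (hk : ∀ z ∈ X, k z z ≤ 1) (hL : IsPathModulus P X f L)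
    (hrun : IsAsyncUCB X k η β m f ε w A x) (j : ℕ) {z : Pt d} (hz : z ∈ X) :
    IsGaussianMixture P (runError k η f ε A x j z) (runVar k η A x j z) := by
  obtain ⟨q, -, -, hq⟩ := IsModel.exists_isDetermining hL (hrun.nonempty P)
  obtain ⟨h1, h2, h3, h4⟩ := hrun.posterior_law (j := j) (T := fun _ _ _ => z) (Z := fun _ => z)
    hM hη hq hX.measurableSet (fun _ => measurable_const) (fun _ => rfl) (fun _ => hz)
  exact ⟨h1.sub h2, h3, fun ω => hM.isFeature.postVar_nonneg hη (fun i => hrun.mem i ω) hz,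
    fun ω => (hM.isFeature.postVar_le_prior hη (fun i => hrun.mem i ω) hz).trans (hk _ hz), h4⟩

lemma IsAsyncUCB.integrable_query (hM : IsModel P X k η f ε w) (hη : 0 < η)
    (hX : IsCompact X) (hcube : ∀ z ∈ X, ∀ i, z i ∈ Set.Icc (0 : ℝ) 1)
    (hk : ∀ z ∈ X, k z z ≤ 1) (hL : IsPathModulus P X f L)
    (hrun : IsAsyncUCB X k η β m f ε w A x) (j : ℕ) :
    Integrable (fun ω => f (x j ω) ω) P := by
  obtain ⟨z₀, hz₀⟩ := hrun.nonempty P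
  refine hL.integrable_of_between hM hz₀ (hrun.isGaussianMixture_query hM hη hX hk hL j).1 ?_
  filter_upwards [hL.ae_abs_sub_le hcube] with ω hω
  exact hω _ (hrun.mem j ω) _ hz₀

lemma IsPathModulus.integrable_iSup (hM : IsModel P X k η f ε w) (hne : X.Nonempty)
    (hcube : ∀ z ∈ X, ∀ i, z i ∈ Set.Icc (0 : ℝ) 1) (hL : IsPathModulus P X f L) :
    Integrable (fun ω => ⨆ z : X, f z ω) P := by
  obtain ⟨q, hqX, hdense, -⟩ := IsModel.exists_isDetermining hL hne
  obtain ⟨z₀, hz₀⟩ := hne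
  refine hL.integrable_of_between hM hz₀ (hL.aemeasurable_iSup hM hcube hqX hdense) ?_
  filter_upwards [hL.ae_abs_sub_le hcube, hL.ae_bddAbove hcube] with ω hω hb
  have : Nonempty X := ⟨⟨z₀, hz₀⟩⟩
  have h1 : f z₀ ω ≤ ⨆ z : X, f z ω := le_ciSup (f := fun z : X => f z ω) hb ⟨z₀, hz₀⟩
  have h2 : ⨆ z : X, f z ω ≤ f z₀ ω + L ω := ciSup_le fun z => by
    linarith [(abs_le.mp (hω z z.2 z₀ hz₀)).2]
  rw [abs_of_nonneg (by linarith)]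
  linarith

lemma IsAsyncUCB.integrable_bonus (hM : IsModel P X k η f ε w) (hη : 0 < η)
    (hX : IsCompact X) (hk : ∀ z ∈ X, k z z ≤ 1) (hL : IsPathModulus P X f L)
    (hrun : IsAsyncUCB X k η β m f ε w A x) (j : ℕ) : Integrable (bonus k η β A x j) P := by
  have h := (hrun.isGaussianMixture_query hM hη hX hk hL j).2
  refine Integrable.of_bound (h.aemeasurable_var.sqrt.const_mul _).aestronglyMeasurable
    (Real.sqrt (β (j + 1))) (Eventually.of_forall fun ω => ?_)
  rw [Real.norm_eq_abs, bonus, abs_of_nonneg (by positivity)]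
  exact mul_le_of_le_one_right (Real.sqrt_nonneg _) (h.sqrt_le_one ω)

/-- Maximality of the query, with each posterior mean written as the value of `f` minus the
prediction error. -/
lemma IsAsyncUCB.ucb_le (hrun : IsAsyncUCB X k η β m f ε w A x) (j : ℕ) {z : Pt d} (hz : z ∈ X)
    (ω : Ω) : f z ω - runError k η f ε A x j z ω +
      Real.sqrt (β (j + 1)) * Real.sqrt (runVar k η A x j z ω) ≤
      f (x j ω) ω - runError k η f ε A x j (x j ω) ω + bonus k η β A x j ω := by
  have h := hrun.isMaxOn j ω hz
  simp only [ucb, Set.mem_ofPred_eq] at h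
  simp only [runError, bonus, runVar, sub_sub_cancel]
  exact h

/-- Comparison with a single point of `X`: on the unit cube the path varies by at most `L`, and both
prediction errors have mean zero. No lower bound on `β` enters. -/
lemma IsAsyncUCB.expectedGap_le (hM : IsModel P X k η f ε w) (hη : 0 < η)
    (hX : IsCompact X) (hcube : ∀ z ∈ X, ∀ i, z i ∈ Set.Icc (0 : ℝ) 1)
    (hk : ∀ z ∈ X, k z z ≤ 1) (hL : IsPathModulus P X f L)
    (hrun : IsAsyncUCB X k η β m f ε w A x) (j : ℕ) :
    expectedGap P X f x j ≤ ∫ ω, L ω ∂P + ∫ ω, bonus k η β A x j ω ∂P := by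
  obtain ⟨z₀, hz₀⟩ := hrun.nonempty P
  have hD := (hrun.isGaussianMixture_query hM hη hX hk hL j).2
  have hD₀ := hrun.isGaussianMixture_point hM hη hX hk hL j hz₀
  have hb := hrun.integrable_bonus hM hη hX hk hL j
  have hint := (hL.integrable.add (hD₀.integrable.sub hD.integrable)).add hb
  have hle : expectedGap P X f x j ≤ _ := integral_mono_ae
    ((hL.integrable_iSup hM ⟨z₀, hz₀⟩ hcube).sub
      (hrun.integrable_query hM hη hX hcube hk hL j)) hint ?_
  · refine hle.trans_eq ?_
    rw [integral_add' (hL.integrable.add (hD₀.integrable.sub hD.integrable)) hb,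
      integral_add' hL.integrable (hD₀.integrable.sub hD.integrable),
      integral_sub' hD₀.integrable hD.integrable, hD₀.integral_eq_zero, hD.integral_eq_zero]
    ring
  · filter_upwards [hL.ae_abs_sub_le hcube] with ω hω
    have : Nonempty X := ⟨⟨z₀, hz₀⟩⟩
    have h1 : ⨆ z : X, f z ω ≤ f z₀ ω + L ω := ciSup_le fun z => by
      linarith [(abs_le.mp (hω z z.2 z₀ hz₀)).2]
    have h2 := hrun.ucb_le j hz₀ ω
    have h3 : 0 ≤ Real.sqrt (β (j + 1)) * Real.sqrt (runVar k η A x j z₀ ω) := by positivity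
    simp only [Pi.sub_apply, Pi.add_apply]
    linarith

/-- The nearest grid point costs `L / N`. The excess at that random grid point is bounded by the sum
of the excesses over all of them, and the prediction error at the query has mean zero. -/
lemma IsAsyncUCB.expectedGap_le_grid (hM : IsModel P X k η f ε w) (hη : 0 < η)
    (hX : IsCompact X) (hcube : ∀ z ∈ X, ∀ i, z i ∈ Set.Icc (0 : ℝ) 1)
    (hk : ∀ z ∈ X, k z z ≤ 1) (hL : IsPathModulus P X f L)
    (hrun : IsAsyncUCB X k η β m f ε w A x) (j : ℕ) (hβ : 0 < β (j + 1)) {N : ℕ} (hN : 1 ≤ N) :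
    expectedGap P X f x j ≤ (∫ ω, L ω ∂P) / N + N ^ d *
      (Real.exp (-β (j + 1) / 2) / (Real.exp 1 * Real.sqrt (β (j + 1)))) +
      ∫ ω, bonus k η β A x j ω ∂P := by
  obtain ⟨z₀, hz₀⟩ := hrun.nonempty P
  obtain ⟨G, hGX, hGcard, hG⟩ := exists_grid hcube hN
  set K := Real.exp (-β (j + 1) / 2) / (Real.exp 1 * Real.sqrt (β (j + 1))) with hK
  have hK0 : 0 ≤ K := by positivity
  have hD := (hrun.isGaussianMixture_query hM hη hX hk hL j).2
  have hb := hrun.integrable_bonus hM hη hX hk hL j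
  set E : Pt d → Ω → ℝ := fun g ω => max (runError k η f ε A x j g ω -
    Real.sqrt (β (j + 1)) * Real.sqrt (runVar k η A x j g ω)) 0 with hE
  have hEi : ∀ g ∈ G, Integrable (E g) P := fun g hg =>
    (hrun.isGaussianMixture_point hM hη hX hk hL j (hGX g hg)).integrable_excess _
  have hEle : ∀ g ∈ G, ∫ ω, E g ω ∂P ≤ K := fun g hg =>
    (hrun.isGaussianMixture_point hM hη hX hk hL j (hGX g hg)).integral_excess_le hβ
  have hLN : Integrable (fun ω => L ω / N) P := hL.integrable.div_const _
  have hEs : Integrable (fun ω => ∑ g ∈ G, E g ω) P := integrable_finsetSum _ hEi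
  have hi₁ : Integrable (fun ω => L ω / N + ∑ g ∈ G, E g ω) P := hLN.add hEs
  have hi₂ : Integrable (fun ω => L ω / N + ∑ g ∈ G, E g ω -
      runError k η f ε A x j (x j ω) ω) P := hi₁.sub hD.integrable
  have hint : Integrable (fun ω => L ω / N + ∑ g ∈ G, E g ω -
      runError k η f ε A x j (x j ω) ω + bonus k η β A x j ω) P := hi₂.add hb
  have hle : expectedGap P X f x j ≤ ∫ ω, (L ω / N + ∑ g ∈ G, E g ω -
      runError k η f ε A x j (x j ω) ω + bonus k η β A x j ω) ∂P := by
    refine integral_mono_ae ((hL.integrable_iSup hM ⟨z₀, hz₀⟩ hcube).sub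
      (hrun.integrable_query hM hη hX hcube hk hL j)) hint ?_
    filter_upwards [hL.abs_sub_le] with ω hω
    have : Nonempty X := ⟨⟨z₀, hz₀⟩⟩
    have h1 : ⨆ z : X, f z ω ≤ L ω / N + ∑ g ∈ G, E g ω -
        runError k η f ε A x j (x j ω) ω + bonus k η β A x j ω + f (x j ω) ω := by
      refine ciSup_le fun z => ?_
      obtain ⟨g, hg, hzg⟩ := hG z z.2
      have h2 := (abs_le.mp (hω z z.2 g (hGX g hg) _ hzg)).2
      have h3 := hrun.ucb_le j (hGX g hg) ω
      have h4 : E g ω ≤ ∑ g ∈ G, E g ω :=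
        Finset.single_le_sum (f := fun g => E g ω) (fun g _ => le_max_right _ _) hg
      have h5 : runError k η f ε A x j g ω -
        Real.sqrt (β (j + 1)) * Real.sqrt (runVar k η A x j g ω) ≤ E g ω := le_max_left _ _
      rw [mul_one_div] at h2
      linarith
    linarith
  refine hle.trans ?_
  rw [integral_add hi₂ hb, integral_sub hi₁ hD.integrable, integral_add hLN hEs, hD.integral_eq_zero, sub_zero,
    integral_div, integral_finsetSum _ hEi]
  have h6 : ∑ g ∈ G, ∫ ω, E g ω ∂P ≤ N ^ d * K := by
    refine (Finset.sum_le_sum hEle).trans ?_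
    rw [Finset.sum_const, nsmul_eq_mul]
    exact mul_le_mul_of_nonneg_right (by exact_mod_cast hGcard) hK0
  linarith

lemma IsAsyncUCB.integrable_simpleRegret (hM : IsModel P X k η f ε w) (hη : 0 < η)
    (hX : IsCompact X) (hcube : ∀ z ∈ X, ∀ i, z i ∈ Set.Icc (0 : ℝ) 1)
    (hk : ∀ z ∈ X, k z z ≤ 1) (hL : IsPathModulus P X f L)
    (hrun : IsAsyncUCB X k η β m f ε w A x) {n : ℕ} (hn : 1 ≤ n) :
    Integrable (simpleRegret X f x n) P := by
  obtain ⟨z₀, hz₀⟩ := hrun.nonempty P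
  refine (hL.integrable_iSup hM ⟨z₀, hz₀⟩ hcube).sub (hL.integrable_of_between hM hz₀
    (AEMeasurable.iSup fun j : Fin n => (hrun.isGaussianMixture_query hM hη hX hk hL j).1) ?_)
  filter_upwards [hL.ae_abs_sub_le hcube] with ω hω
  have : Nonempty (Fin n) := ⟨⟨0, hn⟩⟩
  have hb : BddAbove (Set.range fun j : Fin n => f (x j ω) ω) := (Set.finite_range _).bddAbove
  rw [abs_le]
  constructor
  · have h1 := le_ciSup hb ⟨0, hn⟩
    have h2 := (abs_le.mp (hω _ (hrun.mem 0 ω) z₀ hz₀)).1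
    simp only at h1
    linarith
  · have h1 : ⨆ j : Fin n, f (x j ω) ω ≤ f z₀ ω + L ω := ciSup_le fun j => by
      linarith [(abs_le.mp (hω _ (hrun.mem j ω) z₀ hz₀)).2]
    linarith

lemma IsAsyncUCB.bayesSimpleRegret_le_expectedGap (hM : IsModel P X k η f ε w) (hη : 0 < η)
    (hX : IsCompact X) (hcube : ∀ z ∈ X, ∀ i, z i ∈ Set.Icc (0 : ℝ) 1)
    (hk : ∀ z ∈ X, k z z ≤ 1) (hL : IsPathModulus P X f L)
    (hrun : IsAsyncUCB X k η β m f ε w A x) {n j : ℕ} (hj : j < n) :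
    bayesSimpleRegret P X f x n ≤ expectedGap P X f x j := by
  refine integral_mono (hrun.integrable_simpleRegret hM hη hX hcube hk hL (by omega))
    ((hL.integrable_iSup hM (hrun.nonempty P) hcube).sub
      (hrun.integrable_query hM hη hX hcube hk hL j)) fun ω => ?_
  have hb : BddAbove (Set.range fun j : Fin n => f (x j ω) ω) := (Set.finite_range _).bddAbove
  have h1 := le_ciSup hb ⟨j, hj⟩
  simp only at h1
  simp only [simpleRegret]
  linarith

end Regret

/-! ### The sum of the discretization errors -/

/-- The sum is part of the series `π² / 6 < 1.645` without its first term. -/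
lemma sum_one_div_sq_le (n : ℕ) :
    ∑ j ∈ Finset.range n, 1 / ((j : ℝ) + 2) ^ 2 ≤ 0.645 := by
  have h1 := sum_le_hasSum (Finset.range (n + 2)) (fun i _ => by positivity) hasSum_zeta_two
  rw [Finset.sum_range_succ', Finset.sum_range_succ'] at h1
  push_cast at h1
  have h2 : Real.pi ^ 2 / 6 ≤ 1.645 := by nlinarith [Real.pi_lt_d4, Real.pi_gt_three]
  have h3 : ∑ j ∈ Finset.range n, 1 / ((j : ℝ) + 1 + 1) ^ 2 =
      ∑ j ∈ Finset.range n, 1 / ((j : ℝ) + 2) ^ 2 := by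
    refine Finset.sum_congr rfl fun j _ => ?_
    norm_num [add_assoc]
  rw [h3] at h1
  norm_num at h1 ⊢
  linarith

/-- The room available for the sum of all discretization errors; the numerical constants below are
tuned to fit into it. -/
lemma budget_ge : (1.031 : ℝ) ≤ (Real.pi ^ 2 + Real.sqrt (2 * Real.pi)) / 12 := by
  have h1 := Real.pi_gt_d4
  have h2 : (2.506 : ℝ) ≤ Real.sqrt (2 * Real.pi) := by
    refine Real.le_sqrt_of_sq_le ?_
    norm_num
    linarith
  have h3 : (9.8686 : ℝ) ≤ Real.pi ^ 2 := by nlinarith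
  linarith

/-- The discretization error of one query on the grid with `⌊τ⌋` cells per axis, `τ = θ J²`. -/
lemma grid_error_le {d J : ℕ} {θ b : ℝ} (hθ : 0 < θ) (hd : d ≠ 0) (hJ : 1 ≤ J)
    (hb : 4 * ((d : ℝ) + 1) * Real.log J + 2 * d * Real.log θ ≤ b)
    (hτ : 2 ≤ θ * J ^ 2) {R M κ : ℝ} (hκ0 : 0 < κ) (hκ : 1 / κ ≤ Real.exp 1 * Real.sqrt b)
    (hR : θ * J ^ 2 ≤ R * ⌊θ * J ^ 2⌋₊)
    (hM : ∀ r : ℝ, 1 ≤ r → r ≤ R → r ^ 2 / 2 + κ ≤ M * r) :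
    θ / 2 / ⌊θ * J ^ 2⌋₊ + (⌊θ * J ^ 2⌋₊ : ℝ) ^ d *
      (Real.exp (-b / 2) / (Real.exp 1 * Real.sqrt b)) ≤ M * (1 / (J : ℝ) ^ 2) := by
  have hJ0 : (0 : ℝ) < J := by exact_mod_cast hJ
  set τ := θ * (J : ℝ) ^ 2 with hτdef
  set N := ⌊τ⌋₊ with hN
  have hN1 : 1 ≤ N := Nat.le_floor (by norm_num; linarith)
  have hN0 : (0 : ℝ) < N := by exact_mod_cast hN1
  have hNτ : (N : ℝ) ≤ τ := Nat.floor_le (by linarith)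
  have hτ0 : 0 < τ := by linarith
  -- The loss from rounding `τ` down. In units of `1 / J ^ 2` the two errors are `r / 2` and at most
  -- `κ / r`, and `hM` bounds their sum by `M`.
  set r := τ / N with hr
  have hr1 : 1 ≤ r := (one_le_div hN0).mpr hNτ
  have hrR : r ≤ R := (div_le_iff₀ hN0).mpr hR
  have hr0 : 0 < r := by linarith
  -- Half the lower bound on `b` is `2 log J + d log τ`: the first part yields `1 / J ^ 2`, the
  -- second pays for the number of grid points.
  have hexp : Real.exp (-b / 2) ≤ 1 / (J : ℝ) ^ 2 * (1 / τ ^ d) := by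
    have h1 : Real.log τ = Real.log θ + 2 * Real.log J := by
      rw [hτdef, Real.log_mul hθ.ne' (by positivity), Real.log_pow]
      norm_num
    have h2 : -b / 2 ≤ -(2 * Real.log J + d * Real.log τ) := by
      rw [h1]; linarith
    refine (Real.exp_le_exp.mpr h2).trans_eq ?_
    rw [Real.exp_neg, Real.exp_add, mul_inv, one_div, one_div, ← Real.log_rpow hJ0,
      ← Real.log_pow, Real.exp_log (by positivity), Real.exp_log (by positivity)]
    norm_num
  -- One of the `d ≥ 1` factors `N / τ ≤ 1` is kept, and this provides the `1 / r` in the second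
  -- error.
  have hfrac : (N : ℝ) ^ d * (1 / τ ^ d) ≤ 1 / r := by
    rw [mul_one_div, ← div_pow, hr, one_div_div]
    exact pow_le_of_le_one (by positivity) ((div_le_one hτ0).mpr hNτ) hd
  have hinv : 1 / (Real.exp 1 * Real.sqrt b) ≤ κ := by
    rw [one_div_le (lt_of_lt_of_le (by positivity) hκ) hκ0]
    exact hκ
  have h3 : (N : ℝ) ^ d * (Real.exp (-b / 2) / (Real.exp 1 * Real.sqrt b)) ≤
      1 / (J : ℝ) ^ 2 * (κ / r) := by
    calc (N : ℝ) ^ d * (Real.exp (-b / 2) / (Real.exp 1 * Real.sqrt b))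
        = (N : ℝ) ^ d * Real.exp (-b / 2) * (1 / (Real.exp 1 * Real.sqrt b)) := by ring
      _ ≤ (N : ℝ) ^ d * (1 / (J : ℝ) ^ 2 * (1 / τ ^ d)) * κ := by gcongr
      _ = 1 / (J : ℝ) ^ 2 * κ * ((N : ℝ) ^ d * (1 / τ ^ d)) := by ring
      _ ≤ 1 / (J : ℝ) ^ 2 * κ * (1 / r) := by gcongr
      _ = _ := by ring
  have h4 : θ / 2 / N = 1 / (J : ℝ) ^ 2 * (r / 2) := by
    rw [hr, hτdef]; field_simp
  rw [h4]
  refine (add_le_add le_rfl h3).trans ?_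
  rw [← mul_add, mul_comm M]
  refine mul_le_mul_of_nonneg_left ?_ (by positivity)
  rw [div_add_div _ _ two_ne_zero hr0.ne', div_le_iff₀ (by positivity)]
  nlinarith [hM r hr1 hrR]

/-- Rounding down costs at most the factor `(m + 1) / m` once `τ ≥ m`. -/
lemma le_mul_floor {τ c : ℝ} {m : ℕ} (hm : 1 ≤ m) (hτ : (m : ℝ) ≤ τ)
    (hc : (m : ℝ) + 1 ≤ c * m) : τ ≤ c * ⌊τ⌋₊ := by
  have h1 : (m : ℝ) ≤ ⌊τ⌋₊ := by exact_mod_cast Nat.le_floor hτ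
  have h2 := (Nat.lt_floor_add_one τ).le
  have hm0 : (1 : ℝ) ≤ m := by exact_mod_cast hm
  nlinarith

lemma log_two_bounds : (0.693 : ℝ) < Real.log 2 ∧ Real.log 2 < 0.6932 :=
  ⟨by linarith [Real.log_two_gt_d9], by linarith [Real.log_two_lt_d9]⟩

lemma inv_le_exp_mul_sqrt {κ s b : ℝ} (hs : 0 ≤ s) (hb : s ^ 2 ≤ b) (hκ : 1 / κ ≤ 2.718 * s) :
    1 / κ ≤ Real.exp 1 * Real.sqrt b := by
  have h1 := Real.exp_one_gt_d9
  have h2 : s ≤ Real.sqrt b := Real.le_sqrt_of_sq_le hb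
  refine hκ.trans (mul_le_mul (by linarith) h2 hs (by positivity))

/-- The regret of the queries after the first one. -/
lemma gap_error_le {d J : ℕ} {θ b g : ℝ} (hθ : 0 ≤ θ) (hJ : 2 ≤ J) (hd0 : d = 0 → θ = 0)
    (hb : 4 * ((d : ℝ) + 1) * Real.log J + 2 * d * Real.log θ ≤ b) (hg1 : g ≤ θ / 2)
    (hg : 0 < b → ∀ N : ℕ, 1 ≤ N → g ≤ θ / 2 / N + (N : ℝ) ^ d *
      (Real.exp (-b / 2) / (Real.exp 1 * Real.sqrt b))) :
    g ≤ 1 / (J : ℝ) ^ 2 ∧ (3 / 4 ≤ θ → g ≤ 0.806 * (1 / (J : ℝ) ^ 2)) := by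
  have hJ2 : (2 : ℝ) ≤ J := by exact_mod_cast hJ
  have hJ0 : (0 : ℝ) < J := by linarith
  -- If `θ J ^ 2 < 2`, the crude bound `θ / 2` already lies below `1 / J ^ 2`. For `θ ≥ 3 / 4` this
  -- case is void, as `J ≥ 2` gives `θ J ^ 2 ≥ 3`.
  rcases lt_or_ge (θ * (J : ℝ) ^ 2) 2 with hτ | hτ
  · refine ⟨hg1.trans ?_, fun h => ?_⟩
    · rw [le_div_iff₀ (by positivity)]; linarith
    · nlinarith
  have hθ0 : 0 < θ := by
    rcases hθ.eq_or_lt with h | h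
    · rw [← h] at hτ; norm_num at hτ
    · exact h
  have hd : d ≠ 0 := fun h => hθ0.ne' (hd0 h)
  have hd1 : (1 : ℝ) ≤ d := by exact_mod_cast Nat.one_le_iff_ne_zero.mpr hd
  have hlogJ : Real.log 2 ≤ Real.log J := Real.log_le_log two_pos hJ2
  have hlogτ : Real.log 2 ≤ Real.log θ + 2 * Real.log J := by
    have := Real.log_le_log two_pos hτ
    rw [Real.log_mul hθ0.ne' (by positivity), Real.log_pow] at this
    exact_mod_cast this
  -- The lower bound regroups as `4 log J + 2 d (log θ + 2 log J) ≥ 6 log 2 > 4`. Hence `√b ≥ 2`,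
  -- and `κ = 0.184` below just exceeds `1 / (2 e)`.
  have hb4 : (2 : ℝ) ^ 2 ≤ b := by
    have := log_two_bounds.1
    nlinarith
  have hb0 : 0 < b := by linarith
  have hκ : 1 / (0.184 : ℝ) ≤ Real.exp 1 * Real.sqrt b :=
    inv_le_exp_mul_sqrt zero_le_two hb4 (by norm_num)
  have hN : 1 ≤ ⌊θ * (J : ℝ) ^ 2⌋₊ := Nat.le_floor (by norm_num; linarith)
  refine ⟨?_, fun h => ?_⟩
  -- Here `τ ≥ 2`, so rounding costs at most `3 / 2`. The quadratic inequality is convex in `r` and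
  -- needs checking only at the ends of `[1, 3 / 2]`.
  · have h1 := grid_error_le (R := 3 / 2) (M := 1) hθ0 hd (by omega) hb hτ (by norm_num) hκ
      (le_mul_floor (m := 2) (by norm_num) (by exact_mod_cast hτ) (by norm_num))
      (fun r h1 h2 => by nlinarith)
    rw [one_mul] at h1
    exact (hg hb0 _ hN).trans h1
  -- Here `τ ≥ 3`, so rounding costs at most `4 / 3`; the value `0.806` is dictated by the end `r =
  -- 4 / 3`.
  · have h1 := grid_error_le (R := 4 / 3) (M := 0.806) hθ0 hd (by omega) hb hτ (by norm_num) hκ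
      (le_mul_floor (m := 3) (by norm_num) (by norm_num; nlinarith) (by norm_num))
      (fun r h1 h2 => by norm_num; nlinarith)
    exact (hg hb0 _ hN).trans h1

/-- The regret of the first query. -/
lemma first_gap_error_le {d : ℕ} {θ b g : ℝ} (hd0 : d = 0 → θ = 0)
    (hb : 2 * d * Real.log θ ≤ b) (hg1 : g ≤ θ / 2)
    (hg : 0 < b → ∀ N : ℕ, 1 ≤ N → g ≤ θ / 2 / N + (N : ℝ) ^ d *
      (Real.exp (-b / 2) / (Real.exp 1 * Real.sqrt b))) : g ≤ 1 := by
  rcases le_or_gt θ 2 with hθ | hθ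
  · linarith
  have hθ0 : 0 < θ := by linarith
  have hd : d ≠ 0 := fun h => hθ0.ne' (hd0 h)
  have hd1 : (1 : ℝ) ≤ d := by exact_mod_cast Nat.one_le_iff_ne_zero.mpr hd
  have hlog : Real.log 2 ≤ Real.log θ := Real.log_le_log two_pos hθ.le
  -- With `J = 1` only `2 d log θ ≥ 2 log 2 > 1.386` is available, and `1.177` is just below its
  -- square root.
  have hb2 : (1.177 : ℝ) ^ 2 ≤ b := by
    have := log_two_bounds.1
    norm_num
    nlinarith
  have hb0 : 0 < b := lt_of_lt_of_le (by norm_num) hb2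
  have hκ : 1 / (0.3126 : ℝ) ≤ Real.exp 1 * Real.sqrt b :=
    inv_le_exp_mul_sqrt (by norm_num) hb2 (by norm_num)
  have h1 := grid_error_le (J := 1) (R := 3 / 2) (M := 0.96) hθ0 hd le_rfl (b := b)
    (by simpa using hb) (by simpa using hθ.le) (by norm_num) hκ
    (le_mul_floor (m := 2) (by norm_num) (by simpa using hθ.le) (by norm_num))
    (fun r h1 h2 => by norm_num; nlinarith)
  have hN : 1 ≤ ⌊θ * ((1 : ℕ) : ℝ) ^ 2⌋₊ := Nat.le_floor (by norm_num; linarith)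
  refine (hg hb0 _ hN).trans (h1.trans ?_)
  norm_num

/-- The sum of the gaps, up to the sum of the bonuses. If the gradient scale `θ` is large, the first
query is replaced by the last one. -/
lemma sum_gap_le {d n : ℕ} {θ : ℝ} {β gap bon : ℕ → ℝ} (hθ : 0 ≤ θ) (hd0 : d = 0 → θ = 0)
    (hβ : ∀ j : ℕ, 4 * ((d : ℝ) + 1) * Real.log (j + 1 : ℕ) + 2 * d * Real.log θ ≤ β (j + 1))
    (hg1 : ∀ j, gap j ≤ θ / 2 + bon j)
    (hg : ∀ j, 0 < β (j + 1) → ∀ N : ℕ, 1 ≤ N → gap j ≤ θ / 2 / N + (N : ℝ) ^ d *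
      (Real.exp (-β (j + 1) / 2) / (Real.exp 1 * Real.sqrt (β (j + 1)))) + bon j) :
    (n = 0 ∨ θ ≤ 1 → ∑ j ∈ Finset.range (n + 1), gap j ≤
      (Real.pi ^ 2 + Real.sqrt (2 * Real.pi)) / 12 + ∑ j ∈ Finset.range (n + 1), bon j) ∧
    (n ≠ 0 → 1 < θ → gap n + ∑ j ∈ Finset.range n, gap (j + 1) ≤
      (Real.pi ^ 2 + Real.sqrt (2 * Real.pi)) / 12 +
        (bon n + ∑ j ∈ Finset.range n, bon (j + 1))) := by
  have hbud := budget_ge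
  have hlate : ∀ j : ℕ, gap (j + 1) - bon (j + 1) ≤ 1 / ((j : ℝ) + 2) ^ 2 ∧
      (3 / 4 ≤ θ → gap (j + 1) - bon (j + 1) ≤ 0.806 * (1 / ((j : ℝ) + 2) ^ 2)) := by
    intro j
    have h := gap_error_le (d := d) (J := j + 2) (b := β (j + 1 + 1))
      (g := gap (j + 1) - bon (j + 1)) hθ (by omega) hd0 (hβ (j + 1)) (by linarith [hg1 (j + 1)])
      (fun h N hN => by linarith [hg (j + 1) h N hN])
    push_cast at h
    exact h
  have hfirst : gap 0 - bon 0 ≤ 1 := by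
    refine first_gap_error_le (b := β (0 + 1)) hd0 ?_ (by linarith [hg1 0])
      (fun h N hN => by linarith [hg 0 h N hN])
    simpa using hβ 0
  have hsum := sum_one_div_sq_le n
  have hsum1 : ∑ j ∈ Finset.range n, gap (j + 1) ≤
      ∑ j ∈ Finset.range n, bon (j + 1) + 0.645 := by
    have : ∑ j ∈ Finset.range n, gap (j + 1) ≤
        ∑ j ∈ Finset.range n, (bon (j + 1) + 1 / ((j : ℝ) + 2) ^ 2) :=
      Finset.sum_le_sum fun j _ => by linarith [(hlate j).1]
    rw [Finset.sum_add_distrib] at this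
    linarith
  have hsum2 : 3 / 4 ≤ θ → ∑ j ∈ Finset.range n, gap (j + 1) ≤
      ∑ j ∈ Finset.range n, bon (j + 1) + 0.52 := by
    intro h
    have : ∑ j ∈ Finset.range n, gap (j + 1) ≤
        ∑ j ∈ Finset.range n, (bon (j + 1) + 0.806 * (1 / ((j : ℝ) + 2) ^ 2)) :=
      Finset.sum_le_sum fun j _ => by linarith [(hlate j).2 h]
    rw [Finset.sum_add_distrib, ← Finset.mul_sum] at this
    nlinarith
  refine ⟨fun h => ?_, fun hn h => ?_⟩
  · rw [Finset.sum_range_succ', Finset.sum_range_succ' bon]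
    -- A single query costs at most `1`. Otherwise the first query costs at most `θ / 2`: for `θ ≤ 3
    -- / 4` the total is at most `0.375 + 0.645`, and for `3 / 4 < θ ≤ 1` at most `0.5 + 0.52`, both
    -- below `1.031`.
    rcases Nat.eq_zero_or_pos n with rfl | hn
    · simp only [Finset.range_zero, Finset.sum_empty, zero_add]
      linarith
    · have hθ1 : θ ≤ 1 := h.resolve_left hn.ne'
      have h0 := hg1 0
      rcases le_or_gt θ (3 / 4) with h34 | h34
      · linarith
      · linarith [hsum2 h34.le]
  -- The repeated last query has index at least `1` and so costs at most `0.806 / 4`, far less than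
  -- the first query could.
  · obtain ⟨n, rfl⟩ := Nat.exists_eq_succ_of_ne_zero hn
    have h1 := (hlate n).2 (by linarith)
    have h2 : 1 / ((n : ℝ) + 2) ^ 2 ≤ 1 / 4 := by
      refine one_div_le_one_div_of_le (by norm_num) ?_
      nlinarith [(Nat.cast_nonneg n : (0 : ℝ) ≤ n)]
    have h3 := hsum2 (by linarith)
    rw [Nat.succ_eq_add_one] at *
    linarith

/-! ### The Bayes simple regret -/

section SimpleRegret

variable {d : ℕ} {Ω W : Type*} [MeasurableSpace Ω] [MeasurableSpace W] {P : Measure Ω}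
  [IsProbabilityMeasure P] {X : Set (Pt d)} {k : Pt d → Pt d → ℝ} {η : ℝ} {f : Pt d → Ω → ℝ}
  {ε : ℕ → Ω → ℝ} {w : Ω → W} {β : ℕ → ℝ} {m : ℕ} {L : Ω → ℝ}
  {A : ℕ → Ω → Finset ℕ} {x : ℕ → Ω → Pt d} {ξ : ℝ}

/-- The information bound is applied to the pending evaluations at the run's own locations; together
with the completed ones they form the full history. -/
lemma IsAsyncUCB.ae_runVar_le (hM : IsModel P X k η f ε w) (hη : 0 < η)
    (hrun : IsAsyncUCB X k η β m f ε w A x) (hξ : PendingInfoBound P X m f ε A x ξ) :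
    ∀ᵐ ω ∂P, ∀ j, runVar k η A x j (x j ω) ω ≤
      ξ * postVar k η (Finset.range j) (fun i => x i ω) (x j ω) := by
  rw [ae_all_iff]
  intro j
  filter_upwards [hξ.2 j] with ω hω
  have h := hM.postVar_le_mul_of_condMutualInfo_le hη (x := fun i => x i ω)
    (fun i => hrun.mem i ω) (hrun.mem j ω) Finset.disjoint_sdiff hξ.1
    (hω (Finset.range j \ A j ω) Finset.sdiff_disjoint (hrun.pending_lt j ω)
      fun i => ⟨x i ω, hrun.mem i ω⟩)
  rwa [Finset.union_sdiff_of_subset (hrun.completed_subset j ω)] at h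

/-- The first query has maximal prior variance. -/
lemma IsAsyncUCB.prior_le_prior_first (hM : IsModel P X k η f ε w)
    (hrun : IsAsyncUCB X k η β m f ε w A x) (hβ : 0 < β 1) {z : Pt d} (hz : z ∈ X) (ω : Ω) :
    k z z ≤ k (x 0 ω) (x 0 ω) := by
  have hA : A 0 ω = ∅ := Finset.subset_empty.mp (by simpa using hrun.completed_subset 0 ω)
  have h := hrun.isMaxOn 0 ω hz
  have hmean : ∀ y u, postMean k η ∅ (fun i => x i ω) y u = 0 := fun y u => by
    simp [postMean, dotProduct]
  simp only [Set.mem_ofPred_eq, ucb, hA, hmean, postVar_empty, zero_add] at h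
  have h1 := le_of_mul_le_mul_left h (Real.sqrt_pos.mpr hβ)
  refine (Real.sqrt_le_sqrt_iff ?_).mp h1
  rw [← hM.cov_eq _ (hrun.mem 0 ω) _ (hrun.mem 0 ω),
    covariance_self (hM.measurable_f _ (hrun.mem 0 ω)).aemeasurable]
  exact variance_nonneg _ _

/-- Each bonus is at most the deviation along the full history, enlarged by `√ξ`, with the final `β`
by monotonicity. In the second form the extra copy of the last bonus takes the place of the first.
-/
lemma IsAsyncUCB.sum_integral_bonus_le (hM : IsModel P X k η f ε w) (hη : 0 < η)
    (hX : IsCompact X) (hk : ∀ z ∈ X, k z z ≤ 1) (hL : IsPathModulus P X f L)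
    (hβ_mono : ∀ i j, 1 ≤ i → i ≤ j → β i ≤ β j) (hβ_nonneg : ∀ j, 1 ≤ j → 0 ≤ β j)
    (hrun : IsAsyncUCB X k η β m f ε w A x) (hξ : PendingInfoBound P X m f ε A x ξ) (n : ℕ) :
    ∑ j ∈ Finset.range (n + 1), ∫ ω, bonus k η β A x j ω ∂P ≤
      (n + 1 : ℕ) * Real.sqrt (2 * (ξ * β (n + 1)) * maxInfoGain P X f ε (n + 1) /
        ((n + 1 : ℕ) * Real.log (1 + (η ^ 2)⁻¹))) ∧
    (0 < β 1 → ∫ ω, bonus k η β A x n ω ∂P +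
        ∑ j ∈ Finset.range n, ∫ ω, bonus k η β A x (j + 1) ω ∂P ≤
      (n + 1 : ℕ) * Real.sqrt (2 * (ξ * β (n + 1)) * maxInfoGain P X f ε (n + 1) /
        ((n + 1 : ℕ) * Real.log (1 + (η ^ 2)⁻¹)))) := by
  have hb := hrun.integrable_bonus hM hη hX hk hL
  have hβn := hβ_nonneg (n + 1) (by omega)
  have hξ0 : 0 ≤ ξ := zero_le_one.trans hξ.1
  have hc : 0 ≤ ξ * β (n + 1) := mul_nonneg hξ0 hβn
  have hterm : ∀ j, j ≤ n → ∀ {s t : ℝ}, 0 ≤ s → s ≤ ξ * t → Real.sqrt (β (j + 1)) * Real.sqrt s ≤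
      Real.sqrt (ξ * β (n + 1)) * Real.sqrt t := by
    intro j hj s t hs hst
    rw [← Real.sqrt_mul (hβ_nonneg _ (by omega)), ← Real.sqrt_mul hc]
    refine Real.sqrt_le_sqrt ?_
    calc β (j + 1) * s ≤ β (n + 1) * (ξ * t) :=
          mul_le_mul (hβ_mono _ _ (by omega) (by omega)) hst hs hβn
      _ = ξ * β (n + 1) * t := by ring
  have hvar0 : ∀ j ω, 0 ≤ runVar k η A x j (x j ω) ω := fun j ω =>
    hM.isFeature.postVar_nonneg hη (fun i => hrun.mem i ω) (hrun.mem j ω)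
  have hsum : ∀ ω, _ := fun ω => hM.sum_sqrt_postVar_le hη hk (x := fun i => x i ω)
    (fun i => hrun.mem i ω) hc (n := n + 1) (by omega)
  constructor
  · rw [← integral_finsetSum _ fun j _ => hb j]
    refine (integral_mono_ae (integrable_finsetSum _ fun j _ => hb j)
      (integrable_const _) ?_).trans_eq (by rw [integral_const, probReal_univ, one_smul])
    filter_upwards [hrun.ae_runVar_le hM hη hξ] with ω hω
    refine le_trans (Finset.sum_le_sum fun j hj => ?_) (hsum ω)
    exact hterm j (by have := Finset.mem_range.mp hj; omega) (hvar0 j ω) (hω j)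
  · intro hβ1
    have hi : Integrable (fun ω => ∑ j ∈ Finset.range n, bonus k η β A x (j + 1) ω) P :=
      integrable_finsetSum _ fun j _ => hb (j + 1)
    rw [← integral_finsetSum _ fun j _ => hb (j + 1), ← integral_add (hb n) hi]
    refine (integral_mono_ae ((hb n).add hi) (integrable_const _) ?_).trans_eq
      (by rw [integral_const, probReal_univ, one_smul])
    filter_upwards [hrun.ae_runVar_le hM hη hξ] with ω hω
    refine le_trans ?_ (hsum ω)
    rw [Finset.sum_range_succ', add_comm]
    refine add_le_add (Finset.sum_le_sum fun j hj => ?_) (hterm n le_rfl (hvar0 n ω) ?_)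
    · exact hterm (j + 1) (by have := Finset.mem_range.mp hj; omega) (hvar0 _ ω) (hω _)
    -- The posterior variance of the last query is at most its prior variance, hence at most that of
    -- the first query, which is the term for the empty history.
    · simp only [Finset.range_zero, postVar_empty]
      have h1 : runVar k η A x n (x n ω) ω ≤ k (x n ω) (x n ω) :=
        hM.isFeature.postVar_le_prior hη (fun i => hrun.mem i ω) (hrun.mem n ω)
      have h2 := hrun.prior_le_prior_first hM hβ1 (hrun.mem n ω) ω
      have h3 : 0 ≤ k (x 0 ω) (x 0 ω) := ((hvar0 n ω).trans h1).trans h2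
      exact (h1.trans h2).trans (le_mul_of_one_le_left h3 hξ.1)

/-- The regret is at most every gap, so `n` times the regret is at most a sum of `n` gaps, in which
a gap may be repeated. -/
lemma IsAsyncUCB.bayesSimpleRegret_le (hM : IsModel P X k η f ε w) (hη : 0 < η)
    (hX : IsCompact X) (hcube : ∀ z ∈ X, ∀ i, z i ∈ Set.Icc (0 : ℝ) 1)
    (hk : ∀ z ∈ X, k z z ≤ 1) (hL : IsPathModulus P X f L) {θ : ℝ} (hθ : 0 ≤ θ)
    (hd : d = 0 → θ = 0) (hLθ : ∫ ω, L ω ∂P ≤ θ / 2)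
    (hβ_mono : ∀ i j, 1 ≤ i → i ≤ j → β i ≤ β j) (hβ_nonneg : ∀ j, 1 ≤ j → 0 ≤ β j)
    (hβ : ∀ j : ℕ, 1 ≤ j → 4 * ((d : ℝ) + 1) * Real.log j + 2 * d * Real.log θ ≤ β j)
    (hrun : IsAsyncUCB X k η β m f ε w A x) (hξ : PendingInfoBound P X m f ε A x ξ) {n : ℕ}
    (hn : 1 ≤ n) :
    bayesSimpleRegret P X f x n ≤ (Real.pi ^ 2 + Real.sqrt (2 * Real.pi)) / (12 * n) +
      Real.sqrt (2 * ξ * β n * maxInfoGain P X f ε n / (n * Real.log (1 + (η ^ 2)⁻¹))) := by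
  obtain ⟨n, rfl⟩ : ∃ l, n = l + 1 := ⟨n - 1, by omega⟩
  have hgap := sum_gap_le (n := n) (β := β) (gap := expectedGap P X f x)
    (bon := fun j => ∫ ω, bonus k η β A x j ω ∂P) hθ hd (fun j => hβ (j + 1) (by omega))
    (fun j => (hrun.expectedGap_le hM hη hX hcube hk hL j).trans (by linarith))
    (fun j hj N hN => (hrun.expectedGap_le_grid hM hη hX hcube hk hL j hj hN).trans (by gcongr))
  have hbon := hrun.sum_integral_bonus_le hM hη hX hk hL hβ_mono hβ_nonneg hξ n
  have hreg : ∀ j, j < n + 1 → bayesSimpleRegret P X f x (n + 1) ≤ expectedGap P X f x j :=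
    fun j hj => hrun.bayesSimpleRegret_le_expectedGap hM hη hX hcube hk hL hj
  have hn0 : (0 : ℝ) < (n + 1 : ℕ) := by positivity
  set b := bayesSimpleRegret P X f x (n + 1)
  rw [mul_assoc 2 ξ]
  set S := Real.sqrt (2 * (ξ * β (n + 1)) * maxInfoGain P X f ε (n + 1) /
    ((n + 1 : ℕ) * Real.log (1 + (η ^ 2)⁻¹)))
  have key : ((n + 1 : ℕ) : ℝ) * b ≤
      (Real.pi ^ 2 + Real.sqrt (2 * Real.pi)) / 12 + (n + 1 : ℕ) * S := by
    -- For `θ > 1` and at least two queries the first gap is traded for a second copy of the last.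
    -- Here `log θ > 0` forces `β 1 > 0`, so the first query does maximize the prior variance.
    rcases or_iff_not_imp_left.mpr (fun h : ¬ (n = 0 ∨ θ ≤ 1) => not_or.mp h) with h | ⟨h0, h1⟩
    · have h2 := Finset.card_nsmul_le_sum (Finset.range (n + 1)) (expectedGap P X f x) b
        fun j hj => hreg j (Finset.mem_range.mp hj)
      rw [Finset.card_range, nsmul_eq_mul] at h2
      linarith [hgap.1 h, hbon.1]
    · have h1' : 1 < θ := not_le.mp h1
      have hd0 : d ≠ 0 := fun h => by linarith [hd h]
      have hβ1 : 0 < β 1 := by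
        have h3 := hβ 1 le_rfl
        have h4 : 0 < 2 * (d : ℝ) * Real.log θ := by
          have := Real.log_pos h1'
          have : (0 : ℝ) < d := by exact_mod_cast Nat.pos_of_ne_zero hd0
          positivity
        simp at h3
        linarith
      have h2 := Finset.card_nsmul_le_sum (Finset.range n) (fun j => expectedGap P X f x (j + 1)) b
        fun j hj => hreg (j + 1) (by have := Finset.mem_range.mp hj; omega)
      rw [Finset.card_range, nsmul_eq_mul] at h2
      have h5 := hreg n (by omega)
      push_cast at h2 ⊢
      have := hbon.2 hβ1
      push_cast at this
      linarith [hgap.2 h0 h1']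
  have hdiv : b ≤ ((Real.pi ^ 2 + Real.sqrt (2 * Real.pi)) / 12 + (n + 1 : ℕ) * S) / (n + 1 : ℕ) := by
    rw [le_div_iff₀ hn0]
    linarith
  refine hdiv.trans_eq ?_
  field_simp

/-- A process without variance has no regret. -/
lemma IsAsyncUCB.bayesSimpleRegret_eq_zero (hM : IsModel P X k η f ε w)
    (hL : IsPathModulus P X f L) (hrun : IsAsyncUCB X k η β m f ε w A x)
    (h0 : ∀ z ∈ X, k z z = 0) {n : ℕ} (hn : 1 ≤ n) : bayesSimpleRegret P X f x n = 0 := by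
  have hne := hrun.nonempty P
  obtain ⟨q, hq, hdense⟩ := exists_dense_sequence hne
  have hpt : ∀ z ∈ X, f z =ᵐ[P] 0 := by
    intro z hz
    have hv : variance (f z) P = 0 := by
      rw [← covariance_self (hM.measurable_f z hz).aemeasurable, hM.cov_eq z hz z hz, h0 z hz]
    have hev : evariance (f z) P = 0 := by
      rw [← ofReal_variance (hM.memLp_f hz), hv, ENNReal.ofReal_zero]
    filter_upwards [(evariance_eq_zero_iff (hM.measurable_f z hz).aemeasurable).mp hev] with ω hω
    rw [hω, hM.mean_zero z hz, Pi.zero_apply]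
  have hall : ∀ᵐ ω ∂P, ∀ i, f (q i) ω = 0 := ae_all_iff.mpr fun i => hpt _ (hq i)
  refine integral_eq_zero_of_ae ?_
  filter_upwards [hall, hL.abs_sub_le] with ω hω hlip
  have hcont : ContinuousOn (fun z => f z ω) X :=
    (LipschitzOnWith.of_dist_le_mul (K := ⟨L ω, hL.nonneg ω⟩) fun z hz z' hz' =>
      hlip z hz z' hz' _ (abs_coord_sub_le z z')).continuousOn
  have hzero : Set.EqOn (fun z => f z ω) (fun _ => 0) X :=
    Set.EqOn.of_subset_closure (s := Set.range q) (by rintro _ ⟨i, rfl⟩; exact hω i) hcont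
      continuousOn_const (by rintro _ ⟨i, rfl⟩; exact hq i) hdense
  have : Nonempty X := hne.to_subtype
  have : Nonempty (Fin n) := ⟨⟨0, hn⟩⟩
  have h1 : ∀ z : X, f z ω = 0 := fun z => hzero z.2
  have h2 : ∀ j : Fin n, f (x j ω) ω = 0 := fun j => hzero (hrun.mem j ω)
  simp [simpleRegret, h1, h2]

end SimpleRegret

/-! ### Asymptotic form -/

/-- The asymptotic bound holds only from some `N` on; below it monotonicity gives `β (N + 1)`, and
`log 2 ≤ log n` turns this constant into a multiple of `log n`. -/
lemma exists_le_mul_log {β : ℕ → ℝ} (hβ_mono : ∀ i j, 1 ≤ i → i ≤ j → β i ≤ β j)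
    (h : β =O[atTop] (fun n : ℕ => Real.log n)) :
    ∃ B, 0 ≤ B ∧ ∀ n, 2 ≤ n → β n ≤ B * Real.log n := by
  obtain ⟨c, hc⟩ := h.bound
  obtain ⟨N, hN⟩ := eventually_atTop.mp hc
  have hl2 : 0 < Real.log 2 := Real.log_pos one_lt_two
  refine ⟨|c| + |β (N + 1)| / Real.log 2, by positivity, fun n hn => ?_⟩
  have hl : Real.log 2 ≤ Real.log n := Real.log_le_log two_pos (by exact_mod_cast hn)
  have hl0 : 0 < Real.log n := hl2.trans_le hl
  rw [add_mul]
  rcases le_total N n with h1 | h1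
  · have h2 := hN n h1
    rw [Real.norm_eq_abs, Real.norm_eq_abs, abs_of_pos hl0] at h2
    have h3 : c * Real.log n ≤ |c| * Real.log n := by gcongr; exact le_abs_self c
    have h4 : 0 ≤ |β (N + 1)| / Real.log 2 * Real.log n := by positivity
    linarith [le_abs_self (β n)]
  · have h2 : |β (N + 1)| ≤ |β (N + 1)| / Real.log 2 * Real.log n := by
      rw [div_mul_eq_mul_div, le_div_iff₀ hl2]
      gcongr
    have h3 := hβ_mono n (N + 1) (by omega) (by omega)
    have h4 : 0 ≤ |c| * Real.log n := by positivity
    linarith [le_abs_self (β (N + 1))]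

/-- The term of order `1 / n` is absorbed: `Ψ ≥ c`, `ξ ≥ 1`, `log n ≥ log 2` and `n ≤ n ^ 2` bound
`√(c log 2) / n` by the rate. -/
lemma rate_le {a b B c l n ξ r Ψ : ℝ} (ha : 0 ≤ a) (hB : 0 ≤ B) (hc : 0 < c) (hl : 0 < l)
    (hn : 2 ≤ n) (hξ : 1 ≤ ξ) (hb : b ≤ B * Real.log n) (hΨ : c ≤ Ψ)
    (hr : r ≤ a / (12 * n) + Real.sqrt (2 * ξ * b * Ψ / (n * l))) :
    r ≤ (a / (12 * Real.sqrt (Real.log 2 * c)) + Real.sqrt (2 * B / l)) *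
      Real.sqrt (ξ * Real.log n * Ψ / n) := by
  have hl2 : 0 < Real.log 2 := Real.log_pos one_lt_two
  have hln : Real.log 2 ≤ Real.log n := Real.log_le_log two_pos hn
  have hn0 : 0 < n := by linarith
  have hΨ0 : 0 < Ψ := hc.trans_le hΨ
  have hs : 0 < Real.sqrt (Real.log 2 * c) := Real.sqrt_pos.mpr (by positivity)
  have h1 : Real.sqrt (Real.log 2 * c) / n ≤ Real.sqrt (ξ * Real.log n * Ψ / n) := by
    refine Real.le_sqrt_of_sq_le ?_
    rw [div_pow, Real.sq_sqrt (by positivity)]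
    have h2 : Real.log 2 * c ≤ ξ * Real.log n * Ψ :=
      mul_le_mul (hln.trans (le_mul_of_one_le_left (hl2.le.trans hln) hξ)) hΨ hc.le
        (mul_nonneg (by linarith) (hl2.le.trans hln))
    refine div_le_div₀ (by nlinarith [mul_pos hl2 hc]) h2 hn0 (by nlinarith)
  have h3 : a / (12 * n) ≤ a / (12 * Real.sqrt (Real.log 2 * c)) *
      Real.sqrt (ξ * Real.log n * Ψ / n) := by
    refine le_trans (le_of_eq ?_) (mul_le_mul_of_nonneg_left h1 (by positivity))
    field_simp
  have h4 : Real.sqrt (2 * ξ * b * Ψ / (n * l)) ≤ Real.sqrt (2 * B / l) *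
      Real.sqrt (ξ * Real.log n * Ψ / n) := by
    rw [← Real.sqrt_mul (by positivity)]
    refine Real.sqrt_le_sqrt ?_
    have h5 : 2 * ξ * b * Ψ ≤ 2 * ξ * (B * Real.log n) * Ψ := by gcongr
    refine (div_le_div_of_nonneg_right h5 (by positivity)).trans_eq ?_
    field_simp
  rw [add_mul]
  linarith

end AsyncBO

/-! ### The theorem -/

theorem theorem2 {d : ℕ} {Ω W : Type*} [MeasurableSpace Ω] [MeasurableSpace W]
    (P : Measure Ω) [IsProbabilityMeasure P]
    (X D : Set (AsyncBO.Pt d)) (hX : IsCompact X) (hXcube : ∀ z ∈ X, ∀ i, z i ∈ Set.Icc (0 : ℝ) 1)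
    (hXD : X ⊆ D) (hD : Convex ℝ D)
    (k : AsyncBO.Pt d → AsyncBO.Pt d → ℝ) (hk : ∀ z ∈ X, k z z ≤ 1)
    (η : ℝ) (hη : 0 < η)
    (f : AsyncBO.Pt d → Ω → ℝ) (ε : ℕ → Ω → ℝ) (w : Ω → W)
    (hmodel : AsyncBO.IsModel P D k η f ε w)
    (a b : ℝ) (ha : 0 < a) (hb : 0 < b) (hgrad : AsyncBO.GradientTails P D f a b)
    (β : ℕ → ℝ) (hβ_mono : ∀ i j, 1 ≤ i → i ≤ j → β i ≤ β j)
    (hβ_nonneg : ∀ j, 1 ≤ j → 0 ≤ β j)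
    (hβ : ∀ j : ℕ, 1 ≤ j →
      4 * ((d : ℝ) + 1) * Real.log j + 2 * d * Real.log (d * a * b * Real.sqrt Real.pi) ≤ β j) :
    (∀ (q : ℕ) (A : ℕ → Ω → Finset ℕ) (x : ℕ → Ω → AsyncBO.Pt d) (ξ : ℝ),
      AsyncBO.IsAsyncUCB X k η β q f ε w A x → AsyncBO.PendingInfoBound P X q f ε A x ξ →
      ∀ n : ℕ, 1 ≤ n →
        Integrable (AsyncBO.simpleRegret X f x n) P ∧
        AsyncBO.bayesSimpleRegret P X f x n ≤
          (Real.pi ^ 2 + Real.sqrt (2 * Real.pi)) / (12 * n) +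
            Real.sqrt (2 * ξ * β n * AsyncBO.maxInfoGain P X f ε n /
              (n * Real.log (1 + (η ^ 2)⁻¹)))) ∧
    (β =O[atTop] (fun n : ℕ => Real.log n) →
      ∃ C : ℝ, 0 < C ∧
        ∀ (q : ℕ) (A : ℕ → Ω → Finset ℕ) (x : ℕ → Ω → AsyncBO.Pt d) (ξ : ℝ),
          AsyncBO.IsAsyncUCB X k η β q f ε w A x → AsyncBO.PendingInfoBound P X q f ε A x ξ →
          ∀ n : ℕ, 2 ≤ n →
            AsyncBO.bayesSimpleRegret P X f x n ≤
              C * Real.sqrt (ξ * Real.log n * AsyncBO.maxInfoGain P X f ε n / n)) := by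
  have hM := hmodel.mono hXD
  obtain ⟨L, hLm, hL0, hLi, hLint, hLip⟩ := hgrad.exists_lipschitz ha hb hD
  have hL : AsyncBO.IsPathModulus P X f L := ⟨hLm, hL0, hLi, by
    filter_upwards [hLip] with ω hω z hz z' hz'
    exact hω z (hXD hz) z' (hXD hz')⟩
  have hθ : 0 ≤ d * a * b * Real.sqrt Real.pi := by positivity
  have hbound : ∀ (q : ℕ) (A : ℕ → Ω → Finset ℕ) (x : ℕ → Ω → AsyncBO.Pt d) (ξ : ℝ),
      AsyncBO.IsAsyncUCB X k η β q f ε w A x → AsyncBO.PendingInfoBound P X q f ε A x ξ →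
      ∀ n : ℕ, 1 ≤ n → AsyncBO.bayesSimpleRegret P X f x n ≤
        (Real.pi ^ 2 + Real.sqrt (2 * Real.pi)) / (12 * n) +
          Real.sqrt (2 * ξ * β n * AsyncBO.maxInfoGain P X f ε n /
            (n * Real.log (1 + (η ^ 2)⁻¹))) :=
    fun q A x ξ hrun hξ n hn => hrun.bayesSimpleRegret_le hM hη hX hXcube hk hL hθ
      (fun h => by simp [h]) hLint hβ_mono hβ_nonneg hβ hξ hn
  refine ⟨fun q A x ξ hrun hξ n hn =>
    ⟨hrun.integrable_simpleRegret hM hη hX hXcube hk hL hn, hbound q A x ξ hrun hξ n hn⟩,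
    fun hO => ?_⟩
  -- If the prior variance vanishes on `X`, there is no positive lower bound on the information
  -- gain, but the regret is zero.
  by_cases h0 : ∀ z ∈ X, k z z = 0
  · refine ⟨1, one_pos, fun q A x ξ hrun _ n hn => ?_⟩
    rw [hrun.bayesSimpleRegret_eq_zero hM hL h0 (by omega)]
    positivity
  · push Not at h0
    obtain ⟨z, hz, hz0⟩ := h0
    have hkz : 0 < k z z := by
      refine lt_of_le_of_ne ?_ hz0.symm
      rw [← hM.cov_eq z hz z hz, covariance_self (hM.measurable_f z hz).aemeasurable]
      exact variance_nonneg _ _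
    obtain ⟨B, hB, hβB⟩ := AsyncBO.exists_le_mul_log hβ_mono hO
    have hc : 0 < 1 / 2 * Real.log (1 + k z z / η ^ 2) :=
      mul_pos (by norm_num) (Real.log_pos (by linarith [div_pos hkz (pow_pos hη 2)]))
    have hl : 0 < Real.log (1 + (η ^ 2)⁻¹) :=
      Real.log_pos (by linarith [inv_pos.mpr (pow_pos hη 2)])
    -- The constant is the one in `rate_le`; it involves only `β`, `η` and the prior variance at
    -- `z`, so it is the same for all runs.
    refine ⟨_, ?_, fun q A x ξ hrun hξ n hn =>
      AsyncBO.rate_le (by positivity) hB hc hl (by exact_mod_cast hn) hξ.1 (hβB n hn)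
        (hM.le_maxInfoGain hη hk hz (by omega)) (hbound q A x ξ hrun hξ n (by omega))⟩
    have hs : 0 < Real.sqrt (Real.log 2 * (1 / 2 * Real.log (1 + k z z / η ^ 2))) :=
      Real.sqrt_pos.mpr (mul_pos (Real.log_pos one_lt_two) hc)
    positivity
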